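/- Let $k$ be a field, $n\ge 0$, and let $C_n$ be the free commutative $k$-algebra on isomorphism classes of finite rooted trees with edges coloured by $\{1,\dots,n\}$. Its monomials are the forests, and $|x|$ denotes the number of vertices of a forest $x$. Let $\lambda:C_n^{\otimes n}\to C_n$ be the linear map sending forests $x_1,\dots,x_n$ to the tree obtained by adding a new root and joining it to the root of every tree of $x_i$ by an edge of colour $i$. Fix $\mathbf p\subseteq\{1,\dots,n\}$ and put $q_{1j}=\chi_{\mathbf p}(j)$, $q_{2j}=0$ (with $0^0=1$) and $\sigma_i(x_1,\dots,x_n)=\prod_j q_{ij}^{|x_j|}\,x_1\cdots x_n$ for forests $x_j$. For a forest $t$ and a set $s$ of its vertices (with the induced order, where the edge from $w$ up to $v$ in $s$ has the colour of the first edge of the path from $w$ up to $v$ in $t$), let $p_j(v,s,t)$ be the number of edges of colour $j$ on the path from $v$ to the root whose lower vertex (the end nearer to the root) is not in $s$, and $$q(s,t)=\prod_j q_{1j}^{\sum_{v\in s}p_j(v,s,t)}\prod_j q_{2j}^{\sum_{v\in s^c}p_j(v,s^c,t)} .$$ Let $C_n^*$ be the graded dual of $C_n$ (graded by number of vertices),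 with the coproduct dual to the multiplication of $C_n$, and let $P(C_n^*)$ be its space of primitive elements. For a tree $t$ let $D_t\in C_n^*$ be the functional that is $1$ on $t$ and $0$ on all other forests. Define the bilinear operation $*$ by $(f*g)(t)=\sum_{s\subset t}q(s,t)\,f(s)\,g(s^c)$ for trees $t$, and $(f*g)(u)=0$ for forests $u$ that are not trees; thus $D_a*D_b=\sum_w\big(\sum_{s\subset w,\ s\cong a,\ s^c\cong b}q(s,w)\big)D_w$, where $w$ runs over trees. A (right) pre-Lie algebra is a vector space with a bilinear product $\circ$ such that $(x\circ y)\circ z-x\circ(y\circ z)=(x\circ z)\circ y-x\circ(z\circ y)$. (i) There is a unique morphism of unital algebras $\Delta:C_n\to C_n\otimes C_n$ with $\Delta\circ\lambda=(\sigma_1\otimes\lambda+\lambda\otimes\sigma_2)\circ\tau\circ\Delta^{\otimes n}$, where $\tau:(C_n\otimes C_n)^{\otimes n}\to C_n^{\otimes n}\otimes C_n^{\otimes n}$ is the permutation of tensor factors. For every tree $t$ $$\Delta(t)=t\otimes 1+\sum_c P^c(t)\otimes R^c(t),$$ where $c$ runs over the admissible cuts of $t$, including the empty one, that consist of edges of the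 $\mathbf p$-connected component of $t$ (the vertices joined to the root by a path with all colours in $\mathbf p$). Here a cut is a set of edges, it is admissible if every path from a leaf to the root contains at most one of its edges, $R^c(t)$ is the component of the root after removal of $c$, and $P^c(t)$ is the complement of $R^c(t)$. Moreover $(f*g)(t)=(f\otimes g)(\Delta(t))$ for all functionals $f,g$ on $C_n$ and all trees $t$. The elements $D_t$ form a basis of $P(C_n^*)$, the operation $*$ restricts to $P(C_n^*)$, and $P(C_n^*)$ with the opposite product $f\circ g:=g*f$ is a (right) pre-Lie algebra. (ii) Suppose in addition that $\mathbf p=\{1,\dots,n\}$, $n\ge 1$ and $\operatorname{char}k=0$. Let $L_n$ be the vector space with basis the isomorphism classes of rooted trees with vertices coloured by $\{1,\dots,n\}$, with the product $t\circ s=\sum_{v\in t}s\circ_v t$, where $s\circ_v t$ is $s$ grafted onto the vertex $v$ of $t$ (the standard model of the free pre-Lie algebra on $n$ generators). Then $L_n$ is a (right) pre-Lie algebra, and there is an injective linear map $\Phi:P(C_n^*)\to L_n$ with $\Phi(f\circ g)=\Phi(f)\circ\Phi(g)$ and $$\Phi(D_t)=\frac1{|\operatorname{Aut}(t)|}\sum_{i=1}^n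 t_i ,$$ where $t_i$ is obtained from $t$ by giving each non-root vertex the colour of the edge that ends in it from below, and the root the colour $i$. The image of $\Phi$ is spanned by all sums $\sum_{i=1}^n r_i(T)$, where $T$ is a vertex-coloured tree and $r_i(T)$ is $T$ with the colour of the root changed to $i$. -/

import Mathlib

open scoped TensorProduct

noncomputable section

namespace ColoredTrees

/-! ## Finite forests with colored edges and labeled vertices -/

/-- A rooted forest with vertex set `V` (finite in all uses below), edges colored by `E` and
vertices labeled by `L`, the roots being the minimal elements of the partial order.

`R e w v` means: `w < v` (so `w` is nearer to the root), and the first edge of the path that leads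
from `w` up to `v` has color `e`.  Thus `w < v` is `∃ e, R e w v`, and the color of an edge
(a covering pair) `w < v` is the unique `e` with `R e w v`.  An edge coloring determines `R`, and is
recovered from `R` by looking at the edges only.  With this encoding the restriction of `R` to a
subset of `V` is the induced order, where the edge from `w` to `v` of the subforest has the color of
the edge that leaves `w` on the path from `w` up to `v` in the original forest. -/
structure ColForest (E L V : Type) where
  R : E → V → V → Prop
  irrefl : ∀ e v, ¬ R e v v
  color_unique : ∀ e e' w v, R e w v → R e' w v → e = e'
  /-- transitivity of the order; the first edge from `w` to `v` is the first edge from `w` to `x` -/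
  trans : ∀ e e' w x v, R e w x → R e' x v → R e w v
  /-- the elements below a given element are linearly ordered -/
  down_linear : ∀ e e' x y z, y ≠ z → R e y x → R e' z x → (∃ d, R d y z) ∨ (∃ d, R d z y)
  label : V → L

namespace ColForest

variable {E L V W : Type}

/-- The strict order of the forest. -/
def lt (F : ColForest E L V) (w v : V) : Prop := ∃ e, F.R e w v

/-- The order of the forest. -/
def le (F : ColForest E L V) (w v : V) : Prop := w = v ∨ F.lt w v

/-- The forest structure pulled back along an injection: the induced subforest. -/
def comap (F : ColForest E L V) (f : W → V) (hf : Function.Injective f) : ColForest E L W where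
  R e w v := F.R e (f w) (f v)
  irrefl e v := F.irrefl e (f v)
  color_unique e e' w v := F.color_unique e e' (f w) (f v)
  trans e e' w x v := F.trans e e' (f w) (f x) (f v)
  down_linear e e' x y z hyz := F.down_linear e e' (f x) (f y) (f z) (fun h => hyz (hf h))
  label v := F.label (f v)

/-- The subforest on a set of vertices. -/
def sub (F : ColForest E L V) (S : Set V) : ColForest E L S :=
  F.comap Subtype.val Subtype.val_injective

/-- Isomorphisms: bijections that preserve the order, the edge colors and the vertex labels. -/
structure Iso (F : ColForest E L V) (G : ColForest E L W) extends V ≃ W where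
  map_R : ∀ e w v, F.R e w v ↔ G.R e (toEquiv w) (toEquiv v)
  map_label : ∀ v, F.label v = G.label (toEquiv v)

/-- `r` is the root of `F`, i.e. its least element. -/
def IsRoot (F : ColForest E L V) (r : V) : Prop := ∀ v, v ≠ r → F.lt r v

/-- A tree is a forest with a least element. -/
def IsTree (F : ColForest E L V) : Prop := ∃ r, F.IsRoot r

theorem IsTree.comap_equiv {F : ColForest E L V} (hF : F.IsTree) (f : W ≃ V) :
    (F.comap f f.injective).IsTree := by
  obtain ⟨r, hr⟩ := hF
  refine ⟨f.symm r, fun v hv => ?_⟩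
  obtain ⟨e, he⟩ := hr (f v) (fun h => hv (by rw [← h, Equiv.symm_apply_apply]))
  exact ⟨e, by simpa [comap] using he⟩

/-- `v` is the root of a connected component of the forest. -/
def IsMinimal (F : ColForest E L V) (r : V) : Prop := ∀ v, ¬ F.lt v r

/-- The connected component of a forest with root `r` (for arbitrary `r`: the branch above `r`). -/
def component (F : ColForest E L V) (r : V) : ColForest E L {v | F.le r v} :=
  F.sub {v | F.le r v}

theorem component_isTree (F : ColForest E L V) (r : V) : (F.component r).IsTree := by
  refine ⟨⟨r, Or.inl rfl⟩, fun v hv => ?_⟩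
  rcases v.2 with h | ⟨e, he⟩
  · exact absurd (Subtype.ext h.symm) hv
  · exact ⟨e, he⟩

/-- The pair `(w, v)` is an edge. -/
def IsEdge (F : ColForest E L V) (w v : V) : Prop :=
  F.lt w v ∧ ∀ x, ¬ (F.lt w x ∧ F.lt x v)

/-- A leaf is a vertex with no vertex above it. -/
def IsLeaf (F : ColForest E L V) (m : V) : Prop := ∀ v, ¬ F.lt m v

/-- Grafting: put a copy of the tree `G` (with root `r`) on the vertex `v` of `F` by a new edge of
color `e` from `v` to `r`. -/
def graft (G : ColForest E L W) (F : ColForest E L V) (v : V) (e : E) :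
    ColForest E L (V ⊕ W) where
  R c x y :=
    match x, y with
    | .inl a, .inl b => F.R c a b
    | .inr a, .inr b => G.R c a b
    | .inl a, .inr _ => (a = v ∧ c = e) ∨ F.R c a v
    | .inr _, .inl _ => False
  irrefl c x := by
    cases x
    · exact F.irrefl c _
    · exact G.irrefl c _
  color_unique c c' x y h h' := by
    cases x <;> cases y
    · exact F.color_unique _ _ _ _ h h'
    · rcases h with ⟨h1, h2⟩ | h <;> rcases h' with ⟨h1', h2'⟩ | h'
      · rw [h2, h2']
      · subst h1; exact absurd h' (F.irrefl _ _)
      · subst h1'; exact absurd h (F.irrefl _ _)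
      · exact F.color_unique _ _ _ _ h h'
    · exact h.elim
    · exact G.color_unique _ _ _ _ h h'
  trans c c' x y z h h' := by
    cases x <;> cases y <;> cases z <;> simp only at h h' ⊢
    · exact F.trans _ _ _ _ _ h h'
    · rcases h' with ⟨h1, _⟩ | h'
      · subst h1; exact Or.inr h
      · exact Or.inr (F.trans _ _ _ _ _ h h')
    · exact h
    · exact G.trans _ _ _ _ _ h h'
  down_linear c c' x y z hyz h h' := by
    cases x <;> cases y <;> cases z <;> simp only at h h' ⊢
    · exact F.down_linear _ _ _ _ _ (fun h => hyz (by rw [h])) h h'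
    · rcases h with ⟨h1, _⟩ | h <;> rcases h' with ⟨h1', _⟩ | h'
      · exact absurd (by rw [h1, h1']) hyz
      · subst h1; exact Or.inr ⟨_, h'⟩
      · subst h1'; exact Or.inl ⟨_, h⟩
      · exact F.down_linear _ _ _ _ _ (fun h => hyz (by rw [h])) h h'
    · rcases h with ⟨h1, h2⟩ | h
      · exact Or.inl ⟨c, Or.inl ⟨h1, h2⟩⟩
      · exact Or.inl ⟨c, Or.inr h⟩
    · rcases h' with ⟨h1, h2⟩ | h'
      · exact Or.inr ⟨c', Or.inl ⟨h1, h2⟩⟩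
      · exact Or.inr ⟨c', Or.inr h'⟩
    · exact G.down_linear _ _ _ _ _ (fun h => hyz (by rw [h])) h h'
  label x := Sum.elim F.label G.label x

theorem graft_isTree {G : ColForest E L W} {F : ColForest E L V} (hF : F.IsTree) (v : V) (e : E) :
    (G.graft F v e).IsTree := by
  obtain ⟨r, hr⟩ := hF
  refine ⟨Sum.inl r, fun x hx => ?_⟩
  cases x with
  | inl a =>
    obtain ⟨c, hc⟩ := hr a (fun h => hx (by rw [h]))
    exact ⟨c, hc⟩
  | inr b =>
    by_cases h : v = r
    · exact ⟨e, Or.inl ⟨h.symm, rfl⟩⟩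
    · obtain ⟨c, hc⟩ := hr v h
      exact ⟨c, Or.inr hc⟩

/-- The tree with a new root, labeled `l`, to which the roots of the forests `B i` are connected
by edges of color `c i`. -/
def node {ι : Type} {W : ι → Type} (B : ∀ i, ColForest E L (W i)) (c : ι → E) (l : L) :
    ColForest E L (Option (Σ i, W i)) where
  R e x y :=
    match x, y with
    | none, some y => e = c y.1
    | some x, some y => ∃ i a b, x = ⟨i, a⟩ ∧ y = ⟨i, b⟩ ∧ (B i).R e a b
    | _, none => False
  irrefl e x := by
    cases x with
    | none => exact id
    | some x =>
      rintro ⟨i, a, b, rfl, h, h'⟩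
      cases h
      exact (B i).irrefl e a h'
  color_unique e e' x y h h' := by
    cases y with
    | none => exact (by cases x <;> exact h.elim)
    | some y =>
      cases x with
      | none => exact h.trans h'.symm
      | some x =>
        obtain ⟨i, a, b, rfl, rfl, h⟩ := h
        obtain ⟨_, _, _, h1, h2, h'⟩ := h'
        cases h1
        cases h2
        exact (B i).color_unique _ _ _ _ h h'
  trans e e' x y z h h' := by
    cases z with
    | none => exact (by cases y <;> exact h'.elim)
    | some z =>
      cases y with
      | none => exact (by cases x <;> exact h.elim)
      | some y =>
        obtain ⟨j, a, b, rfl, rfl, h'⟩ := h'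
        cases x with
        | none => exact h
        | some x =>
          obtain ⟨i, a', b', rfl, h2, h⟩ := h
          cases h2
          exact ⟨j, a', b, rfl, rfl, (B j).trans _ _ _ _ _ h h'⟩
  down_linear e e' x y z hyz h h' := by
    cases x with
    | none => exact (by cases y <;> exact h.elim)
    | some x =>
      cases y with
      | none =>
        cases z with
        | none => exact absurd rfl hyz
        | some z => exact Or.inl ⟨_, rfl⟩
      | some y =>
        cases z with
        | none => exact Or.inr ⟨_, rfl⟩
        | some z =>
          obtain ⟨i, a, b, rfl, rfl, h⟩ := h
          obtain ⟨_, a', b', rfl, h2, h'⟩ := h'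
          cases h2
          rcases (B i).down_linear _ _ _ _ _ (fun hh => hyz (by rw [hh])) h h' with
            ⟨d, hd⟩ | ⟨d, hd⟩
          · exact Or.inl ⟨d, i, a, a', rfl, rfl, hd⟩
          · exact Or.inr ⟨d, i, a', a, rfl, rfl, hd⟩
  label x :=
    match x with
    | none => l
    | some x => (B x.1).label x.2

theorem node_isTree {ι : Type} {W : ι → Type} (B : ∀ i, ColForest E L (W i)) (c : ι → E) (l : L) :
    (node B c l).IsTree := by
  refine ⟨none, fun v hv => ?_⟩
  cases v with
  | none => exact absurd rfl hv
  | some v => exact ⟨_, rfl⟩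

end ColForest

/-! ## Isomorphism classes of trees -/

/-- Trees whose set of vertices is `{0, …, m - 1}` for some `m`. -/
def PreTree (E L : Type) : Type := Σ m : ℕ, {F : ColForest E L (Fin m) // F.IsTree}

/-- Isomorphism of trees. -/
def treeSetoid (E L : Type) : Setoid (PreTree E L) where
  r s t := Nonempty (s.2.1.Iso t.2.1)
  iseqv :=
    { refl := fun s => ⟨⟨Equiv.refl _, fun _ _ _ => Iff.rfl, fun _ => rfl⟩⟩
      symm := by
        rintro s t ⟨f⟩
        exact ⟨⟨f.toEquiv.symm, fun e w v => by simp [f.map_R], fun v => by simp [f.map_label]⟩⟩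
      trans := by
        rintro s t u ⟨f⟩ ⟨g⟩
        exact ⟨⟨f.toEquiv.trans g.toEquiv, fun e w v => by simp [f.map_R, g.map_R],
          fun v => by simp [f.map_label, g.map_label]⟩⟩ }

/-- Isomorphism classes of finite rooted trees with edges colored by `E` and vertices labeled
by `L`. -/
def RTree (E L : Type) : Type := Quotient (treeSetoid E L)

/-- Rooted trees with edges colored by `{1, …, n}` (and no vertex labels). -/
abbrev ETree (n : ℕ) : Type := RTree (Fin n) Unit

/-- Rooted trees with vertices labeled by `{1, …, n}` (and no edge colors). -/
abbrev VTree (n : ℕ) : Type := RTree Unit (Fin n)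

/-- The isomorphism class of a tree on an arbitrary finite set of vertices. -/
def ColForest.toRTree {E L V : Type} [Finite V] (F : ColForest E L V) (hF : F.IsTree) :
    RTree E L :=
  Quotient.mk (treeSetoid E L) ⟨Nat.card V,
    F.comap (Finite.equivFin V).symm (Finite.equivFin V).symm.injective,
    hF.comap_equiv (Finite.equivFin V).symm⟩

namespace RTree

variable {E L : Type}

/-- The number of vertices `|t|`. -/
def size (t : RTree E L) : ℕ := (Quotient.out t).1

/-- A representative of the isomorphism class `t`. -/
def rep (t : RTree E L) : ColForest E L (Fin t.size) := (Quotient.out t).2.1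

theorem rep_isTree (t : RTree E L) : t.rep.IsTree := (Quotient.out t).2.2

theorem toRTree_rep (t : RTree E L) : t.rep.toRTree t.rep_isTree = t := by
  refine Eq.trans (Quotient.sound ?_) (Quotient.out_eq t)
  exact ⟨⟨(Finite.equivFin (Fin t.size)).symm, fun e w v => Iff.rfl, fun v => rfl⟩⟩

/-- The order of the automorphism group of `t`. -/
def autCard (t : RTree E L) : ℕ := Nat.card (t.rep.Iso t.rep)

end RTree

/-! ## The algebra of forests -/

open scoped Classical in
/-- A forest, up to isomorphism, as the finite multiset of its connected components, which is
an exponent of a monomial in the trees. -/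
def ColForest.components {E L V : Type} [Fintype V] (F : ColForest E L V) : RTree E L →₀ ℕ :=
  ∑ r : {r : V // F.IsMinimal r}, Finsupp.single ((F.component r.1).toRTree (F.component_isTree r.1)) 1

/-- The initial commutative algebra with an `n`-ary operation: the free commutative `k`-algebra on
the rooted trees with edges colored by `{1, …, n}`. The monomials are the forests. -/
abbrev TreeAlg (k : Type*) [Field k] (n : ℕ) : Type _ := MvPolynomial (ETree n) k

section Coproduct

variable (k : Type*) [Field k] {n : ℕ}

/-- A forest (on a finite vertex set) as an element of the algebra. -/
def forestElt {V : Type} [Fintype V] (F : ColForest (Fin n) Unit V) : TreeAlg k n :=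
  MvPolynomial.monomial F.components 1

/-- The number of vertices of a forest. -/
def numVertices (m : ETree n →₀ ℕ) : ℕ := Finsupp.weight RTree.size m

/-- The tree `λ(x₁, …, xₙ)` for forests `x₁, …, xₙ`: a new root is added and the root of each tree
of `xᵢ` is connected to it by an edge of color `i`. -/
def nodeTree (x : Fin n → (ETree n →₀ ℕ)) : ETree n :=
  (ColForest.node
    (ι := (i : Fin n) × (t : {t // t ∈ (x i).support}) × Fin (x i t.1))
    (fun j => j.2.1.1.rep) (fun j => j.1) ()).toRTree
      (ColForest.node_isTree _ _ _)

/-- The basis of `C_n^{⊗ n}` that consists of the tensor products of forests. -/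
def tensorBasis (n : ℕ) :
    Module.Basis (Fin n → (ETree n →₀ ℕ)) k (PiTensorProduct k fun _ : Fin n => TreeAlg k n) :=
  Basis.piTensorProduct fun _ => MvPolynomial.basisMonomials (ETree n) k

/-- The operation `λ : C_n^{⊗ n} → C_n`. -/
def lam (n : ℕ) : (PiTensorProduct k fun _ : Fin n => TreeAlg k n) →ₗ[k] TreeAlg k n :=
  (tensorBasis k n).constr k fun x => MvPolynomial.X (nodeTree x)

variable {k} in
/-- The map `σ(t₁, …, tₙ) = q₁^{|t₁|} ⋯ qₙ^{|tₙ|} t₁ ⋯ tₙ`. -/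
def sigma (q : Fin n → k) : (PiTensorProduct k fun _ : Fin n => TreeAlg k n) →ₗ[k] TreeAlg k n :=
  (tensorBasis k n).constr k fun x =>
    (∏ j, q j ^ numVertices (x j)) • ∏ j, MvPolynomial.monomial (x j) (1 : k)

variable {k} in
/-- The natural map `(C_n ⊗ C_n)^{⊗ n} → C_n^{⊗ n} ⊗ C_n^{⊗ n}` as a function of `n` arguments,
`(a₁ ⊗ b₁, …, aₙ ⊗ bₙ) ↦ (a₁ ⊗ ⋯ ⊗ aₙ) ⊗ (b₁ ⊗ ⋯ ⊗ bₙ)`. -/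
def twist (z : Fin n → TreeAlg k n ⊗[k] TreeAlg k n) :
    (PiTensorProduct k fun _ : Fin n => TreeAlg k n) ⊗[k]
      (PiTensorProduct k fun _ : Fin n => TreeAlg k n) :=
  ∏ i, Algebra.TensorProduct.map
    (PiTensorProduct.singleAlgHom (R := k) (A := fun _ : Fin n => TreeAlg k n) i)
    (PiTensorProduct.singleAlgHom (R := k) (A := fun _ : Fin n => TreeAlg k n) i) (z i)

variable {k} in
theorem twist_tmul (a b : Fin n → TreeAlg k n) :
    twist (fun i => a i ⊗ₜ[k] b i) = PiTensorProduct.tprod k a ⊗ₜ[k] PiTensorProduct.tprod k b := by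
  have key : ∀ a : Fin n → TreeAlg k n, ∏ i, PiTensorProduct.singleAlgHom (R := k)
      (A := fun _ : Fin n => TreeAlg k n) i (a i) = PiTensorProduct.tprod k a := fun a => by
    simp only [PiTensorProduct.singleAlgHom_apply]
    rw [← PiTensorProduct.tprod_prod]
    exact congrArg _ (Finset.univ_prod_mulSingle a)
  rw [← key a, ← key b]
  simp only [twist, Algebra.TensorProduct.map_tmul]
  induction (Finset.univ : Finset (Fin n)) using Finset.cons_induction with
  | empty => rfl
  | cons i s hi ih =>
    simp only [Finset.prod_cons, ih, Algebra.TensorProduct.tmul_mul_tmul]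

variable {k} in
/-- `Δ` is the coproduct defined by `σ₁` and `σ₂` with parameters `q₁` and `q₂`: a morphism of
unital algebras with `Δ ∘ λ = (σ₁ ⊗ λ + λ ⊗ σ₂) ∘ τ ∘ Δ^{⊗ n}`. -/
def IsCoproduct (q₁ q₂ : Fin n → k) (Δ : TreeAlg k n →ₐ[k] TreeAlg k n ⊗[k] TreeAlg k n) : Prop :=
  ∀ x : Fin n → TreeAlg k n,
    Δ (lam k n (PiTensorProduct.tprod k x)) =
      (TensorProduct.map (sigma q₁) (lam k n) + TensorProduct.map (lam k n) (sigma q₂))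
        (twist fun i => Δ (x i))

end Coproduct

/-! ## Admissible cuts -/

namespace ColForest

variable {V : Type} {n : ℕ}

/-- A cut is a set of edges `(w, v)`. It is admissible if for each leaf `m` the path from `m` to
the root contains at most one edge of the cut. -/
def IsAdmissibleCut (F : ColForest (Fin n) Unit V) (c : Finset (V × V)) : Prop :=
  (∀ a ∈ c, F.IsEdge a.1 a.2) ∧
    ∀ m, F.IsLeaf m → ∀ a ∈ c, ∀ b ∈ c, F.le a.2 m → F.le b.2 m → a = b

/-- The vertices of the `p`-connected component of a tree: those that are connected to the root by
a path with all edges of a color in `p`. -/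
def InComponent (F : ColForest (Fin n) Unit V) (p : Finset (Fin n)) (v : V) : Prop :=
  ∀ e w, F.R e w v → e ∈ p

/-- All edges of the cut are edges of the `p`-connected component. -/
def CutsInside (F : ColForest (Fin n) Unit V) (p : Finset (Fin n)) (c : Finset (V × V)) : Prop :=
  ∀ a ∈ c, F.InComponent p a.1 ∧ F.InComponent p a.2

/-- The vertices of `R^c`, the component of the root after removal of the edges of the cut `c`:
no edge of `c` lies on the path to the root. -/
def trunk (F : ColForest (Fin n) Unit V) (c : Finset (V × V)) : Set V :=
  {v | ∀ a ∈ c, ¬ F.le a.2 v}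

open scoped Classical in
/-- The finite set of the admissible cuts at edges of the `p`-connected component. -/
def admissibleCuts [Fintype V] (F : ColForest (Fin n) Unit V) (p : Finset (Fin n)) :
    Finset (Finset (V × V)) :=
  Finset.univ.filter fun c => F.IsAdmissibleCut c ∧ F.CutsInside p c

end ColForest

open scoped Classical in
/-- `∑_c P^c(t) ⊗ R^c(t)`, the sum over the admissible cuts `c` of the tree `t` at edges of its
`p`-connected component; here `P^c(t)` is the complement of `R^c(t)`. -/
def cutSum (k : Type*) [Field k] {n : ℕ} (p : Finset (Fin n)) (t : ETree n) :
    TreeAlg k n ⊗[k] TreeAlg k n :=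
  ∑ c ∈ t.rep.admissibleCuts p,
    forestElt k (t.rep.sub (t.rep.trunk c)ᶜ) ⊗ₜ[k] forestElt k (t.rep.sub (t.rep.trunk c))

/-! ## The graded dual, its primitive elements, and the product `*` -/

section Dual

variable (k : Type*) [Field k] (n : ℕ)

/-- The counit: it is `1` on the empty forest and `0` on all other forests. -/
def counit : Module.Dual k (TreeAlg k n) := MvPolynomial.lcoeff k 0

/-- The graded dual `C_n^*`, the direct sum of the duals of the homogeneous parts with respect to
the number of vertices: the functionals that vanish in all but finitely many degrees. -/
def gradedDual : Submodule k (Module.Dual k (TreeAlg k n)) where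
  carrier := {f | ∃ N : ℕ, ∀ m : ETree n →₀ ℕ, N ≤ numVertices m → f (MvPolynomial.monomial m 1) = 0}
  add_mem' := by
    rintro f g ⟨N, hN⟩ ⟨M, hM⟩
    exact ⟨max N M, fun m hm => by
      rw [LinearMap.add_apply, hN m (le_trans (le_max_left _ _) hm),
        hM m (le_trans (le_max_right _ _) hm), add_zero]⟩
  zero_mem' := ⟨0, fun _ _ => rfl⟩
  smul_mem' := by
    rintro a f ⟨N, hN⟩
    exact ⟨N, fun m hm => by rw [LinearMap.smul_apply, hN m hm, smul_zero]⟩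

/-- The primitive elements `P(C_n^*)`: elements `f` of the graded dual such that the coproduct of
`f`, which is `f` composed with the multiplication of `C_n`, is `f ⊗ 1 + 1 ⊗ f`. The unit `1` of
`C_n^*` is the counit of `C_n`. -/
def primitives : Submodule k (Module.Dual k (TreeAlg k n)) where
  carrier := {f | f ∈ gradedDual k n ∧ f ∘ₗ LinearMap.mul' k (TreeAlg k n) =
    TensorProduct.dualDistrib k (TreeAlg k n) (TreeAlg k n)
      (f ⊗ₜ[k] counit k n + counit k n ⊗ₜ[k] f)}
  add_mem' := by
    rintro f g ⟨hf, hf'⟩ ⟨hg, hg'⟩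
    refine ⟨add_mem hf hg, ?_⟩
    rw [LinearMap.add_comp, hf', hg', ← map_add, TensorProduct.add_tmul, TensorProduct.tmul_add]
    congr 1
    abel
  zero_mem' := ⟨zero_mem _, by simp⟩
  smul_mem' := by
    rintro a f ⟨hf, hf'⟩
    refine ⟨Submodule.smul_mem _ a hf, ?_⟩
    rw [LinearMap.smul_comp, hf', ← map_smul, smul_add, TensorProduct.smul_tmul',
      TensorProduct.tmul_smul]

variable {n}

/-- The element `D_t` of the basis dual to the basis of forests, for a tree `t`. -/
def dualTree (t : ETree n) : Module.Dual k (TreeAlg k n) :=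
  MvPolynomial.lcoeff k (Finsupp.single t 1)

theorem dualTree_mem_primitives (t : ETree n) : dualTree k t ∈ primitives k n := by
  classical
  refine ⟨⟨t.size + 1, fun m hm => ?_⟩, ?_⟩
  · have hne : m ≠ Finsupp.single t 1 := by
      rintro rfl
      simp [numVertices, Finsupp.weight_apply] at hm
    simp [dualTree, MvPolynomial.coeff_monomial, hne]
  · refine TensorProduct.ext' fun x y => ?_
    have hanti : Finset.HasAntidiagonal.antidiagonal (Finsupp.single t 1) =
        {((0 : ETree n →₀ ℕ), Finsupp.single t 1), (Finsupp.single t 1, 0)} := by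
      ext ⟨a, b⟩
      rw [Finset.HasAntidiagonal.mem_antidiagonal]
      simp only [Finset.mem_insert, Finset.mem_singleton, Prod.mk.injEq]
      constructor
      · intro h
        have hval : ∀ u, a u + b u = Finsupp.single t 1 u := fun u => by
          rw [← h, Finsupp.add_apply]
        have ht := hval t
        rw [Finsupp.single_eq_same] at ht
        have h01 : a t = 0 ∨ b t = 0 := by omega
        rcases h01 with h0 | h0
        · have ha : a = 0 := by
            ext u
            by_cases hu : u = t
            · rw [hu, h0, Finsupp.coe_zero, Pi.zero_apply]
            · have := hval u
              rw [Finsupp.single_eq_of_ne hu] at this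
              exact (Nat.add_eq_zero_iff.1 this).1
          exact Or.inl ⟨ha, by rw [← h, ha, zero_add]⟩
        · have hb : b = 0 := by
            ext u
            by_cases hu : u = t
            · rw [hu, h0, Finsupp.coe_zero, Pi.zero_apply]
            · have := hval u
              rw [Finsupp.single_eq_of_ne hu] at this
              exact (Nat.add_eq_zero_iff.1 this).2
          exact Or.inr ⟨by rw [← h, hb, add_zero], hb⟩
      · rintro (⟨rfl, rfl⟩ | ⟨rfl, rfl⟩)
        · rw [zero_add]
        · rw [add_zero]
    have hne : ((0 : ETree n →₀ ℕ), (Finsupp.single t 1 : ETree n →₀ ℕ)) ≠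
        (Finsupp.single t 1, 0) := by
      simp
    simp only [LinearMap.comp_apply, LinearMap.mul'_apply, map_add, LinearMap.add_apply,
      TensorProduct.dualDistrib_apply, dualTree, counit, MvPolynomial.lcoeff_apply]
    rw [MvPolynomial.coeff_mul, hanti, Finset.sum_pair hne, add_comm]

/-- `D_t` as a primitive element. -/
def primTree (t : ETree n) : primitives k n := ⟨dualTree k t, dualTree_mem_primitives k t⟩

variable {k}

open scoped Classical in
/-- The number `p_j(v, s, t)`, for a forest `F = t` and a set `S = s` of vertices: the number of
edges of color `j` of the path from `v` to the root that have their lower vertex outside of `S`.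
The lower vertices of the edges of this path are the vertices `w < v`, and `R j w v` says that the
edge of the path with lower vertex `w` has color `j`. -/
def pathCount {V : Type} [Fintype V] (F : ColForest (Fin n) Unit V) (S : Finset V) (v : V)
    (j : Fin n) : ℕ :=
  (Finset.univ.filter fun w => w ∉ S ∧ F.R j w v).card

open scoped Classical in
/-- The coefficient
`q(s, t) = ∏_j q_{1j}^{∑_{v ∈ s} p_j(v, s, t)} ⬝ ∏_j q_{2j}^{∑_{v ∈ sᶜ} p_j(v, sᶜ, t)}`. -/
def qCoeff (q₁ q₂ : Fin n → k) {V : Type} [Fintype V] (F : ColForest (Fin n) Unit V)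
    (S : Finset V) : k :=
  (∏ j, q₁ j ^ ∑ v ∈ S, pathCount F S v j) * ∏ j, q₂ j ^ ∑ v ∈ Sᶜ, pathCount F Sᶜ v j

open scoped Classical in
/-- `∑_{s ⊂ t} q(s, t) f(s) g(sᶜ)`, the sum over all subforests `s` of the tree `t`. For `f = D_a`
and `g = D_b` it is the sum of `q(s, t)` over the `s ⊂ t` with `s ≅ a` and `sᶜ ≅ b`. -/
def starCoeff (q₁ q₂ : Fin n → k) (f g : Module.Dual k (TreeAlg k n)) (t : ETree n) : k :=
  ∑ S : Finset (Fin t.size), qCoeff q₁ q₂ t.rep S *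
    (f (forestElt k (t.rep.sub (S : Set (Fin t.size)))) *
      g (forestElt k (t.rep.sub ((Sᶜ : Finset (Fin t.size)) : Set (Fin t.size)))))

open scoped Classical in
/-- The bilinear operation `*` with `D_a * D_b = ∑_{t = a ∪ b} q(a, t) D_t`, where `t` ranges over
trees with complementary subforests `a` and `b`: the functional `f * g` vanishes on the forests
that are not trees, and on a tree `t` its value is `∑_{s ⊂ t} q(s, t) f(s) g(sᶜ)`. -/
def star (q₁ q₂ : Fin n → k) :
    Module.Dual k (TreeAlg k n) →ₗ[k] Module.Dual k (TreeAlg k n) →ₗ[k]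
      Module.Dual k (TreeAlg k n) :=
  LinearMap.mk₂ k
    (fun f g => (MvPolynomial.basisMonomials (ETree n) k).constr k fun m =>
      if h : ∃ t, m = Finsupp.single t 1 then starCoeff q₁ q₂ f g h.choose else 0)
    (fun f f' g => by
      refine (MvPolynomial.basisMonomials (ETree n) k).ext fun m => ?_
      simp only [LinearMap.add_apply, Module.Basis.constr_basis]
      split_ifs
      · simp only [starCoeff, LinearMap.add_apply, ← Finset.sum_add_distrib]
        exact Finset.sum_congr rfl fun _ _ => by ring
      · simp)
    (fun a f g => by
      refine (MvPolynomial.basisMonomials (ETree n) k).ext fun m => ?_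
      simp only [LinearMap.smul_apply, Module.Basis.constr_basis]
      split_ifs
      · simp only [starCoeff, LinearMap.smul_apply, smul_eq_mul, Finset.mul_sum]
        exact Finset.sum_congr rfl fun _ _ => by ring
      · simp)
    (fun f g g' => by
      refine (MvPolynomial.basisMonomials (ETree n) k).ext fun m => ?_
      simp only [LinearMap.add_apply, Module.Basis.constr_basis]
      split_ifs
      · simp only [starCoeff, LinearMap.add_apply, ← Finset.sum_add_distrib]
        exact Finset.sum_congr rfl fun _ _ => by ring
      · simp)
    (fun a f g => by
      refine (MvPolynomial.basisMonomials (ETree n) k).ext fun m => ?_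
      simp only [LinearMap.smul_apply, Module.Basis.constr_basis]
      split_ifs
      · simp only [starCoeff, LinearMap.smul_apply, smul_eq_mul, Finset.mul_sum]
        exact Finset.sum_congr rfl fun _ _ => by ring
      · simp)

/-- A bilinear operation makes a vector space a (right) pre-Lie algebra. -/
def IsRightPreLie {A : Type*} [AddCommGroup A] [Module k A] (mul : A →ₗ[k] A →ₗ[k] A) : Prop :=
  ∀ x y z : A, mul (mul x y) z - mul x (mul y z) = mul (mul x z) y - mul x (mul z y)

end Dual

/-! ## The free pre-Lie algebra on `n` generators, as the algebra of vertex-colored trees -/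

/-- The tree `s ∘_v t` obtained by grafting `s` onto the vertex `v` of `t`. -/
def VTree.graft {n : ℕ} (s t : VTree n) (v : Fin t.size) : VTree n :=
  (s.rep.graft t.rep v ()).toRTree (ColForest.graft_isTree t.rep_isTree v ())

/-- The vector space `L_n` with basis the rooted trees with vertices colored by `{1, …, n}`. -/
abbrev FreePreLie (k : Type*) [Field k] (n : ℕ) : Type _ := VTree n →₀ k

/-- The pre-Lie product of `L_n`: `t * s = ∑_{v ∈ t} s ∘_v t`. -/
def graftProduct (k : Type*) [Field k] (n : ℕ) :
    FreePreLie k n →ₗ[k] FreePreLie k n →ₗ[k] FreePreLie k n :=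
  Finsupp.linearCombination k fun t =>
    Finsupp.linearCombination k fun s =>
      ∑ v : Fin t.size, Finsupp.single (VTree.graft s t v) (1 : k)

open scoped Classical in
/-- The same tree with the color of the root changed to `i`. -/
def ColForest.recolorRoot {E V : Type} {n : ℕ} (F : ColForest E (Fin n) V) (i : Fin n) :
    ColForest E (Fin n) V :=
  { F with label := fun v => if F.IsRoot v then i else F.label v }

/-- The map `r_i` on vertex-colored trees, which changes the color of the root to `i`. -/
def VTree.recolorRoot {n : ℕ} (i : Fin n) (t : VTree n) : VTree n :=
  (t.rep.recolorRoot i).toRTree t.rep_isTree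

open scoped Classical in
/-- The vertex-colored tree obtained from an edge-colored tree by assigning the color of each edge
to its upper vertex and the color `i` to the root. -/
def ColForest.colorVertices {V : Type} {n : ℕ} (F : ColForest (Fin n) Unit V) (i : Fin n) :
    ColForest Unit (Fin n) V where
  R _ w v := F.lt w v
  irrefl _ v := fun ⟨e, h⟩ => F.irrefl e v h
  color_unique _ _ _ _ _ _ := rfl
  trans _ _ w x v := fun ⟨e, h⟩ ⟨e', h'⟩ => ⟨e, F.trans e e' w x v h h'⟩
  down_linear _ _ x y z hyz := fun ⟨e, h⟩ ⟨e', h'⟩ =>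
    (F.down_linear e e' x y z hyz h h').imp (fun h => ⟨(), h⟩) (fun h => ⟨(), h⟩)
  label v := if h : ∃ e w, F.IsEdge w v ∧ F.R e w v then h.choose else i

/-- The vertex-colored tree `t_i` obtained from an edge-colored tree `t` by assigning the color of
each edge to its upper vertex and the color `i` to the root. -/
def ETree.colorVertices {n : ℕ} (t : ETree n) (i : Fin n) : VTree n :=
  (t.rep.colorVertices i).toRTree (by
    obtain ⟨r, hr⟩ := t.rep_isTree
    exact ⟨r, fun v hv => ⟨(), hr v hv⟩⟩)

end ColoredTrees

end

/-! All of part (i) rests on one description of the coproduct by vertex sets. For a forest `F` let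
`coprod` be the sum of the tensors of the subforests on `S` and on its complement, where `S` runs
over the sets satisfying `IsUpper`: `S` is closed upwards, and on every path from outside into `S`
the edges that start outside `S` have colors in `p`. Comparable vertices lie in one component, so
such a set is an independent choice of sets in the components; hence the sum is multiplicative
(`coprod_eq_prod`) and agrees with the algebra morphism that it defines on trees.

For a tree there are two cases. If the root lies in `S`, then `S` is everything and the term is `t ⊗
1`. Otherwise `S` is a choice of such sets in the branches, empty in every branch whose color is not
in `p`. Because `0 ^ 0 = 1`, these cases are exactly what `λ ⊗ σ₂` and `σ₁ ⊗ λ` produce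
(`coprod_eq_of_isRoot`). Every tree is `λ` of its branches, which gives uniqueness by induction on
size. The sets that avoid the root correspond to admissible cuts through the edges entering them,
and `q(s, t)` is the indicator function of `IsUpper` (`qCoeff_eq`), so `*` is dual to the coproduct
on trees.

A primitive functional vanishes on products of nonempty forests, so it is supported on trees; there
are finitely many trees of each size, so it is a finite combination of the `D_t`. For the pre-Lie
identity, `z * (y * x)` is expanded over pairs of disjoint sets `S`, `T`, and `(z * y) * x` is the
same sum restricted to the pairs for which `S ∪ T` is a tree. In the difference only trees `S` and
`T` matter, and they are incomparable because their union is not a tree; the sum is therefore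
symmetric in `y` and `z` (`IsUpperPair.symm`, `star_associator_symm`).

For part (ii), a vertex-colored tree amounts to an edge-colored tree together with a root color, and
grafting turns the root color of the upper tree into the color of the new edge. Thus the product of
`Φ(D_b)` and `Φ(D_a)` enumerates the graftings of `a` onto `b` by an edge of any color, whereas `D_a
* D_b` enumerates subforests. The two counts differ by orders of automorphism groups, since both
count the same bijections, the elements of `Shuffle` (`card_grafts`). The factors `1 / |Aut(t)|`
absorb this difference. -/

noncomputable section

namespace ColoredTrees

open scoped Classical

open ColForest

/-! ## Isomorphisms of forests -/

namespace ColForest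

variable {E L V W U A B : Type}

/-! ### The order of a forest. -/

section Order

variable {F : ColForest E L V}

theorem lt_irrefl (F : ColForest E L V) (v : V) : ¬ F.lt v v := fun ⟨e, h⟩ => F.irrefl e v h

theorem lt_trans {u v w : V} (h : F.lt u v) (h' : F.lt v w) : F.lt u w :=
  let ⟨e, h⟩ := h
  let ⟨e', h'⟩ := h'
  ⟨e, F.trans e e' u v w h h'⟩

theorem lt_asymm {u v : V} (h : F.lt u v) : ¬ F.lt v u := fun h' => F.lt_irrefl u (lt_trans h h')

theorem le_refl (F : ColForest E L V) (v : V) : F.le v v := Or.inl rfl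

theorem lt_of_le_of_lt {u v w : V} (h : F.le u v) (h' : F.lt v w) : F.lt u w := by
  rcases h with rfl | h
  exacts [h', lt_trans h h']

theorem lt_of_lt_of_le {u v w : V} (h : F.lt u v) (h' : F.le v w) : F.lt u w := by
  rcases h' with rfl | h'
  exacts [h, lt_trans h h']

theorem le_trans {u v w : V} (h : F.le u v) (h' : F.le v w) : F.le u w := by
  rcases h with rfl | h
  exacts [h', Or.inr (lt_of_lt_of_le h h')]

theorem le_antisymm {u v : V} (h : F.le u v) (h' : F.le v u) : u = v := by
  rcases h with rfl | h
  · rfl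
  · exact absurd (lt_of_lt_of_le h h') (F.lt_irrefl u)

theorem not_lt_of_le {u v : V} (h : F.le u v) : ¬ F.lt v u :=
  fun h' => F.lt_irrefl u (lt_of_le_of_lt h h')

/-- The non-strict form of `down_linear`; nearly every case distinction on the position of two
vertices below a third one goes through it. -/
theorem le_or_lt_of_le {u v w : V} (h : F.le u w) (h' : F.le v w) : F.le u v ∨ F.lt v u := by
  rcases h with rfl | ⟨e, h⟩
  · rcases h' with rfl | h'
    · exact Or.inl (Or.inl rfl)
    · exact Or.inr h'
  · rcases h' with rfl | ⟨e', h'⟩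
    · exact Or.inl (Or.inr ⟨e, h⟩)
    · by_cases huv : u = v
      · exact Or.inl (Or.inl huv)
      · exact (F.down_linear e e' w u v huv h h').imp Or.inr id

/-- The color recorded by `R` is that of the first edge at the lower end, so it does not change when
the upper end moves further up. -/
theorem R_of_le {e : E} {u v w : V} (h : F.R e u v) (h' : F.le v w) : F.R e u w := by
  rcases h' with rfl | ⟨e', h'⟩
  exacts [h, F.trans _ _ _ _ _ h h']

/-- The first step towards `v` and towards anything above it has the same color. -/
theorem R_of_lt_of_le {e : E} {u v w : V} (h : F.lt u v) (h' : F.le v w) (hw : F.R e u w) :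
    F.R e u v := by
  obtain ⟨e', he'⟩ := h
  rwa [F.color_unique _ _ _ _ hw (R_of_le he' h')]

/-- The partial order on the vertices. -/
@[reducible] def partialOrder (F : ColForest E L V) : PartialOrder V where
  le := F.le
  lt := F.lt
  le_refl := F.le_refl
  le_trans _ _ _ := le_trans
  lt_iff_le_not_ge u v := ⟨fun h => ⟨Or.inr h, fun h' => not_lt_of_le h' h⟩, fun h => by
    rcases h.1 with rfl | h'
    · exact absurd (F.le_refl _) h.2
    · exact h'⟩
  le_antisymm _ _ := le_antisymm

/-- Every nonempty set of vertices has a minimal element below each of its elements. -/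
theorem exists_minimal_le [Finite V] (F : ColForest E L V) (S : Set V) {v : V} (hv : v ∈ S) :
    ∃ u ∈ S, F.le u v ∧ ∀ w ∈ S, ¬ F.lt w u := by
  let _ := F.partialOrder
  obtain ⟨u, hu, hm⟩ := (Set.toFinite S).exists_le_minimal hv
  exact ⟨u, hm.1, hu, fun w hw hlt => hm.not_lt hw hlt⟩

theorem exists_maximal_ge [Finite V] (F : ColForest E L V) (S : Set V) {v : V} (hv : v ∈ S) :
    ∃ u ∈ S, F.le v u ∧ ∀ w ∈ S, ¬ F.lt u w := by
  let _ := F.partialOrder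
  obtain ⟨u, hu, hm⟩ := (Set.toFinite S).exists_le_maximal hv
  exact ⟨u, hm.1, hu, fun w hw hlt => hm.not_gt hw hlt⟩

theorem exists_leaf_ge [Finite V] (F : ColForest E L V) (v : V) : ∃ m, F.IsLeaf m ∧ F.le v m := by
  obtain ⟨m, -, h, hm⟩ := F.exists_maximal_ge Set.univ (Set.mem_univ v)
  exact ⟨m, fun w => hm w trivial, h⟩

theorem exists_isMinimal_le [Finite V] (F : ColForest E L V) (v : V) :
    ∃ r, F.IsMinimal r ∧ F.le r v := by
  obtain ⟨m, -, h, hm⟩ := F.exists_minimal_le Set.univ (Set.mem_univ v)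
  exact ⟨m, fun w => hm w trivial, h⟩

theorem IsMinimal.eq_of_le {r r' v : V} (h : F.IsMinimal r) (h' : F.IsMinimal r') (hr : F.le r v)
    (hr' : F.le r' v) : r = r' := by
  rcases le_or_lt_of_le hr hr' with (h1 | h1) | h1
  · exact h1
  · exact absurd h1 (h' _)
  · exact absurd h1 (h _)

theorem IsRoot.le {r : V} (h : F.IsRoot r) (v : V) : F.le r v := by
  by_cases hv : v = r
  exacts [Or.inl hv.symm, Or.inr (h v hv)]

theorem IsRoot.isMinimal {r : V} (h : F.IsRoot r) : F.IsMinimal r :=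
  fun v => not_lt_of_le (h.le v)

theorem IsRoot.eq {r r' : V} (h : F.IsRoot r) (h' : F.IsRoot r') : r = r' :=
  le_antisymm (h.le r') (h'.le r)

/-- Below each vertex that is not minimal there is an edge. -/
theorem exists_isEdge_of_lt [Finite V] {w v : V} (h : F.lt w v) :
    ∃ u, F.IsEdge u v ∧ F.le w u := by
  obtain ⟨u, hu, hwu, hm⟩ := F.exists_maximal_ge {u | F.lt u v} h
  exact ⟨u, ⟨hu, fun x hx => hm x hx.2 hx.1⟩, hwu⟩

theorem exists_isEdge_of_lt' [Finite V] {w v : V} (h : F.lt w v) :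
    ∃ u, F.IsEdge w u ∧ F.le u v := by
  obtain ⟨u, hu, huv, hm⟩ := F.exists_minimal_le {u | F.lt w u} h
  exact ⟨u, ⟨hu, fun x hx => hm x hx.1 hx.2⟩, huv⟩

theorem IsEdge.le_of_lt {u v w : V} (h : F.IsEdge w v) (hu : F.lt u v) : F.le u w := by
  rcases le_or_lt_of_le (Or.inr hu) (Or.inr h.1) with h1 | h1
  exacts [h1, absurd ⟨h1, hu⟩ (h.2 u)]

theorem IsEdge.eq {u v w : V} (h : F.IsEdge w v) (h' : F.IsEdge u v) : w = u :=
  le_antisymm (h'.le_of_lt h.1) (h.le_of_lt h'.1)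

end Order

/-! ### Isomorphisms and induced subforests. -/

namespace Iso

variable {F : ColForest E L V} {G : ColForest E L W} {H : ColForest E L U}

theorem toEquiv_injective : Function.Injective (Iso.toEquiv : F.Iso G → V ≃ W) := by
  rintro ⟨f, _, _⟩ ⟨g, _, _⟩ h
  cases h
  rfl

instance [Finite V] [Finite W] : Finite (F.Iso G) := Finite.of_injective _ toEquiv_injective

/-- The identity. -/
def refl (F : ColForest E L V) : F.Iso F := ⟨Equiv.refl V, fun _ _ _ => Iff.rfl, fun _ => rfl⟩

/-- The inverse of an isomorphism. -/
def symm (f : F.Iso G) : G.Iso F :=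
  ⟨f.toEquiv.symm, fun e w v => by simp [f.map_R], fun v => by simp [f.map_label]⟩

/-- The composition of isomorphisms. -/
def trans (f : F.Iso G) (g : G.Iso H) : F.Iso H :=
  ⟨f.toEquiv.trans g.toEquiv, fun e w v => by simp [f.map_R, g.map_R],
    fun v => by simp [f.map_label, g.map_label]⟩

theorem lt_iff (f : F.Iso G) (w v : V) : F.lt w v ↔ G.lt (f.toEquiv w) (f.toEquiv v) :=
  exists_congr fun e => f.map_R e w v

theorem le_iff (f : F.Iso G) (w v : V) : F.le w v ↔ G.le (f.toEquiv w) (f.toEquiv v) :=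
  or_congr (by simp) (f.lt_iff w v)

theorem isRoot_iff (f : F.Iso G) (r : V) : F.IsRoot r ↔ G.IsRoot (f.toEquiv r) := by
  refine ⟨fun h v hv => ?_, fun h v hv => ?_⟩
  · have := h (f.toEquiv.symm v) fun hh => hv (by simp [← hh])
    simpa [f.lt_iff] using this
  · exact (f.lt_iff _ _).2 (h _ fun hh => hv (f.toEquiv.injective hh))

theorem isMinimal_iff (f : F.Iso G) (r : V) : F.IsMinimal r ↔ G.IsMinimal (f.toEquiv r) := by
  refine ⟨fun h v hv => h (f.toEquiv.symm v) ?_, fun h v hv => h _ ((f.lt_iff _ _).1 hv)⟩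
  simpa [f.lt_iff] using hv

theorem isEdge_iff (f : F.Iso G) (w v : V) :
    F.IsEdge w v ↔ G.IsEdge (f.toEquiv w) (f.toEquiv v) := by
  refine and_congr (f.lt_iff _ _) ?_
  rw [← f.toEquiv.forall_congr_right]
  simp [f.lt_iff]

theorem isTree (f : F.Iso G) (h : F.IsTree) : G.IsTree :=
  let ⟨r, hr⟩ := h
  ⟨f.toEquiv r, (f.isRoot_iff r).1 hr⟩

/-- Isomorphic forests have isomorphic subforests. -/
def comapOfRange (f : F.Iso G) {i : A → V} {j : B → W} (hi : Function.Injective i)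
    (hj : Function.Injective j) (h : ∀ w, (∃ a, f.toEquiv (i a) = w) ↔ ∃ b, j b = w) :
    (F.comap i hi).Iso (G.comap j hj) := by
  have key : ∀ a, ∃ b, j b = f.toEquiv (i a) := fun a => (h _).1 ⟨a, rfl⟩
  let g : A → B := fun a => (key a).choose
  have hg : ∀ a, j (g a) = f.toEquiv (i a) := fun a => (key a).choose_spec
  refine ⟨Equiv.ofBijective g ⟨fun a a' haa => hi (f.toEquiv.injective ?_), fun b => ?_⟩, ?_, ?_⟩
  · rw [← hg, ← hg, haa]
  · obtain ⟨a, ha⟩ := (h (j b)).2 ⟨b, rfl⟩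
    exact ⟨a, hj (by rw [hg, ha])⟩
  · intro e w v
    show F.R e (i w) (i v) ↔ G.R e (j (g w)) (j (g v))
    rw [hg, hg, f.map_R]
  · intro v
    show F.label (i v) = G.label (j (g v))
    rw [hg, f.map_label]

/-- Corresponding subforests of isomorphic forests are isomorphic. -/
def sub (f : F.Iso G) {S : Set V} {T : Set W} (h : ∀ v, v ∈ S ↔ f.toEquiv v ∈ T) :
    (F.sub S).Iso (G.sub T) :=
  f.comapOfRange _ _ fun w => by
    constructor
    · rintro ⟨a, rfl⟩
      exact ⟨⟨_, (h a).1 a.2⟩, rfl⟩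
    · rintro ⟨b, rfl⟩
      exact ⟨⟨f.toEquiv.symm b, (h _).2 (by simp)⟩, by simp⟩

/-- Equal sets of vertices have isomorphic subforests. -/
def subCongr (F : ColForest E L V) {S T : Set V} (h : S = T) : (F.sub S).Iso (F.sub T) :=
  (refl F).sub fun v => by subst h; rfl

/-- A subforest of a subforest is a subforest. -/
def subSub (F : ColForest E L V) (S : Set V) (T : Set S) :
    ((F.sub S).sub T).Iso (F.sub (Subtype.val '' T)) :=
  (refl F).comapOfRange (i := fun a : T => a.1.1)
    (fun _ _ h => Subtype.ext (Subtype.ext h)) Subtype.val_injective fun w => by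
    constructor
    · rintro ⟨a, rfl⟩
      exact ⟨⟨_, a.1, a.2, rfl⟩, rfl⟩
    · rintro ⟨⟨_, b, hb, rfl⟩, rfl⟩
      exact ⟨⟨b, hb⟩, rfl⟩

/-- The subforest on all vertices. -/
def subUniv (F : ColForest E L V) {S : Set V} (h : ∀ v, v ∈ S) : (F.sub S).Iso F :=
  ⟨Equiv.subtypeUnivEquiv h, fun _ _ _ => Iff.rfl, fun _ => rfl⟩

/-- Pulling back along a bijection. -/
def comapEquiv (F : ColForest E L V) (f : W ≃ V) : (F.comap f f.injective).Iso F :=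
  ⟨f, fun _ _ _ => Iff.rfl, fun _ => rfl⟩

end Iso

/-- Isomorphism classes are built from models on `Fin m`; with this lemma the models can be ignored,
and equality of classes is proved by exhibiting an isomorphism between forests on any finite vertex
sets. -/
theorem toRTree_eq_iff [Finite V] [Finite W] {F : ColForest E L V} {G : ColForest E L W}
    (hF : F.IsTree) (hG : G.IsTree) : F.toRTree hF = G.toRTree hG ↔ Nonempty (F.Iso G) := by
  refine Quotient.eq.trans ⟨fun ⟨f⟩ => ⟨?_⟩, fun ⟨f⟩ => ⟨?_⟩⟩
  · exact ((Iso.comapEquiv F _).symm.trans f).trans (Iso.comapEquiv G _)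
  · exact ((Iso.comapEquiv F _).trans f).trans (Iso.comapEquiv G _).symm

theorem Iso.toRTree_eq [Finite V] [Finite W] {F : ColForest E L V} {G : ColForest E L W}
    (f : F.Iso G) (hF : F.IsTree) (hG : G.IsTree) : F.toRTree hF = G.toRTree hG :=
  (toRTree_eq_iff hF hG).2 ⟨f⟩

theorem toRTree_eq_rtree_iff [Finite V] {F : ColForest E L V} (hF : F.IsTree) (t : RTree E L) :
    F.toRTree hF = t ↔ Nonempty (F.Iso t.rep) := by
  conv_lhs => rw [← t.toRTree_rep]
  exact toRTree_eq_iff hF t.rep_isTree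

theorem nonempty_iso_rep [Finite V] {F : ColForest E L V} (hF : F.IsTree) :
    Nonempty (F.Iso (F.toRTree hF).rep) :=
  (toRTree_eq_rtree_iff hF _).1 rfl

theorem size_toRTree [Finite V] {F : ColForest E L V} (hF : F.IsTree) :
    (F.toRTree hF).size = Nat.card V := by
  obtain ⟨f⟩ := nonempty_iso_rep hF
  simpa using (Nat.card_congr f.toEquiv).symm

/-! ## Connected components -/

theorem component_iso {F : ColForest E L V} {G : ColForest E L W} (f : F.Iso G) (r : V) :
    Nonempty ((F.component r).Iso (G.component (f.toEquiv r))) :=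
  ⟨f.sub fun v => f.le_iff r v⟩

theorem Iso.components_eq [Fintype V] [Fintype W] {F : ColForest E L V} {G : ColForest E L W}
    (f : F.Iso G) : F.components = G.components := by
  refine Fintype.sum_equiv (f.toEquiv.subtypeEquiv f.isMinimal_iff) _ _ fun r => ?_
  congr 1
  exact (toRTree_eq_iff _ _).2 (component_iso f r.1)

theorem IsTree.components_eq [Fintype V] {F : ColForest E L V} (hF : F.IsTree) :
    F.components = Finsupp.single (F.toRTree hF) 1 := by
  obtain ⟨r, hr⟩ := id hF
  have : Unique {r : V // F.IsMinimal r} :=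
    ⟨⟨⟨r, hr.isMinimal⟩⟩, fun s => Subtype.ext
      (IsMinimal.eq_of_le s.2 hr.isMinimal (F.le_refl _) (hr.le _))⟩
  unfold components
  rw [Fintype.sum_unique]
  congr 1
  refine (Iso.subUniv F fun v => ?_).toRTree_eq _ _
  have : (default : {r : V // F.IsMinimal r}) = ⟨r, hr.isMinimal⟩ := Subsingleton.elim _ _
  rw [this]
  exact hr.le v

/-- If vertices with different values of `π` are in different components, the components of the
forest are those of the fibers of `π`. -/
theorem components_eq_sum_fiber [Fintype V] {ι : Type} [Fintype ι] (F : ColForest E L V)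
    (π : V → ι) (hπ : ∀ e w v, F.R e w v → π w = π v) [∀ i, Fintype {v | π v = i}] :
    F.components = ∑ i, (F.sub {v | π v = i}).components := by
  have hmin : ∀ i (v : {v | π v = i}),
      (F.sub {v | π v = i}).IsMinimal v ↔ F.IsMinimal v.1 := by
    rintro i ⟨v, hv⟩
    refine ⟨fun h w hw => h ⟨w, ?_⟩ hw, fun h w hw => h w.1 hw⟩
    obtain ⟨e, he⟩ := hw
    exact (hπ e w v he).trans hv
  unfold components
  rw [← Fintype.sum_sigma']
  refine Fintype.sum_equiv
    { toFun := fun r => ⟨π r.1, ⟨r.1, rfl⟩, (hmin _ _).2 r.2⟩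
      invFun := fun r => ⟨r.2.1.1, (hmin _ _).1 r.2.2⟩
      left_inv := fun r => rfl
      right_inv := by
        rintro ⟨_, ⟨r, rfl⟩, hr⟩
        rfl } _ _ fun r => ?_
  congr 1
  refine Iso.toRTree_eq (Iso.symm ((Iso.subSub F _ _).trans (Iso.subCongr F ?_))) _ _
  ext v
  constructor
  · rintro ⟨w, hw, rfl⟩
    rcases hw with hw | hw
    · exact Or.inl (congrArg Subtype.val hw)
    · exact Or.inr hw
  · intro hv
    have : π v = π r.1 := by
      rcases hv with hv | ⟨e, he⟩
      · rw [hv]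
      · exact (hπ _ _ _ he).symm
    refine ⟨⟨v, this⟩, ?_, rfl⟩
    rcases hv with hv | hv
    · exact Or.inl (Subtype.ext hv)
    · exact Or.inr hv

end ColForest

/-- Two families with the same values, counted with multiplicity, differ by a bijection of
the index sets. -/
theorem exists_equiv_of_sum_single_eq {A B X : Type} [Fintype A] [Fintype B] (f : A → X)
    (g : B → X)
    (h : ∑ a, Finsupp.single (f a) (1 : ℕ) = ∑ b, Finsupp.single (g b) 1) :
    ∃ e : A ≃ B, ∀ a, g (e a) = f a := by
  -- The coefficient of the sum at `x` is the number of indices with value `x`, so corresponding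
  -- fibers have the same cardinality.
  have hcard : ∀ x, Nonempty ({a // f a = x} ≃ {b // g b = x}) := fun x => by
    refine ⟨Fintype.equivOfCardEq ?_⟩
    have := DFunLike.congr_fun h x
    simpa [Finsupp.finsetSum_apply, Finsupp.single_apply, Fintype.card_subtype] using this
  refine ⟨((Equiv.sigmaFiberEquiv f).symm.trans
    (Equiv.sigmaCongrRight fun x => (hcard x).some)).trans (Equiv.sigmaFiberEquiv g), fun a => ?_⟩
  exact ((hcard (f a)).some ⟨a, rfl⟩).2

/-! ### Forests are determined by their components, trees by their branches. -/

namespace ColForest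

variable {E L V W U A B ι : Type}

/-- Isomorphisms between the fibers of two functions are glued to a bijection. -/
theorem exists_glue {F : ColForest E L V} {G : ColForest E L W} (π : V → ι) (ρ : W → ι)
    (φ : ∀ i, Nonempty ((F.sub {v | π v = i}).Iso (G.sub {w | ρ w = i}))) :
    ∃ ψ : V ≃ W, (∀ v, ρ (ψ v) = π v) ∧ (∀ v, F.label v = G.label (ψ v)) ∧
      ∀ e w v, π w = π v → (F.R e w v ↔ G.R e (ψ w) (ψ v)) := by
  let f := fun i => (φ i).some
  let ψ : V ≃ W := ((Equiv.sigmaFiberEquiv π).symm.trans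
    (Equiv.sigmaCongrRight fun i => (f i).toEquiv)).trans (Equiv.sigmaFiberEquiv ρ)
  have hψ : ∀ i v (h : π v = i), ψ v = ((f i).toEquiv ⟨v, h⟩).1 := by
    rintro _ v rfl
    rfl
  refine ⟨ψ, fun v => ?_, fun v => ?_, fun e w v h => ?_⟩
  · rw [hψ _ v rfl]
    exact ((f (π v)).toEquiv ⟨v, rfl⟩).2
  · rw [hψ _ v rfl]
    exact (f (π v)).map_label ⟨v, rfl⟩
  · rw [hψ _ v rfl, hψ _ w h]
    exact (f (π v)).map_R e ⟨w, h⟩ ⟨v, rfl⟩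

/-- The minimal vertex below a vertex. -/
def rootOf [Finite V] (F : ColForest E L V) (v : V) : {r : V // F.IsMinimal r} :=
  ⟨(F.exists_isMinimal_le v).choose, (F.exists_isMinimal_le v).choose_spec.1⟩

theorem rootOf_eq_iff [Finite V] (F : ColForest E L V) (v : V) (r : {r : V // F.IsMinimal r}) :
    F.rootOf v = r ↔ F.le r.1 v := by
  have h := (F.exists_isMinimal_le v).choose_spec.2
  refine ⟨?_, fun hr => Subtype.ext ((F.rootOf v).2.eq_of_le r.2 h hr)⟩
  rintro rfl
  exact h

theorem rootOf_eq_of_R [Finite V] (F : ColForest E L V) (e : E) (w v : V) (h : F.R e w v) :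
    F.rootOf w = F.rootOf v := by
  symm
  rw [rootOf_eq_iff]
  exact le_trans ((F.rootOf_eq_iff w _).1 rfl) (Or.inr ⟨e, h⟩)

/-- The fibers of `rootOf` are the connected components. -/
def fiberRootOf [Finite V] (F : ColForest E L V) (r : {r : V // F.IsMinimal r}) :
    (F.sub {v | F.rootOf v = r}).Iso (F.component r.1) :=
  Iso.subCongr F (by ext v; exact F.rootOf_eq_iff v r)

/-- Forests with the same components are isomorphic. -/
theorem nonempty_iso_of_components_eq [Fintype V] [Fintype W] {F : ColForest E L V}
    {G : ColForest E L W} (h : F.components = G.components) : Nonempty (F.Iso G) := by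
  obtain ⟨e, he⟩ := exists_equiv_of_sum_single_eq _ _ h
  obtain ⟨ψ, h1, h2, h3⟩ := exists_glue (F := F) (G := G) F.rootOf
    (fun w => e.symm (G.rootOf w)) fun r => by
      obtain ⟨f⟩ := (toRTree_eq_iff _ _).1 (he r)
      refine ⟨((F.fiberRootOf r).trans f.symm).trans ((G.fiberRootOf (e r)).symm.trans
        (Iso.subCongr G ?_))⟩
      ext w
      exact (Equiv.symm_apply_eq e).symm
  refine ⟨⟨ψ, fun c w v => ⟨fun hR => (h3 c w v (F.rootOf_eq_of_R c w v hR)).1 hR,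
    fun hR => (h3 c w v ?_).2 hR⟩, h2⟩⟩
  rw [← h1, ← h1, G.rootOf_eq_of_R c _ _ hR]

/-- Trees with isomorphic branches at the root are isomorphic. -/
theorem nonempty_iso_of_branches {F : ColForest E L V} {G : ColForest E L W} {r : V} {s : W}
    (hr : F.IsRoot r) (hs : G.IsRoot s) (hl : F.label r = G.label s)
    (φ : ∀ e, Nonempty ((F.sub {v | F.R e r v}).Iso (G.sub {w | G.R e s w}))) :
    Nonempty (F.Iso G) := by
  -- The vertices are sorted by the branch they lie in: `none` for the root itself, `some e` for the
  -- vertices reached from the root through an edge of color `e`.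
  have hcol : ∀ {V : Type} {F : ColForest E L V} {r : V}, F.IsRoot r →
      ∃ π : V → Option E, ∀ v, (π v = none ↔ v = r) ∧ ∀ e, π v = some e ↔ F.R e r v := by
    intro V F r hr
    refine ⟨fun v => if h : F.lt r v then some h.choose else none, fun v => ⟨?_, fun e => ?_⟩⟩
    · by_cases hv : v = r
      · subst hv
        simp [F.lt_irrefl]
      · simp [hr v hv, hv]
    · by_cases hv : F.lt r v
      · simp only [hv, dite_true, Option.some.injEq]
        refine ⟨?_, fun h => F.color_unique _ _ _ _ hv.choose_spec h⟩
        rintro rfl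
        exact hv.choose_spec
      · simp only [hv, dite_false]
        exact ⟨fun h => by simp at h, fun h => absurd ⟨e, h⟩ hv⟩
  obtain ⟨π, hπ⟩ := hcol hr
  obtain ⟨ρ, hρ⟩ := hcol hs
  obtain ⟨ψ, h1, h2, h3⟩ := exists_glue (F := F) (G := G) π ρ fun i => by
    cases i with
    | none =>
      have : Unique {v | π v = none} :=
        ⟨⟨⟨r, (hπ r).1.2 rfl⟩⟩, fun v => Subtype.ext ((hπ v).1.1 v.2)⟩
      have : Unique {w | ρ w = none} :=
        ⟨⟨⟨s, (hρ s).1.2 rfl⟩⟩, fun v => Subtype.ext ((hρ v).1.1 v.2)⟩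
      refine ⟨⟨Equiv.ofUnique _ _, fun e w v => ?_, fun v => ?_⟩⟩
      · rw [Subsingleton.elim w v]
        exact ⟨fun h => absurd h (ColForest.irrefl _ _ _),
          fun h => absurd h (ColForest.irrefl _ _ _)⟩
      · obtain ⟨v, hv⟩ := v
        obtain rfl := (hπ v).1.1 hv
        exact hl.trans (congrArg G.label ((hρ _).1.1
          (Equiv.ofUnique {v | π v = none} {w | ρ w = none} ⟨v, hv⟩).2).symm)
    | some e =>
      obtain ⟨f⟩ := φ e
      exact ⟨(Iso.subCongr F (by ext v; exact (hπ v).2 e)).trans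
        (f.trans (Iso.subCongr G (by ext v; exact ((hρ v).2 e).symm)))⟩
  have hψr : ψ r = s := (hρ _).1.1 (by rw [h1, (hπ r).1.2 rfl])
  -- a pair in the order lies in one fiber, unless its lower vertex is the root
  have hfib : ∀ {V : Type} {F : ColForest E L V} {r : V} {π : V → Option E}, F.IsRoot r →
      (∀ v, (π v = none ↔ v = r) ∧ ∀ e, π v = some e ↔ F.R e r v) →
      ∀ e w v, F.R e w v → w ≠ r → π w = π v := by
    intro V F r π hr hπ e w v h hw
    obtain ⟨c, hc⟩ := hr w hw
    rw [((hπ w).2 c).2 hc, ((hπ v).2 c).2 (F.trans _ _ _ _ _ hc h)]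
  refine ⟨⟨ψ, fun e w v => ?_, h2⟩⟩
  by_cases hw : w = r
  · subst hw
    rw [hψr, ← (hπ v).2 e, ← (hρ _).2 e, h1]
  · constructor
    · exact fun h => (h3 e w v (hfib hr hπ e w v h hw)).1 h
    · refine fun h => (h3 e w v ?_).2 h
      rw [← h1, ← h1]
      exact hfib hs hρ e _ _ h (by rwa [← hψr, ψ.injective.ne_iff])

theorem node_isRoot {W : ι → Type} (B : ∀ i, ColForest E L (W i)) (c : ι → E) (l : L) :
    (node B c l).IsRoot none := by
  intro v hv
  cases v with
  | none => exact absurd rfl hv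
  | some v => exact ⟨_, rfl⟩

/-- The branches of color `e` at the root of a tree obtained by adding a root. -/
theorem node_branch_components [Fintype ι] {W : ι → Type} [∀ i, Fintype (W i)]
    (B : ∀ i, ColForest E L (W i)) (c : ι → E) (l : L) (e : E)
    [Fintype {v | (node B c l).R e none v}] [Fintype {j : ι // c j = e}] :
    ((node B c l).sub {v | (node B c l).R e none v}).components =
      ∑ j : {j : ι // c j = e}, (B j).components := by
  have hv : ∀ v : {v | (node B c l).R e none v}, ∃ j : ι, ∃ a : W j,
      v.1 = some ⟨j, a⟩ ∧ c j = e := by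
    rintro ⟨v, hv⟩
    cases v with
    | none => exact hv.elim
    | some v => exact ⟨v.1, v.2, rfl, hv.symm⟩
  -- A vertex of the branch is sent to the index of the forest it comes from; forests with different
  -- indices are not joined to each other above the new root.
  let π : {v | (node B c l).R e none v} → {j : ι // c j = e} := fun v =>
    ⟨(hv v).choose, (hv v).choose_spec.choose_spec.2⟩
  have hπ : ∀ j (a : W j) (h : some ⟨j, a⟩ ∈ {v | (node B c l).R e none v}),
      (π ⟨some ⟨j, a⟩, h⟩).1 = j := by
    intro j a h
    have := (hv ⟨some ⟨j, a⟩, h⟩).choose_spec.choose_spec.1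
    exact (congrArg Sigma.fst (Option.some_injective _ this)).symm
  rw [components_eq_sum_fiber _ π]
  · refine Fintype.sum_congr _ _ fun j => Iso.components_eq (Iso.symm ?_)
    have hinj : Function.Injective fun a : W j => some (⟨j, a⟩ : Σ i, W i) := by
      intro a b h
      simpa using h
    refine Iso.trans (⟨Equiv.refl _, fun d w v => ?_, fun v => ?_⟩ :
        (B j).Iso ((node B c l).comap (fun a : W j => some (⟨j, a⟩ : Σ i, W i)) hinj))
      ((Iso.refl _).comapOfRange (j := fun a : {v | π v = j} => a.1.1) hinj
        (fun _ _ h => Subtype.ext (Subtype.ext h)) fun w => ?_)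
    · constructor
      · exact fun h => ⟨j, w, v, rfl, rfl, h⟩
      · rintro ⟨i, a, b, h1, h2, h⟩
        cases h1
        cases h2
        exact h
    · rfl
    · constructor
      · rintro ⟨a, rfl⟩
        exact ⟨⟨⟨some ⟨j, a⟩, j.2.symm⟩, Subtype.ext (hπ _ _ _)⟩, rfl⟩
      · rintro ⟨⟨⟨b, hb⟩, hj⟩, rfl⟩
        cases b with
        | none => exact hb.elim
        | some b =>
          obtain ⟨i, b⟩ := b
          have := hπ i b hb
          rw [hj] at this
          subst this
          exact ⟨b, rfl⟩
  · rintro d ⟨w, hw⟩ ⟨v, hv⟩ h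
    cases w with
    | none => exact hw.elim
    | some w =>
      cases v with
      | none => exact hv.elim
      | some v =>
        obtain ⟨i, a, b, rfl, rfl, -⟩ := h
        exact Subtype.ext ((hπ _ _ _).trans (hπ _ _ _).symm)

end ColForest

/-- The index type lists each tree of the monomial as often as its exponent says; it is the index
type used in `nodeTree`. -/
theorem sum_single_fin {E L : Type} (m : RTree E L →₀ ℕ) :
    ∑ j : (t : {t // t ∈ m.support}) × Fin (m t.1), Finsupp.single j.1.1 1 = m := by
  rw [Fintype.sum_sigma]
  simp only [Finset.sum_const, Finset.card_univ, Fintype.card_fin]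
  rw [Finset.sum_coe_sort m.support fun t => m t • Finsupp.single t 1]
  conv_rhs => rw [← Finsupp.sum_single m]
  exact Finset.sum_congr rfl fun t _ => by rw [Finsupp.smul_single, smul_eq_mul, mul_one]

variable {n : ℕ}

/-- The tree with prescribed branches at the root. -/
def nodeForest (x : Fin n → (ETree n →₀ ℕ)) : ColForest (Fin n) Unit
    (Option (Σ j : (i : Fin n) × (t : {t // t ∈ (x i).support}) × Fin (x i t.1),
      Fin j.2.1.1.size)) :=
  node (ι := (i : Fin n) × (t : {t // t ∈ (x i).support}) × Fin (x i t.1))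
    (fun j => j.2.1.1.rep) (fun j => j.1) ()

theorem nodeForest_branch_components (x : Fin n → (ETree n →₀ ℕ)) (i : Fin n)
    [inst : Fintype {v | (nodeForest x).R i none v}] :
    ((nodeForest x).sub {v | (nodeForest x).R i none v}).components = x i := by
  refine (@node_branch_components (Fin n) Unit _ _ _ _ (fun j : (i : Fin n) ×
    (t : {t // t ∈ (x i).support}) × Fin (x i t.1) => j.2.1.1.rep) (fun j => j.1) () i
    inst _).trans ?_
  conv_rhs => rw [← sum_single_fin (x i)]
  refine (Fintype.sum_bijective (fun j => (⟨⟨i, j⟩, rfl⟩ : {j : (i : Fin n) ×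
    (t : {t // t ∈ (x i).support}) × Fin (x i t.1) // j.1 = i})) ⟨fun j j' h => ?_, ?_⟩ _ _
    fun j => ?_).symm
  · simpa using h
  · rintro ⟨⟨_, j⟩, rfl⟩
    exact ⟨j, rfl⟩
  · rw [(RTree.rep_isTree _).components_eq, RTree.toRTree_rep]

/-- A tree is obtained from its branches by adding a root. -/
theorem toRTree_eq_nodeTree {V : Type} [Fintype V] {F : ColForest (Fin n) Unit V} {r : V}
    (hr : F.IsRoot r) (hF : F.IsTree) :
    F.toRTree hF = nodeTree fun i => (F.sub {v | F.R i r v}).components := by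
  refine (toRTree_eq_iff _ _).2 (nonempty_iso_of_branches hr (node_isRoot _ _ _) rfl fun i => ?_)
  exact nonempty_iso_of_components_eq (nodeForest_branch_components
    (fun i => (F.sub {v | F.R i r v}).components) i).symm

/-- Families of subsets of disjoint sets correspond to subsets of the union. -/
theorem sum_pi_set {V ι M : Type*} [Fintype V] [AddCommMonoid M] (fib : ι → Set V)
    {_ : Fintype (∀ i, Set (fib i))}
    (hdisj : ∀ v i j, v ∈ fib i → v ∈ fib j → i = j) (P : Set V → Prop)
    [DecidablePred P] (hP : ∀ S, P S ↔ ∀ v ∈ S, ∃ i, v ∈ fib i)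
    (g : (∀ i, Set (fib i)) → M) :
    ∑ T, g T = ∑ S ∈ Finset.univ.filter P, g fun i => Subtype.val ⁻¹' S := by
  have key : ∀ T : (i : ι) → Set (fib i), ∀ i,
      (Subtype.val ⁻¹' (⋃ i, Subtype.val '' T i) : Set (fib i)) = T i := fun T i => by
    ext v
    simp only [Set.mem_preimage, Set.mem_iUnion, Set.mem_image]
    constructor
    · rintro ⟨j, w, hw, h⟩
      obtain rfl := hdisj v.1 j i (h ▸ w.2) v.2
      rwa [← Subtype.ext h]
    · exact fun h => ⟨i, v, h, rfl⟩
  refine Finset.sum_nbij' (fun T => ⋃ i, Subtype.val '' T i) (fun S i => Subtype.val ⁻¹' S)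
    (fun T _ => ?_) (fun _ _ => Finset.mem_univ _) (fun T _ => funext fun i => key T i)
    (fun S hS => ?_) fun T _ => ?_
  · simp only [Finset.mem_filter, Finset.mem_univ, true_and, hP, Set.mem_iUnion, Set.mem_image]
    rintro v ⟨i, w, -, rfl⟩
    exact ⟨i, w.2⟩
  · ext v
    simp only [Set.mem_iUnion, Set.mem_image, Set.mem_preimage]
    constructor
    · rintro ⟨i, w, hw, rfl⟩
      exact hw
    · intro hv
      obtain ⟨i, hi⟩ := (hP S).1 (Finset.mem_filter.1 hS).2 v hv
      exact ⟨i, ⟨v, hi⟩, hv, rfl⟩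
  · exact congrArg g (funext fun i => (key T i).symm)

theorem prod_tmul_prod {k ι A B : Type*} [CommSemiring k] [CommSemiring A] [CommSemiring B]
    [Algebra k A] [Algebra k B] (s : Finset ι) (a : ι → A) (b : ι → B) :
    ∏ i ∈ s, a i ⊗ₜ[k] b i = (∏ i ∈ s, a i) ⊗ₜ[k] ∏ i ∈ s, b i := by
  induction s using Finset.cons_induction with
  | empty => rfl
  | cons i s hi ih => simp only [Finset.prod_cons, ih, Algebra.TensorProduct.tmul_mul_tmul]

/-! ### Monomials of forests and of their subforests. -/

section ForestElt

variable {k : Type*} [Field k] {n : ℕ} {V W ι : Type}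

theorem ColForest.Iso.forestElt_eq {_ : Fintype V} {_ : Fintype W} {F : ColForest (Fin n) Unit V}
    {G : ColForest (Fin n) Unit W} (f : F.Iso G) : forestElt k F = forestElt k G := by
  rw [forestElt, forestElt, f.components_eq]

theorem ColForest.IsTree.forestElt_eq {_ : Fintype V} {F : ColForest (Fin n) Unit V}
    (hF : F.IsTree) : forestElt k F = MvPolynomial.X (F.toRTree hF) := by
  rw [forestElt, hF.components_eq]
  rfl

theorem forestElt_of_isEmpty {_ : Fintype V} [IsEmpty V] (F : ColForest (Fin n) Unit V) :
    forestElt k F = 1 := by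
  have : F.components = 0 := by
    unfold components
    exact Finset.sum_eq_zero fun r _ => (IsEmpty.false r.1).elim
  rw [forestElt, this]
  rfl

variable {p : Finset (Fin n)}

/-- The vertex sets that contribute to the coproduct: no vertex of the complement is above
a vertex of `S`, and on the paths from outside `S` to a vertex of `S` all edges that start outside
of `S` have a color in `p`. -/
def IsUpper (p : Finset (Fin n)) (F : ColForest (Fin n) Unit V) (S : Set V) : Prop :=
  ∀ e w v, F.R e w v → (w ∈ S → v ∈ S) ∧ (w ∉ S → v ∈ S → e ∈ p)

theorem isUpper_univ (F : ColForest (Fin n) Unit V) : IsUpper p F Set.univ :=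
  fun _ _ _ _ => ⟨fun _ => trivial, fun h => absurd trivial h⟩

theorem isUpper_iso {F : ColForest (Fin n) Unit V} {G : ColForest (Fin n) Unit W} (f : F.Iso G)
    (T : Set W) : IsUpper p F (f.toEquiv ⁻¹' T) ↔ IsUpper p G T := by
  unfold IsUpper
  refine forall_congr' fun e => ?_
  rw [← f.toEquiv.forall_congr_right]
  refine forall_congr' fun w => ?_
  rw [← f.toEquiv.forall_congr_right]
  simp [f.map_R]

variable [Fintype V] [Fintype W] [Fintype ι]

/-- The monomial of a subforest. -/
def subElt (k : Type*) [Field k] (F : ColForest (Fin n) Unit V) (S : Set V) : TreeAlg k n :=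
  forestElt k (F.sub S)

/-- Absorbs the choice of the `Fintype` instance on `S`: the identity is an isomorphism between the
two readings. -/
theorem forestElt_sub (F : ColForest (Fin n) Unit V) (S : Set V) {_ : Fintype S} :
    forestElt k (F.sub S) = subElt k F S :=
  (Iso.refl _).forestElt_eq

theorem subElt_univ (F : ColForest (Fin n) Unit V) : subElt k F Set.univ = forestElt k F :=
  (Iso.subUniv F (S := Set.univ) Set.mem_univ).forestElt_eq

theorem subElt_empty (F : ColForest (Fin n) Unit V) : subElt k F ∅ = 1 :=
  forestElt_of_isEmpty _

theorem subElt_iso {F : ColForest (Fin n) Unit V} {G : ColForest (Fin n) Unit W} (f : F.Iso G)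
    {S : Set V} {T : Set W} (h : ∀ v, v ∈ S ↔ f.toEquiv v ∈ T) : subElt k F S = subElt k G T :=
  (f.sub h).forestElt_eq

theorem subElt_sub (F : ColForest (Fin n) Unit V) (S : Set V) {_ : Fintype S} (T : Set S) :
    subElt k (F.sub S) T = subElt k F (Subtype.val '' T) :=
  (Iso.subSub F S T).forestElt_eq

theorem subElt_sub_preimage (F : ColForest (Fin n) Unit V) (S : Set V) {_ : Fintype S} (T : Set V) :
    subElt k (F.sub S) (Subtype.val ⁻¹' T) = subElt k F (S ∩ T) := by
  rw [subElt_sub, Subtype.image_preimage_coe]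

/-- By `hfib`, comparable vertices of `S` lie in the same `fib i`, so the components of the
subforest on `S` are distributed over the fibers and its monomial factors. -/
theorem subElt_eq_prod (F : ColForest (Fin n) Unit V) (S : Set V) (fib : ι → Set V)
    [∀ i, Fintype (fib i)] (hdisj : ∀ v i j, v ∈ fib i → v ∈ fib j → i = j)
    (hS : ∀ v ∈ S, ∃ i, v ∈ fib i)
    (hfib : ∀ e w v i, w ∈ S → F.R e w v → v ∈ fib i → w ∈ fib i) :
    subElt k F S = ∏ i, subElt k (F.sub (fib i)) (Subtype.val ⁻¹' S) := by
  choose π hπ using hS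
  rw [subElt, forestElt, components_eq_sum_fiber (F.sub S) (fun v => π v.1 v.2),
    MvPolynomial.monomial_sum_one]
  · refine Finset.prod_congr rfl fun i _ => ?_
    rw [subElt_sub_preimage]
    refine ((Iso.subSub F S _).trans (Iso.subCongr F ?_)).forestElt_eq
    ext v
    constructor
    · rintro ⟨w, rfl, rfl⟩
      exact ⟨hπ _ _, w.2⟩
    · rintro ⟨hi, hv⟩
      exact ⟨⟨v, hv⟩, hdisj v _ _ (hπ v hv) hi, rfl⟩
  · intro e w v h
    exact hdisj w.1 _ _ (hπ _ _) (hfib e w.1 v.1 _ w.2 h (hπ _ _))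

theorem numVertices_components (F : ColForest (Fin n) Unit V) :
    numVertices F.components = Fintype.card V := by
  have h : ∀ r : {r : V // F.IsMinimal r},
      ((F.component r.1).toRTree (F.component_isTree r.1)).size =
        Fintype.card {v // F.rootOf v = r} := fun r => by
    rw [size_toRTree, ← Nat.card_eq_fintype_card]
    exact (Nat.card_congr (F.fiberRootOf r).toEquiv).symm
  rw [numVertices, components, map_sum]
  simp only [Finsupp.weight_single, one_smul, h]
  rw [← Fintype.card_sigma]
  exact Fintype.card_congr (Equiv.sigmaFiberEquiv F.rootOf)

/-! ## The coproduct of a forest -/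

/-- The coproduct of a forest. -/
def coprod (k : Type*) [Field k] (p : Finset (Fin n)) (F : ColForest (Fin n) Unit V) :
    TreeAlg k n ⊗[k] TreeAlg k n :=
  ∑ S : Set V, if IsUpper p F S then subElt k F S ⊗ₜ[k] subElt k F Sᶜ else 0

theorem ColForest.Iso.coprod_eq {F : ColForest (Fin n) Unit V}
    {G : ColForest (Fin n) Unit W} (f : F.Iso G) : coprod k p F = coprod k p G := by
  refine (Fintype.sum_bijective (fun T : Set W => f.toEquiv ⁻¹' T)
    ⟨Set.preimage_injective.2 f.toEquiv.surjective,
      Set.preimage_surjective.2 f.toEquiv.injective⟩ _ _ fun T => ?_).symm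
  simp only [isUpper_iso]
  rw [subElt_iso f (S := f.toEquiv ⁻¹' T) (T := T) fun v => Iff.rfl,
    subElt_iso f (S := (f.toEquiv ⁻¹' T)ᶜ) (T := Tᶜ) fun v => Iff.rfl]

/-- The condition `IsUpper` only compares vertices related by `R`, hence vertices in the same fiber.
Choosing `S` is choosing its trace on each fiber, and expanding the product of the sums gives the
sum over `S`. -/
theorem coprod_eq_prod (F : ColForest (Fin n) Unit V) (π : V → ι)
    (hπ : ∀ e w v, F.R e w v → π w = π v) [∀ i, Fintype {v | π v = i}] :
    coprod k p F = ∏ i, coprod k p (F.sub {v | π v = i}) := by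
  have hdisj : ∀ v i j, v ∈ {v | π v = i} → v ∈ {v | π v = j} → i = j := by
    rintro v i j rfl h
    exact h
  have helt : ∀ S, subElt k F S = ∏ i, subElt k (F.sub {v | π v = i}) (Subtype.val ⁻¹' S) :=
    fun S => subElt_eq_prod F S _ hdisj (fun v _ => ⟨_, rfl⟩) fun e w v i _ h hv =>
      (hπ e w v h).trans hv
  have hup : ∀ S, IsUpper p F S ↔
      ∀ i, IsUpper p (F.sub {v | π v = i}) (Subtype.val ⁻¹' S) := fun S => by
    constructor
    · exact fun h i e w v hR => h e w.1 v.1 hR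
    · exact fun h e w v hR => h (π v) e ⟨w, hπ _ _ _ hR⟩ ⟨v, rfl⟩ hR
  simp only [coprod]
  rw [Finset.prod_univ_sum, Fintype.piFinset_univ,
    sum_pi_set (fun i => {v | π v = i}) hdisj (fun _ => True)
    fun S => ⟨fun _ v _ => ⟨π v, rfl⟩, fun _ => trivial⟩, Finset.filter_true]
  simp only [Finset.prod_ite_zero, prod_tmul_prod, Finset.mem_univ, true_implies,
    ← Set.preimage_compl]
  refine Finset.sum_congr rfl fun S _ => ?_
  simp only [hup, helt]

/-- The coproduct as a morphism of algebras. -/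
def coprodHom (k : Type*) [Field k] (p : Finset (Fin n)) :
    TreeAlg k n →ₐ[k] TreeAlg k n ⊗[k] TreeAlg k n :=
  MvPolynomial.aeval fun t => coprod k p t.rep

theorem coprodHom_X (t : ETree n) : coprodHom k p (MvPolynomial.X t) = coprod k p t.rep :=
  MvPolynomial.aeval_X _ _

theorem forestElt_eq_prod_X (F : ColForest (Fin n) Unit V) :
    forestElt k F = ∏ r : {r : V // F.IsMinimal r},
      MvPolynomial.X ((F.component r.1).toRTree (F.component_isTree r.1)) := by
  rw [forestElt, components, MvPolynomial.monomial_sum_one]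
  rfl

/-- The morphism is defined on trees only; multiplicativity of `coprod` over the components shows
that the sum over vertex sets computes it on every forest. -/
theorem coprodHom_forestElt (F : ColForest (Fin n) Unit V) :
    coprodHom k p (forestElt k F) = coprod k p F := by
  rw [forestElt_eq_prod_X, map_prod, coprod_eq_prod F F.rootOf F.rootOf_eq_of_R]
  refine Finset.prod_congr rfl fun r _ => ?_
  rw [coprodHom_X]
  obtain ⟨f⟩ := nonempty_iso_rep (F.component_isTree r.1)
  exact ((F.fiberRootOf r).trans f).coprod_eq.symm

end ForestElt

/-! ### The recursion for the coproduct at the root of a tree. -/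

section Coproduct

variable {k : Type*} [Field k] {n : ℕ} {V W : Type} {p : Finset (Fin n)}

/-- The pairs whose lower vertex is not the root lie inside one branch and give the first condition.
The pairs that start at the root say that `S` meets only branches whose color is in `p`, which is
the second condition. -/
theorem isUpper_iff_of_root_notMem {F : ColForest (Fin n) Unit V} {r : V} (hr : F.IsRoot r)
    {S : Set V} (hS : r ∉ S) :
    IsUpper p F S ↔ (∀ i, IsUpper p (F.sub {v | F.R i r v}) (Subtype.val ⁻¹' S)) ∧
      ∀ i, i ∉ p → (Subtype.val ⁻¹' S : Set {v | F.R i r v}) = ∅ := by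
  constructor
  · refine fun h => ⟨fun i e w v hR => h e w.1 v.1 hR, fun i hi => ?_⟩
    refine Set.eq_empty_of_forall_notMem fun v hv => hi ((h i r v.1 v.2).2 hS hv)
  · rintro ⟨h1, h2⟩ e w v hR
    have hp : ∀ i, F.R i r v → v ∈ S → i ∈ p := fun i hi hv => by
      by_contra hip
      exact Set.eq_empty_iff_forall_notMem.1 (h2 i hip) ⟨v, hi⟩ hv
    by_cases hw : w = r
    · subst hw
      exact ⟨fun h => absurd h hS, fun _ => hp e hR⟩
    · obtain ⟨i, hi⟩ := hr w hw
      exact h1 i e ⟨w, hi⟩ ⟨v, F.trans _ _ _ _ _ hi hR⟩ hR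

theorem eq_univ_of_root_mem {F : ColForest (Fin n) Unit V} {r : V} (hr : F.IsRoot r)
    {S : Set V} (h : IsUpper p F S) (hS : r ∈ S) : S = Set.univ := by
  refine Set.eq_univ_of_forall fun v => ?_
  by_cases hv : v = r
  · exact hv ▸ hS
  · obtain ⟨e, he⟩ := hr v hv
    exact (h e r v he).1 hS

theorem branch_unique {F : ColForest (Fin n) Unit V} {r : V} (v : V) (i j : Fin n)
    (hi : v ∈ {v | F.R i r v}) (hj : v ∈ {v | F.R j r v}) : i = j :=
  F.color_unique i j r v hi hj

variable [Fintype V] [Fintype W]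

theorem tprod_monomial (m : Fin n → (ETree n →₀ ℕ)) :
    PiTensorProduct.tprod k (fun i => (MvPolynomial.monomial (m i) 1 : TreeAlg k n)) =
      tensorBasis k n m := by
  rw [tensorBasis, Basis.piTensorProduct_apply]
  rfl

theorem lam_tprod_monomial (m : Fin n → (ETree n →₀ ℕ)) :
    lam k n (PiTensorProduct.tprod k fun i => MvPolynomial.monomial (m i) 1) =
      MvPolynomial.X (nodeTree m) := by
  rw [tprod_monomial, lam, Module.Basis.constr_basis]

theorem sigma_tprod_monomial (q : Fin n → k) (m : Fin n → (ETree n →₀ ℕ)) :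
    sigma q (PiTensorProduct.tprod k fun i => MvPolynomial.monomial (m i) 1) =
      (∏ j, q j ^ numVertices (m j)) • ∏ j, MvPolynomial.monomial (m j) (1 : k) := by
  rw [tprod_monomial, sigma, Module.Basis.constr_basis]

theorem sigma_tprod_subElt {V : Fin n → Type} [∀ i, Fintype (V i)] (q : Fin n → k)
    (F : ∀ i, ColForest (Fin n) Unit (V i)) (S : ∀ i, Set (V i)) :
    sigma q (PiTensorProduct.tprod k fun i => subElt k (F i) (S i)) =
      (∏ j, q j ^ Nat.card (S j)) • ∏ j, subElt k (F j) (S j) := by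
  have h := sigma_tprod_monomial q fun i => ((F i).sub (S i)).components
  simp only [numVertices_components, ← Nat.card_eq_fintype_card] at h
  exact h

/-- The operation `λ`, applied to the branches at the root of a tree. -/
theorem lam_branches {F : ColForest (Fin n) Unit V} {r : V} (hr : F.IsRoot r)
    [∀ i, Fintype {v | F.R i r v}] :
    lam k n (PiTensorProduct.tprod k fun i => forestElt k (F.sub {v | F.R i r v})) =
      forestElt k F := by
  have hF : F.IsTree := ⟨r, hr⟩
  rw [hF.forestElt_eq, toRTree_eq_nodeTree hr hF, ← lam_tprod_monomial]
  refine congrArg _ (congrArg _ (funext fun i => ?_))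
  exact (Iso.refl (F.sub {v | F.R i r v})).forestElt_eq

/-- Since `S` contains the root, its subforest is a tree. Restriction keeps first-edge colors, so
the branch of color `i` of the restriction is the trace on `S` of the branch of color `i` of `F`. -/
theorem lam_tprod_subElt {F : ColForest (Fin n) Unit V} {r : V} (hr : F.IsRoot r) {S : Set V}
    (hS : r ∈ S) :
    lam k n (PiTensorProduct.tprod k fun i => subElt k (F.sub {v | F.R i r v})
      (Subtype.val ⁻¹' S)) = subElt k F S := by
  have hr' : (F.sub S).IsRoot ⟨r, hS⟩ := fun v hv => hr v.1 fun h => hv (Subtype.ext h)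
  refine Eq.trans ?_ (lam_branches hr')
  refine congrArg _ (congrArg _ (funext fun i => ?_))
  refine (subElt_sub_preimage _ _ _).trans (Eq.symm ?_)
  refine (Iso.trans (Iso.subSub F S _) (Iso.subCongr F ?_)).forestElt_eq
  ext v
  constructor
  · rintro ⟨w, hw, rfl⟩
    exact ⟨hw, w.2⟩
  · exact fun h => ⟨⟨v, h.2⟩, h.1, rfl⟩

/-- The coproduct of a tree without the term `t ⊗ 1`. -/
theorem coprod_of_isRoot {F : ColForest (Fin n) Unit V} {r : V} (hr : F.IsRoot r) :
    coprod k p F = forestElt k F ⊗ₜ[k] 1 + ∑ S ∈ Finset.univ.filter (fun S : Set V => r ∉ S),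
      if IsUpper p F S then subElt k F S ⊗ₜ[k] subElt k F Sᶜ else 0 := by
  rw [coprod, ← Finset.sum_filter_not_add_sum_filter Finset.univ (fun S : Set V => r ∉ S)]
  congr 1
  rw [Finset.sum_eq_single_of_mem Set.univ (by simp), if_pos (isUpper_univ F), subElt_univ,
    Set.compl_univ, subElt_empty]
  intro S hS hne
  rw [if_neg fun h => hne (eq_univ_of_root_mem hr h (by simpa using hS))]

/-- The map `twist` is multilinear. -/
def twistMultilinear (k : Type*) [Field k] (n : ℕ) :
    MultilinearMap k (fun _ : Fin n => TreeAlg k n ⊗[k] TreeAlg k n)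
      ((PiTensorProduct k fun _ : Fin n => TreeAlg k n) ⊗[k]
        (PiTensorProduct k fun _ : Fin n => TreeAlg k n)) :=
  (MultilinearMap.mkPiAlgebra k (Fin n) ((PiTensorProduct k fun _ : Fin n => TreeAlg k n) ⊗[k]
    (PiTensorProduct k fun _ : Fin n => TreeAlg k n))).compLinearMap fun i =>
    (Algebra.TensorProduct.map
      (PiTensorProduct.singleAlgHom (R := k) (A := fun _ : Fin n => TreeAlg k n) i)
      (PiTensorProduct.singleAlgHom (R := k) (A := fun _ : Fin n => TreeAlg k n) i)).toLinearMap

theorem twistMultilinear_apply (z : Fin n → TreeAlg k n ⊗[k] TreeAlg k n) :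
    twistMultilinear k n z = twist z := rfl

theorem twist_sum_ite {ι : Fin n → Type} [∀ i, Fintype (ι i)] (P : ∀ i, ι i → Prop)
    (a b : ∀ i, ι i → TreeAlg k n) :
    twist (fun i => ∑ x, if P i x then a i x ⊗ₜ[k] b i x else 0) =
      ∑ x : (i : Fin n) → ι i, if ∀ i, P i (x i) then
        PiTensorProduct.tprod k (fun i => a i (x i)) ⊗ₜ[k]
          PiTensorProduct.tprod k (fun i => b i (x i)) else 0 := by
  rw [← twistMultilinear_apply, MultilinearMap.map_sum]
  refine Finset.sum_congr rfl fun x _ => ?_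
  by_cases h : ∀ i, P i (x i)
  · simp only [h, if_true, implies_true, twistMultilinear_apply, twist_tmul]
  · rw [if_neg h]
    push Not at h
    obtain ⟨i, hi⟩ := h
    exact MultilinearMap.map_coord_zero _ i (if_neg hi)

/-- A factor for a color outside `p` is a power of `0`, which is `1` exactly for exponent `0`, that
is, for an empty set. This is where `0 ^ 0 = 1` enters. -/
theorem sigma_coeff {ι : Fin n → Type} (S : ∀ i, Set (ι i)) [∀ i, Finite (S i)] {q₁ : Fin n → k}
    (hq₁ : q₁ = fun j => if j ∈ p then 1 else 0) :
    (∏ j, q₁ j ^ Nat.card (S j)) = if ∀ i, i ∉ p → S i = ∅ then 1 else 0 := by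
  have h1 : ∀ j, q₁ j ^ Nat.card (S j) = if j ∉ p → S j = ∅ then 1 else 0 := fun j => by
    rw [hq₁]
    by_cases hj : j ∈ p
    · simp [hj]
    · simp only [hj, if_false, not_false_eq_true, true_implies, zero_pow_eq,
        Finite.card_eq_zero_iff, Set.isEmpty_coe_sort]
  simp only [h1, Finset.prod_ite_zero, Finset.prod_const_one, Finset.mem_univ, true_implies]

theorem subElt_eq_prod_branches {F : ColForest (Fin n) Unit V} {r : V} (hr : F.IsRoot r)
    {S : Set V} (hS : r ∉ S) :
    subElt k F S = ∏ i, subElt k (F.sub {v | F.R i r v}) (Subtype.val ⁻¹' S) := by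
  refine subElt_eq_prod F S _ branch_unique (fun v hv => hr v fun h => hS (h ▸ hv)) ?_
  intro e w v i hw hR hv
  obtain ⟨j, hj⟩ := hr w fun h => hS (h ▸ hw)
  have := branch_unique v i j hv (F.trans _ _ _ _ _ hj hR)
  rwa [this]

/-- The coefficient of `σ₁` supplies precisely the color condition at the root that is missing from
the conditions in the branches; `λ` puts the root into the complement of `S`. -/
theorem sigma_tmul_lam {F : ColForest (Fin n) Unit V} {r : V} (hr : F.IsRoot r)
    {q₁ : Fin n → k} (hq₁ : q₁ = fun j => if j ∈ p then 1 else 0) {S : Set V} (hS : r ∉ S) :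
    TensorProduct.map (sigma q₁) (lam k n)
      (if ∀ i, IsUpper p (F.sub {v | F.R i r v}) (Subtype.val ⁻¹' S) then
          PiTensorProduct.tprod k (fun i => subElt k (F.sub {v | F.R i r v})
            (Subtype.val ⁻¹' S)) ⊗ₜ[k]
          PiTensorProduct.tprod k (fun i => subElt k (F.sub {v | F.R i r v})
            (Subtype.val ⁻¹' S)ᶜ)
        else 0) =
      if IsUpper p F S then subElt k F S ⊗ₜ[k] subElt k F Sᶜ else 0 := by
  have hσ : sigma q₁ (PiTensorProduct.tprod k fun i => subElt k (F.sub {v | F.R i r v})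
      (Subtype.val ⁻¹' S)) =
      if ∀ i, i ∉ p → (Subtype.val ⁻¹' S : Set {v | F.R i r v}) = ∅ then subElt k F S else 0 := by
    rw [sigma_tprod_subElt, sigma_coeff _ hq₁, ite_smul, one_smul, zero_smul,
      subElt_eq_prod_branches hr hS]
  have hl := lam_tprod_subElt (k := k) hr (S := Sᶜ) hS
  simp only [Set.preimage_compl] at hl
  by_cases h1 : ∀ i, IsUpper p (F.sub {v | F.R i r v}) (Subtype.val ⁻¹' S)
  · by_cases h2 : ∀ i, i ∉ p → (Subtype.val ⁻¹' S : Set {v | F.R i r v}) = ∅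
    · rw [if_pos h1, TensorProduct.map_tmul, hσ, hl, if_pos h2,
        if_pos ((isUpper_iff_of_root_notMem hr hS).2 ⟨h1, h2⟩)]
    · rw [if_pos h1, TensorProduct.map_tmul, hσ, if_neg h2, TensorProduct.zero_tmul,
        if_neg fun h => h2 ((isUpper_iff_of_root_notMem hr hS).1 h).2]
  · rw [if_neg h1, map_zero, if_neg fun h => h1 ((isUpper_iff_of_root_notMem hr hS).1 h).1]

/-- All parameters of `σ₂` are `0`, so only an empty right factor survives: every `T i` is the whole
branch. -/
theorem lam_tmul_sigma {F : ColForest (Fin n) Unit V} {r : V} (hr : F.IsRoot r)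
    (T : (i : Fin n) → Set {v | F.R i r v}) :
    TensorProduct.map (lam k n) (sigma fun _ => 0)
      (if ∀ i, IsUpper p (F.sub {v | F.R i r v}) (T i) then
          PiTensorProduct.tprod k (fun i => subElt k (F.sub {v | F.R i r v}) (T i)) ⊗ₜ[k]
          PiTensorProduct.tprod k (fun i => subElt k (F.sub {v | F.R i r v}) (T i)ᶜ)
        else 0) =
      if T = fun _ => Set.univ then forestElt k F ⊗ₜ[k] 1 else 0 := by
  have hc : ∀ T : (i : Fin n) → Set {v | F.R i r v},
      (∏ j, (0 : k) ^ Nat.card ((T j)ᶜ : Set _)) = if T = fun _ => Set.univ then 1 else 0 := by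
    intro T
    rw [sigma_coeff (p := ∅) (fun i => (T i)ᶜ) (by simp)]
    simp [funext_iff]
  by_cases hT : T = fun _ => Set.univ
  · subst hT
    rw [if_pos rfl, if_pos fun i => isUpper_univ _, TensorProduct.map_tmul, sigma_tprod_subElt, hc,
      if_pos rfl, one_smul, ← lam_branches hr]
    simp only [subElt_univ, Set.compl_univ, subElt_empty, Finset.prod_const_one]
  · rw [if_neg hT]
    split_ifs
    · rw [TensorProduct.map_tmul, sigma_tprod_subElt, hc, if_neg hT, zero_smul,
        TensorProduct.tmul_zero]
    · rw [map_zero]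

/-- The terms with the root outside `S` come from `σ₁ ⊗ λ`, and the single remaining term `F ⊗ 1`
comes from `λ ⊗ σ₂`. This is the defining recursion of the coproduct, for an actual tree. -/
theorem coprod_eq_of_isRoot {F : ColForest (Fin n) Unit V} {r : V} (hr : F.IsRoot r)
    {q₁ q₂ : Fin n → k} (hq₁ : q₁ = fun j => if j ∈ p then 1 else 0) (hq₂ : q₂ = fun _ => 0) :
    coprod k p F = (TensorProduct.map (sigma q₁) (lam k n) + TensorProduct.map (lam k n) (sigma q₂))
      (twist fun i => coprod k p (F.sub {v | F.R i r v})) := by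
  have htw := twist_sum_ite (k := k) (fun i => IsUpper p (F.sub {v | F.R i r v}))
    (fun i => subElt k (F.sub {v | F.R i r v})) (fun i T => subElt k (F.sub {v | F.R i r v}) Tᶜ)
  have htw' : twist (fun i => coprod k p (F.sub {v | F.R i r v})) = _ := htw
  rw [htw', LinearMap.add_apply, map_sum, map_sum, coprod_of_isRoot hr, add_comm, hq₂]
  congr 1
  · rw [sum_pi_set (fun i => {v | F.R i r v}) branch_unique (fun S => r ∉ S)]
    · refine Finset.sum_congr rfl fun S hS => ?_
      exact (sigma_tmul_lam hr hq₁ (Finset.mem_filter.1 hS).2).symm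
    · refine fun S => ⟨fun hS v hv => hr v fun h => hS (h ▸ hv), fun h hS => ?_⟩
      obtain ⟨i, hi⟩ := h r hS
      exact F.irrefl _ _ hi
  · simp only [lam_tmul_sigma hr]
    rw [Fintype.sum_ite_eq']

end Coproduct

theorem trunk_lower {n : ℕ} {V : Type} (F : ColForest (Fin n) Unit V) (c : Finset (V × V)) {w v : V}
    (h : F.le w v) (hv : v ∈ F.trunk c) : w ∈ F.trunk c :=
  fun a ha hw => hv a ha (le_trans hw h)

/-! ### Existence and uniqueness of the coproduct. -/

section CoproductHom

variable {k : Type*} [Field k] {n : ℕ} {V : Type} [Fintype V] {p : Finset (Fin n)}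
  {q₁ q₂ : Fin n → k}

theorem forestElt_nodeForest (m : Fin n → (ETree n →₀ ℕ)) :
    forestElt k (nodeForest m) = MvPolynomial.X (nodeTree m) :=
  IsTree.forestElt_eq (node_isTree _ _ _)

/-- Both sides are multilinear in the arguments, so forests suffice; for forests,
`coprod_eq_of_isRoot` is applied to the tree `nodeForest m`, whose branches are the given forests.
-/
theorem coprodHom_isCoproduct (hq₁ : q₁ = fun j => if j ∈ p then 1 else 0)
    (hq₂ : q₂ = fun _ => 0) : IsCoproduct q₁ q₂ (coprodHom k p) := by
  let f : MultilinearMap k (fun _ : Fin n => TreeAlg k n) (TreeAlg k n ⊗[k] TreeAlg k n) :=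
    ((coprodHom k p).toLinearMap ∘ₗ lam k n).compMultilinearMap (PiTensorProduct.tprod k)
  let g : MultilinearMap k (fun _ : Fin n => TreeAlg k n) (TreeAlg k n ⊗[k] TreeAlg k n) :=
    (TensorProduct.map (sigma q₁) (lam k n) +
      TensorProduct.map (lam k n) (sigma q₂)).compMultilinearMap
      ((twistMultilinear k n).compLinearMap fun _ => (coprodHom k p).toLinearMap)
  have h : f = g := by
    refine Module.Basis.ext_multilinear (fun _ => MvPolynomial.basisMonomials (ETree n) k)
      fun m => ?_
    simp only [MvPolynomial.coe_basisMonomials]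
    have hroot := node_isRoot (ι := (i : Fin n) × (t : {t // t ∈ (m i).support}) × Fin (m i t.1))
      (fun j => j.2.1.1.rep) (fun j => j.1) ()
    have key := coprod_eq_of_isRoot (k := k) (F := nodeForest m) hroot hq₁ hq₂
    rw [← coprodHom_forestElt, forestElt_nodeForest, ← lam_tprod_monomial] at key
    refine key.trans ?_
    refine congrArg _ (congrArg twist (funext fun i => ?_))
    rw [← coprodHom_forestElt, forestElt, nodeForest_branch_components]
    rfl
  exact fun x => DFunLike.congr_fun h x

theorem X_eq_lam_branches (t : ETree n) {r : Fin t.size} (hr : t.rep.IsRoot r) :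
    (MvPolynomial.X t : TreeAlg k n) = lam k n (PiTensorProduct.tprod k fun i =>
      forestElt k (t.rep.sub {v | t.rep.R i r v})) := by
  rw [lam_branches hr, t.rep_isTree.forestElt_eq, t.toRTree_rep]

/-- The recursion expresses the value on a tree through the values on the components of its
branches, which are smaller trees. -/
theorem IsCoproduct.unique {Δ Δ' : TreeAlg k n →ₐ[k] TreeAlg k n ⊗[k] TreeAlg k n}
    (h : IsCoproduct q₁ q₂ Δ) (h' : IsCoproduct q₁ q₂ Δ') : Δ' = Δ := by
  have key : ∀ N : ℕ, ∀ t : ETree n, t.size = N →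
      Δ' (MvPolynomial.X t) = Δ (MvPolynomial.X t) := by
    intro N
    induction N using Nat.strong_induction_on with
    | _ N ih =>
      intro t ht
      obtain ⟨r, hr⟩ := t.rep_isTree
      rw [X_eq_lam_branches t hr, h, h']
      refine congrArg _ (congrArg twist (funext fun i => ?_))
      rw [forestElt_eq_prod_X, map_prod, map_prod]
      -- A branch misses the root `r`, so each of its components has fewer vertices than `t`.
      refine Finset.prod_congr rfl fun s _ => ih _ ?_ _ rfl
      rw [size_toRTree]
      refine lt_of_le_of_lt (Finite.card_subtype_le _) ?_
      have := Finite.card_subtype_lt (p := fun v => v ∈ {v | t.rep.R i r v})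
        (t.rep.irrefl i r)
      rw [Nat.card_fin] at this
      exact ht ▸ this
  exact MvPolynomial.algHom_ext fun t => key _ t rfl

/-! ## Admissible cuts -/

/-- The edges that enter a set of vertices. -/
def cutOf (F : ColForest (Fin n) Unit V) (S : Set V) : Finset (V × V) :=
  Finset.univ.filter fun a => F.IsEdge a.1 a.2 ∧ a.1 ∉ S ∧ a.2 ∈ S

/-- A vertex of `S` lies above a minimal element of `S`. As the root is not in `S`, an edge ends in
this minimal element from below, and it enters `S`. -/
theorem trunk_cutOf {F : ColForest (Fin n) Unit V} {r : V} (hr : F.IsRoot r) {S : Set V}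
    (hS : IsUpper p F S) (hrS : r ∉ S) : (F.trunk (cutOf F S))ᶜ = S := by
  ext v
  constructor
  · intro hv
    by_contra hvS
    refine hv fun a ha hle => hvS ?_
    obtain ⟨-, -, ha⟩ := (Finset.mem_filter.1 ha).2
    rcases hle with rfl | ⟨e, he⟩
    · exact ha
    · exact (hS e _ _ he).1 ha
  · intro hv ht
    obtain ⟨u, hu, huv, hm⟩ := F.exists_minimal_le S hv
    obtain ⟨w, hw, -⟩ := exists_isEdge_of_lt (hr u fun h => hrS (h ▸ hu))
    exact ht (w, u) (Finset.mem_filter.2 ⟨Finset.mem_univ _, hw, fun h => hm w h hw.1, hu⟩) huv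

/-- No vertex of `S` lies below the upper end of an entering edge. Hence the upper ends of two
different entering edges are incomparable, which gives admissibility, and the path to the root runs
outside `S`, which puts its colors in `p`. -/
theorem cutOf_mem {F : ColForest (Fin n) Unit V} {S : Set V} (hS : IsUpper p F S) :
    cutOf F S ∈ F.admissibleCuts p := by
  have hmem : ∀ a ∈ cutOf F S, F.IsEdge a.1 a.2 ∧ a.1 ∉ S ∧ a.2 ∈ S :=
    fun a ha => (Finset.mem_filter.1 ha).2
  have hup : ∀ u v, F.le u v → u ∈ S → v ∈ S := by
    rintro u v (rfl | ⟨e, he⟩) hu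
    exacts [hu, (hS e _ _ he).1 hu]
  have hlt : ∀ a ∈ cutOf F S, ∀ b ∈ cutOf F S, ¬ F.lt a.2 b.2 := fun a ha b hb hab =>
    (hmem b hb).2.1 (hup _ _ ((hmem b hb).1.le_of_lt hab) (hmem a ha).2.2)
  have hcomp : ∀ a ∈ cutOf F S, F.InComponent p a.2 := fun a ha e w hR =>
    (hS e w a.2 hR).2 (fun hw => (hmem a ha).2.1
      (hup _ _ ((hmem a ha).1.le_of_lt ⟨e, hR⟩) hw)) (hmem a ha).2.2
  refine Finset.mem_filter.2 ⟨Finset.mem_univ _, ⟨fun a ha => (hmem a ha).1, ?_⟩,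
    fun a ha => ⟨fun e w hR => ?_, hcomp a ha⟩⟩
  · intro m _ a ha b hb h1 h2
    have h : a.2 = b.2 := by
      rcases le_or_lt_of_le h1 h2 with (h | h) | h
      exacts [h, absurd h (hlt a ha b hb), absurd h (hlt b hb a ha)]
    exact Prod.ext ((hmem a ha).1.eq (h ▸ (hmem b hb).1)) h
  · exact hcomp a ha e w (R_of_le hR (Or.inr (hmem a ha).1.1))

/-- If a path goes from `w` in the trunk to `v` outside it, it passes the upper end of a cut edge.
Its first edge therefore lies below that end, inside the `p`-component. -/
theorem trunk_isUpper {F : ColForest (Fin n) Unit V} {c : Finset (V × V)}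
    (hc : c ∈ F.admissibleCuts p) : IsUpper p F (F.trunk c)ᶜ := by
  obtain ⟨⟨he, ha⟩, hp⟩ := (Finset.mem_filter.1 hc).2
  refine fun e w v hR => ⟨fun hw hv => hw (trunk_lower F c (Or.inr ⟨e, hR⟩) hv), fun hw hv => ?_⟩
  have hw : w ∈ F.trunk c := by simpa using hw
  have hv : ¬ ∀ a ∈ c, ¬ F.le a.2 v := hv
  push Not at hv
  obtain ⟨a, hac, hav⟩ := hv
  rcases le_or_lt_of_le hav (Or.inr ⟨e, hR⟩) with h | h
  · exact absurd h (hw a hac)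
  · exact (hp a hac).2 e w (R_of_lt_of_le h hav hR)

/-- Admissibility is used for one inclusion only: the lower end of a cut edge must stay in the
trunk, with no second cut edge below it. -/
theorem cutOf_trunk {F : ColForest (Fin n) Unit V} {c : Finset (V × V)}
    (hc : c ∈ F.admissibleCuts p) : cutOf F (F.trunk c)ᶜ = c := by
  obtain ⟨⟨he, ha⟩, hp⟩ := (Finset.mem_filter.1 hc).2
  ext ⟨w, v⟩
  simp only [cutOf, Finset.mem_filter, Finset.mem_univ, true_and, Set.mem_compl_iff, not_not]
  constructor
  · rintro ⟨hwv, hw, hv⟩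
    have hv : ¬ ∀ a ∈ c, ¬ F.le a.2 v := hv
    push Not at hv
    obtain ⟨a, hac, hav⟩ := hv
    rcases hav with rfl | hlt
    · rwa [show (w, a.2) = a from Prod.ext (hwv.eq (he a hac)) rfl]
    · exact absurd (hwv.le_of_lt hlt) (hw a hac)
  · intro hwv
    refine ⟨he _ hwv, fun b hb hle => ?_, fun h => h _ hwv (F.le_refl v)⟩
    -- Admissibility speaks of paths from leaves, so two cut edges on one path are compared through
    -- a leaf above both.
    obtain ⟨m, hm, hvm⟩ := F.exists_leaf_ge v
    have := ha m hm _ hwv b hb hvm (le_trans hle (le_trans (Or.inr (he _ hwv).1) hvm))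
    subst this
    exact not_lt_of_le hle (he _ hwv).1

theorem coprod_eq_cuts {F : ColForest (Fin n) Unit V} {r : V} (hr : F.IsRoot r) :
    coprod k p F = forestElt k F ⊗ₜ[k] 1 + ∑ c ∈ F.admissibleCuts p,
      subElt k F (F.trunk c)ᶜ ⊗ₜ[k] subElt k F (F.trunk c) := by
  rw [coprod_of_isRoot hr, ← Finset.sum_filter]
  congr 1
  symm
  refine Finset.sum_bij' (fun c _ => (F.trunk c)ᶜ) (fun S _ => cutOf F S) (fun c hc => ?_)
    (fun S hS => ?_) (fun c hc => cutOf_trunk hc) (fun S hS => ?_) fun c hc => ?_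
  · simp only [Finset.mem_filter, Finset.mem_univ, true_and, Set.mem_compl_iff, not_not]
    refine ⟨fun a ha => not_lt_of_le (hr.le a.1) ∘ fun h => ?_, trunk_isUpper hc⟩
    exact lt_of_lt_of_le ((Finset.mem_filter.1 hc).2.1.1 a ha).1 h
  · exact cutOf_mem (Finset.mem_filter.1 hS).2
  · simp only [Finset.mem_filter, Finset.mem_univ, true_and] at hS
    exact trunk_cutOf hr hS.2 hS.1
  · rw [compl_compl]

theorem coprodHom_X_eq_cutSum (t : ETree n) :
    coprodHom k p (MvPolynomial.X t) = MvPolynomial.X t ⊗ₜ[k] 1 + cutSum k p t := by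
  obtain ⟨r, hr⟩ := t.rep_isTree
  rw [coprodHom_X, coprod_eq_cuts hr, t.rep_isTree.forestElt_eq, t.toRTree_rep]
  simp only [cutSum, forestElt_sub]

/-! ## The operation `*` -/

/-- All parameters are `0` or `1`, so the coefficient is `1` if the exponents of all zero parameters
vanish, and `0` otherwise. The `q₂` factors force `S` to be closed upwards; the `q₁` factors force
the edges leaving the complement on paths into `S` to have colors in `p`. -/
theorem qCoeff_eq (hq₁ : q₁ = fun j => if j ∈ p then 1 else 0)
    (hq₂ : q₂ = fun _ => 0) (F : ColForest (Fin n) Unit V) (S : Finset V) :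
    qCoeff q₁ q₂ F S = if IsUpper p F (S : Set V) then 1 else 0 := by
  have h1 : ∀ j, q₁ j ^ ∑ v ∈ S, pathCount F S v j =
      if j ∉ p → ∀ v ∈ S, ∀ w, F.R j w v → w ∈ S then 1 else 0 := fun j => by
    rw [hq₁]
    by_cases hj : j ∈ p
    · simp [hj]
    · simp only [hj, if_false, not_false_eq_true, true_implies, zero_pow_eq, Finset.sum_eq_zero_iff,
        pathCount, Finset.card_eq_zero, Finset.filter_eq_empty_iff, Finset.mem_univ]
      congr 1
      simp only [not_and, eq_iff_iff]
      exact forall₃_congr fun v _ w => not_imp_not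
  have h2 : ∀ j, q₂ j ^ ∑ v ∈ Sᶜ, pathCount F Sᶜ v j =
      if ∀ v ∉ S, ∀ w, F.R j w v → w ∉ S then 1 else 0 := fun j => by
    simp only [hq₂, zero_pow_eq, Finset.sum_eq_zero_iff, pathCount, Finset.card_eq_zero,
      Finset.filter_eq_empty_iff, Finset.mem_univ, Finset.mem_compl, true_implies, not_not, not_and]
    congr 1
    simp only [eq_iff_iff]
    exact forall₃_congr fun v _ w => ⟨fun h hR hw => h hw hR, fun h hw hR => h hR hw⟩
  rw [qCoeff]
  simp only [h1, h2, Finset.prod_ite_zero, Finset.prod_const_one, Finset.mem_univ, true_implies,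
    ite_zero_mul_ite_zero, mul_one]
  congr 1
  simp only [eq_iff_iff, IsUpper, Finset.mem_coe]
  constructor
  · rintro ⟨ha, hb⟩ e w v hR
    refine ⟨fun hw => ?_, fun hw hv => ?_⟩
    · by_contra hv
      exact hb e v hv w hR hw
    · by_contra he
      exact hw (ha e he v hv w hR)
  · refine fun h => ⟨fun j hj v hv w hR => ?_, fun j v hv w hR hw => hv ((h j w v hR).1 hw)⟩
    by_contra hw
    exact hj ((h j w v hR).2 hw hv)

/-- The pairing of `f ⊗ g` with the coproduct of a forest. -/
theorem dualDistrib_coprod (f g : Module.Dual k (TreeAlg k n)) (F : ColForest (Fin n) Unit V) :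
    TensorProduct.dualDistrib k (TreeAlg k n) (TreeAlg k n) (f ⊗ₜ[k] g) (coprod k p F) =
      ∑ S : Set V, if IsUpper p F S then f (subElt k F S) * g (subElt k F Sᶜ) else 0 := by
  rw [coprod, map_sum]
  refine Finset.sum_congr rfl fun S _ => ?_
  rw [apply_ite (TensorProduct.dualDistrib k _ _ _), map_zero, TensorProduct.dualDistrib_apply]

theorem star_X (hq₁ : q₁ = fun j => if j ∈ p then 1 else 0) (hq₂ : q₂ = fun _ => 0)
    (f g : Module.Dual k (TreeAlg k n)) (t : ETree n) :
    star q₁ q₂ f g (MvPolynomial.X t) =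
      TensorProduct.dualDistrib k (TreeAlg k n) (TreeAlg k n) (f ⊗ₜ[k] g) (coprod k p t.rep) := by
  have hX : (MvPolynomial.X t : TreeAlg k n) =
      MvPolynomial.basisMonomials (ETree n) k (Finsupp.single t 1) := by
    rw [MvPolynomial.coe_basisMonomials]
    rfl
  have hex : ∃ t', (Finsupp.single t 1 : ETree n →₀ ℕ) = Finsupp.single t' 1 := ⟨t, rfl⟩
  have ht : hex.choose = t :=
    ((Finsupp.single_left_inj one_ne_zero).1 hex.choose_spec).symm
  rw [star, LinearMap.mk₂_apply, hX, Module.Basis.constr_basis, dif_pos hex, ht,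
    dualDistrib_coprod, starCoeff]
  refine Fintype.sum_bijective (fun S : Finset (Fin t.size) => (S : Set (Fin t.size)))
    Fintype.finsetEquivSet.bijective _ _ fun S => ?_
  rw [qCoeff_eq hq₁ hq₂, ite_mul, one_mul, zero_mul]
  simp only [forestElt_sub, Finset.coe_compl]

theorem star_monomial (f g : Module.Dual k (TreeAlg k n)) {m : ETree n →₀ ℕ}
    (hm : ∀ t, m ≠ Finsupp.single t 1) :
    star q₁ q₂ f g (MvPolynomial.monomial m 1) = 0 := by
  have hX : (MvPolynomial.monomial m 1 : TreeAlg k n) =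
      MvPolynomial.basisMonomials (ETree n) k m := by
    rw [MvPolynomial.coe_basisMonomials]
  rw [star, LinearMap.mk₂_apply, hX, Module.Basis.constr_basis, dif_neg (by simpa using hm)]

end CoproductHom

/-! ## Primitive elements -/

instance {E L V : Type} [Finite E] [Finite L] [Finite V] : Finite (ColForest E L V) :=
  Finite.of_injective (β := (E → V → V → Prop) × (V → L)) (fun F => (F.R, F.label)) fun F G h => by
    cases F
    cases G
    simp only [Prod.mk.injEq] at h
    obtain ⟨rfl, rfl⟩ := h
    rfl

/-- A class is recovered from its representative, one of finitely many structures on `Fin m` with `m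
< N`. This bounds the support of a functional in the graded dual. -/
theorem finite_size_lt {E L : Type} [Finite E] [Finite L] (N : ℕ) :
    {t : RTree E L | t.size < N}.Finite := by
  refine Set.Finite.of_injOn (f := fun t : RTree E L => (⟨t.size, t.rep⟩ : Σ m : ℕ,
    ColForest E L (Fin m))) (t := ⋃ m ∈ Set.Iio N, Set.range (Sigma.mk m)) ?_ ?_
    ((Set.finite_Iio N).biUnion fun m _ => Set.finite_range _)
  · intro t ht
    simp only [Set.mem_iUnion]
    exact ⟨t.size, ht, t.rep, rfl⟩
  · intro t _ s _ h
    rw [← t.toRTree_rep, ← s.toRTree_rep]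
    have key : ∀ (a b : Σ m : ℕ, ColForest E L (Fin m)) (ha : a.2.IsTree) (hb : b.2.IsTree),
        a = b → a.2.toRTree ha = b.2.toRTree hb := by
      rintro a b ha hb rfl
      rfl
    exact key _ _ t.rep_isTree s.rep_isTree h

section Primitives

variable {k : Type*} [Field k] {n : ℕ} {V : Type} [Fintype V] {p : Finset (Fin n)}
  {q₁ q₂ : Fin n → k} {f g : Module.Dual k (TreeAlg k n)}

theorem isTree_of_components_eq {E L : Type} {F : ColForest E L V} {t : RTree E L}
    (h : F.components = Finsupp.single t 1) : F.IsTree := by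
  have h' : F.components = t.rep.components := by
    rw [h, t.rep_isTree.components_eq, t.toRTree_rep]
  obtain ⟨φ⟩ := nonempty_iso_of_components_eq h'
  exact φ.symm.isTree t.rep_isTree

theorem apply_mul_of_mem_primitives (hf : f ∈ primitives k n) (x y : TreeAlg k n) :
    f (x * y) = f x * counit k n y + counit k n x * f y := by
  have h := LinearMap.congr_fun hf.2 (x ⊗ₜ y)
  simpa using h

theorem counit_monomial {m : ETree n →₀ ℕ} (hm : m ≠ 0) :
    counit k n (MvPolynomial.monomial m 1) = 0 := by
  simp [counit, MvPolynomial.coeff_monomial, hm]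

theorem apply_one_of_mem_primitives (hf : f ∈ primitives k n) : f 1 = 0 := by
  have h := apply_mul_of_mem_primitives hf 1 1
  have h1 : counit k n 1 = 1 := by simp [counit]
  rw [h1, mul_one, mul_one, one_mul] at h
  simpa using h

/-- A monomial that is neither `1` nor a tree is a product of two nontrivial monomials; the counit
kills both, so both terms of the primitivity formula vanish. -/
theorem apply_monomial_of_mem_primitives (hf : f ∈ primitives k n) {m : ETree n →₀ ℕ}
    (hm : ∀ t, m ≠ Finsupp.single t 1) : f (MvPolynomial.monomial m 1) = 0 := by
  by_cases h0 : m = 0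
  · subst h0
    exact apply_one_of_mem_primitives hf
  · obtain ⟨t, ht⟩ := Finsupp.support_nonempty_iff.2 h0
    have hle : Finsupp.single t 1 ≤ m := by
      rw [Finsupp.single_le_iff]
      exact Nat.one_le_iff_ne_zero.2 (Finsupp.mem_support_iff.1 ht)
    obtain ⟨m', rfl⟩ := exists_add_of_le hle
    have hm' : m' ≠ 0 := fun h => hm t (by rw [h, add_zero])
    have ht' : (Finsupp.single t 1 : ETree n →₀ ℕ) ≠ 0 := by simp
    have hmul : (MvPolynomial.monomial (Finsupp.single t 1 + m') 1 : TreeAlg k n) =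
        MvPolynomial.monomial (Finsupp.single t 1) 1 * MvPolynomial.monomial m' 1 := by
      rw [MvPolynomial.monomial_mul, one_mul]
    rw [hmul, apply_mul_of_mem_primitives hf, counit_monomial hm', counit_monomial ht', mul_zero,
      zero_mul, add_zero]

theorem apply_subElt_of_mem_primitives (hf : f ∈ primitives k n) {F : ColForest (Fin n) Unit V}
    {S : Set V} (hS : ¬ (F.sub S).IsTree) : f (subElt k F S) = 0 :=
  apply_monomial_of_mem_primitives hf fun _ h => hS (isTree_of_components_eq h)

theorem numVertices_single (t : ETree n) : numVertices (Finsupp.single t 1) = t.size := by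
  rw [numVertices, Finsupp.weight_single, one_smul]

/-- Two functionals are equal if they are on trees and vanish on other forests. -/
theorem dual_ext_trees (hf : ∀ m, (∀ t, m ≠ Finsupp.single t 1) →
    f (MvPolynomial.monomial m 1) = 0) (hg : ∀ m, (∀ t, m ≠ Finsupp.single t 1) →
    g (MvPolynomial.monomial m 1) = 0)
    (h : ∀ t, f (MvPolynomial.X t) = g (MvPolynomial.X t)) : f = g := by
  refine (MvPolynomial.basisMonomials (ETree n) k).ext fun m => ?_
  rw [MvPolynomial.coe_basisMonomials]
  by_cases hm : ∃ t, m = Finsupp.single t 1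
  · obtain ⟨t, rfl⟩ := hm
    exact h t
  · push Not at hm
    rw [hf m hm, hg m hm]

theorem dualTree_X (t s : ETree n) :
    dualTree k t (MvPolynomial.X s) = if s = t then 1 else 0 := by
  simp [dualTree, MvPolynomial.coeff_X, Finsupp.single_left_inj]

theorem dualTree_monomial (t : ETree n) {m : ETree n →₀ ℕ} (hm : ∀ t, m ≠ Finsupp.single t 1) :
    dualTree k t (MvPolynomial.monomial m 1) = 0 :=
  apply_monomial_of_mem_primitives (dualTree_mem_primitives k t) hm

theorem exists_eq_sum_dualTree (hf : f ∈ gradedDual k n)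
    (hf' : ∀ m, (∀ t, m ≠ Finsupp.single t 1) → f (MvPolynomial.monomial m 1) = 0) :
    ∃ T : Finset (ETree n), f = ∑ t ∈ T, f (MvPolynomial.X t) • dualTree k t := by
  obtain ⟨N, hN⟩ := hf
  refine ⟨(finite_size_lt N).toFinset, dual_ext_trees hf' (fun m hm => ?_) fun s => ?_⟩
  · rw [LinearMap.sum_apply]
    exact Finset.sum_eq_zero fun t _ => by rw [LinearMap.smul_apply, dualTree_monomial t hm, smul_zero]
  · simp only [LinearMap.sum_apply, LinearMap.smul_apply, dualTree_X, smul_eq_mul, mul_ite, mul_one,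
      mul_zero, Finset.sum_ite_eq, Set.Finite.mem_toFinset, Set.mem_ofPred_eq]
    split_ifs with h
    · rfl
    · exact hN (Finsupp.single s 1) (by rw [numVertices_single]; omega)

theorem mem_primitives_of_forall (hf : f ∈ gradedDual k n)
    (hf' : ∀ m, (∀ t, m ≠ Finsupp.single t 1) → f (MvPolynomial.monomial m 1) = 0) :
    f ∈ primitives k n := by
  obtain ⟨T, hT⟩ := exists_eq_sum_dualTree hf hf'
  rw [hT]
  exact Submodule.sum_mem _ fun t _ => Submodule.smul_mem _ _ (dualTree_mem_primitives k t)

theorem linearCombination_primTree_X (c : ETree n →₀ k) (t : ETree n) :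
    (Finsupp.linearCombination k (primTree k (n := n)) c).1 (MvPolynomial.X t) = c t := by
  have h : (primitives k n).subtype (Finsupp.linearCombination k (primTree k (n := n)) c) =
      Finsupp.linearCombination k (fun t => dualTree k t) c :=
    Finsupp.apply_linearCombination k _ _ _
  refine (LinearMap.congr_fun h _).trans ?_
  rw [Finsupp.linearCombination_apply, Finsupp.sum, LinearMap.sum_apply]
  simp +contextual [dualTree_X, eq_comm]

theorem linearIndependent_primTree : LinearIndependent k (primTree k (n := n)) := by
  intro a b h
  ext t
  rw [← linearCombination_primTree_X a t, ← linearCombination_primTree_X b t, h]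

theorem span_primTree : Submodule.span k (Set.range (primTree k (n := n))) = ⊤ := by
  refine Submodule.eq_top_iff'.2 fun f => ?_
  obtain ⟨T, hT⟩ := exists_eq_sum_dualTree f.2.1 fun m => apply_monomial_of_mem_primitives f.2
  have : f = ∑ t ∈ T, f.1 (MvPolynomial.X t) • primTree k t := by
    refine Subtype.ext (hT.trans ?_)
    simp [primTree]
  rw [this]
  exact Submodule.sum_mem _ fun t _ =>
    Submodule.smul_mem _ _ (Submodule.subset_span (Set.mem_range_self t))

theorem apply_subElt_of_le {N : ℕ}
    (hN : ∀ m : ETree n →₀ ℕ, N ≤ numVertices m → f (MvPolynomial.monomial m 1) = 0)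
    (F : ColForest (Fin n) Unit V) {S : Set V} (hS : N ≤ Nat.card S) : f (subElt k F S) = 0 :=
  hN _ (by rwa [numVertices_components, ← Nat.card_eq_fintype_card])

/-- The product vanishes on forests that are not trees, so only its degrees need a bound: in a tree
with at least `N + M` vertices, `S` has at least `N` or its complement at least `M`. -/
theorem star_mem_primitives (hq₁ : q₁ = fun j => if j ∈ p then 1 else 0) (hq₂ : q₂ = fun _ => 0)
    (hf : f ∈ gradedDual k n) (hg : g ∈ gradedDual k n) : star q₁ q₂ f g ∈ primitives k n := by
  refine mem_primitives_of_forall ?_ fun m => star_monomial f g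
  obtain ⟨N, hN⟩ := hf
  obtain ⟨M, hM⟩ := hg
  refine ⟨N + M, fun m hm => ?_⟩
  by_cases h : ∃ t, m = Finsupp.single t 1
  · obtain ⟨t, rfl⟩ := h
    refine (star_X hq₁ hq₂ f g t).trans ?_
    rw [dualDistrib_coprod]
    refine Finset.sum_eq_zero fun S _ => ite_eq_right_iff.2 fun _ => ?_
    rw [numVertices_single] at hm
    have hc : Nat.card S + Nat.card (Sᶜ : Set _) = t.size := by
      rw [Nat.card_coe_set_eq,
        Nat.card_coe_set_eq, Set.ncard_add_ncard_compl, Nat.card_fin]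
    rcases le_or_gt N (Nat.card S) with h | h
    · rw [apply_subElt_of_le hN _ h, zero_mul]
    · rw [apply_subElt_of_le hM _ (by omega), mul_zero]
  · push Not at h
    exact star_monomial f g h

/-! ## The pre-Lie identity -/

/-- The subsets of `S` that contribute to the coproduct of the subforest on `S`. -/
def IsUpperIn (p : Finset (Fin n)) {V : Type} (F : ColForest (Fin n) Unit V) (S T : Set V) : Prop :=
  T ⊆ S ∧ ∀ e w v, w ∈ S → v ∈ S → F.R e w v → (w ∈ T → v ∈ T) ∧ (w ∉ T → v ∈ T → e ∈ p)

/-- Evaluates `*` on a subforest in terms of subsets of the ambient vertex set, so that iterated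
products become sums over subsets of one fixed forest. -/
theorem star_subElt (hq₁ : q₁ = fun j => if j ∈ p then 1 else 0) (hq₂ : q₂ = fun _ => 0)
    (f g : Module.Dual k (TreeAlg k n)) (F : ColForest (Fin n) Unit V) (S : Set V) :
    star q₁ q₂ f g (subElt k F S) = if (F.sub S).IsTree then
      ∑ T : Set V, if IsUpperIn p F S T then f (subElt k F T) * g (subElt k F (S \ T)) else 0
      else 0 := by
  split_ifs with hS
  · obtain ⟨φ⟩ := nonempty_iso_rep hS
    rw [subElt, hS.forestElt_eq, star_X hq₁ hq₂, ← φ.coprod_eq, dualDistrib_coprod,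
      ← Finset.sum_filter, ← Finset.sum_filter]
    refine Finset.sum_nbij' (fun T => Subtype.val '' T) (fun T => Subtype.val ⁻¹' T) (fun T hT => ?_)
      (fun T hT => ?_) (fun T _ => Set.preimage_image_eq _ Subtype.val_injective) (fun T hT => ?_)
      fun T _ => ?_
    · have hT := (Finset.mem_filter.1 hT).2
      refine Finset.mem_filter.2 ⟨Finset.mem_univ _, by simp, fun e w v hw hv hR => ?_⟩
      simpa [hw, hv] using hT e ⟨w, hw⟩ ⟨v, hv⟩ hR
    · have hT := (Finset.mem_filter.1 hT).2
      exact Finset.mem_filter.2 ⟨Finset.mem_univ _, fun e w v hR => hT.2 e w v w.2 v.2 hR⟩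
    · rw [Subtype.image_preimage_coe]
      exact Set.inter_eq_right.2 (Finset.mem_filter.1 hT).2.1
    · rw [subElt_sub, subElt_sub]
      congr 3
      ext v
      simp only [Set.mem_image, Set.mem_compl_iff, Subtype.exists, Set.mem_sdiff]
      constructor
      · rintro ⟨w, hw, hT, rfl⟩
        refine ⟨hw, ?_⟩
        rintro ⟨w', hw', hT', rfl⟩
        exact hT hT'
      · rintro ⟨hv, hT⟩
        exact ⟨v, hv, fun h => hT ⟨v, hv, h, rfl⟩, rfl⟩
  · exact star_monomial f g fun _ h => hS (isTree_of_components_eq h)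

/-- The pairs of disjoint sets that contribute to the iterated coproduct of a forest. -/
def IsUpperPair (p : Finset (Fin n)) {V : Type} (F : ColForest (Fin n) Unit V) (S T : Set V) :
    Prop :=
  IsUpperIn p F Set.univ S ∧ IsUpperIn p F Sᶜ T

/-- Coassociativity at the level of vertex sets: a chain in which `S` is removed before `T` can also
be obtained by removing `S ∪ T` and then splitting it. -/
theorem isUpperPair_iff {V : Type} {F : ColForest (Fin n) Unit V} {S T : Set V} :
    IsUpperPair p F S T ↔ T ⊆ Sᶜ ∧ IsUpperIn p F Set.univ (S ∪ T) ∧ IsUpperIn p F (S ∪ T) S := by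
  simp only [IsUpperPair, IsUpperIn, Set.subset_univ, true_and, Set.mem_univ, true_implies,
    Set.mem_compl_iff, Set.mem_union, Set.subset_union_left]
  constructor
  · rintro ⟨h1, h2, h3⟩
    refine ⟨h2, fun e w v hR => ?_, fun e w v _ _ hR => h1 e w v hR⟩
    have := h1 e w v hR
    have := h3 e w v
    tauto
  · rintro ⟨h2, h1, h3⟩
    have hd : ∀ v, v ∈ T → v ∉ S := fun v hv => h2 hv
    refine ⟨fun e w v hR => ?_, h2, fun e w v hw hv hR => ?_⟩
    · have := h1 e w v hR
      have := h3 e w v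
      have := hd w
      have := hd v
      tauto
    · have := h1 e w v hR
      tauto

/-- If two disjoint subtrees do not form a tree together, their order is irrelevant. -/
theorem IsUpperPair.symm {V : Type} {F : ColForest (Fin n) Unit V} {S T : Set V}
    (h : IsUpperPair p F S T) (hS : (F.sub S).IsTree) (hT : (F.sub T).IsTree)
    (hST : ¬ (F.sub (S ∪ T)).IsTree) : IsUpperPair p F T S := by
  obtain ⟨⟨-, h1⟩, hd, h2⟩ := h
  -- Otherwise the root `s` of `T` lies below `v`, so it is comparable with the root `r` of `S`.
  -- Here `r < s` would put `s` into `S`, and `s ≤ r` would make `s` a root of `S ∪ T`.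
  have hno : ∀ w v, F.lt w v → w ∈ T → v ∉ S := by
    intro w v hwv hw hv
    obtain ⟨⟨r, hrS⟩, hr⟩ := hS
    obtain ⟨⟨s, hsT⟩, hs⟩ := hT
    have hrle : ∀ u ∈ S, F.le r u := fun u hu => by
      by_cases hur : u = r
      · exact Or.inl hur.symm
      · exact Or.inr (hr ⟨u, hu⟩ fun h => hur (congrArg Subtype.val h))
    have hsle : ∀ u ∈ T, F.le s u := fun u hu => by
      by_cases hus : u = s
      · exact Or.inl hus.symm
      · exact Or.inr (hs ⟨u, hu⟩ fun h => hus (congrArg Subtype.val h))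
    have hsv : F.lt s v := lt_of_le_of_lt (hsle w hw) hwv
    have hsr : F.le s r := by
      rcases le_or_lt_of_le (Or.inr hsv) (hrle v hv) with h | ⟨e, he⟩
      · exact h
      · exact absurd ((h1 e r s trivial trivial he).1 hrS) (hd hsT)
    refine hST ⟨⟨s, Or.inr hsT⟩, fun u hu => ?_⟩
    have hle : F.le s u := u.2.elim (fun h => le_trans hsr (hrle _ h)) (hsle _)
    exact hle.resolve_left fun h => hu (Subtype.ext h.symm)
  refine ⟨⟨Set.subset_univ _, fun e w v _ _ hR => ⟨fun hw => ?_, fun hw hv => ?_⟩⟩,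
    fun v hv hvT => hd hvT hv, fun e w v hw hv hR => h1 e w v trivial trivial hR⟩
  · exact (h2 e w v (hd hw) (hno w v ⟨e, hR⟩ hw) hR).1 hw
  · have hwS : w ∉ S := fun h => hd hv ((h1 e w v trivial trivial hR).1 h)
    exact (h2 e w v hwS (hd hv) hR).2 hw hv

theorem isTree_sub_of_isUpperIn {V : Type} {F : ColForest (Fin n) Unit V} (hF : F.IsTree) {S : Set V}
    (hS : IsUpperIn p F Set.univ S) {v : V} (hv : v ∉ S) : (F.sub Sᶜ).IsTree := by
  obtain ⟨r, hr⟩ := hF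
  have hrS : r ∉ S := fun h => hv <| by
    by_cases hvr : v = r
    · exact hvr ▸ h
    · obtain ⟨e, he⟩ := hr v hvr
      exact (hS.2 e r v trivial trivial he).1 h
  exact ⟨⟨r, hrS⟩, fun u hu => hr u.1 fun h => hu (Subtype.ext h)⟩

variable {x y z : Module.Dual k (TreeAlg k n)}

/-- The inner product is evaluated on the complement of `S`, which contains the root of `F` and is a
tree unless it is empty. In the empty case `T` is empty too, and `y` vanishes on `1`. -/
theorem star_star_right (hq₁ : q₁ = fun j => if j ∈ p then 1 else 0) (hq₂ : q₂ = fun _ => 0)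
    (hy : y ∈ primitives k n) {F : ColForest (Fin n) Unit V} (hF : F.IsTree) :
    star q₁ q₂ z (star q₁ q₂ y x) (subElt k F Set.univ) =
      ∑ S : Set V, ∑ T : Set V, if IsUpperPair p F S T then
        z (subElt k F S) * y (subElt k F T) * x (subElt k F (S ∪ T)ᶜ) else 0 := by
  rw [star_subElt hq₁ hq₂, if_pos ((Iso.subUniv F Set.mem_univ).symm.isTree hF)]
  refine Finset.sum_congr rfl fun S _ => ?_
  split_ifs with hS
  · rw [← Set.compl_eq_univ_sdiff, star_subElt hq₁ hq₂]
    split_ifs with hT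
    · rw [Finset.mul_sum]
      refine Finset.sum_congr rfl fun T _ => ?_
      rw [mul_ite, mul_zero, ← mul_assoc, Set.compl_union, Set.sdiff_eq]
      simp only [IsUpperPair, hS, true_and]
    · rw [mul_zero]
      refine (Finset.sum_eq_zero fun T _ => ite_eq_right_iff.2 fun h => ?_).symm
      have hT' : T = ∅ := Set.eq_empty_of_forall_notMem fun v hv =>
        hT (isTree_sub_of_isUpperIn hF hS (h.2.1 hv))
      rw [hT', subElt_empty, apply_one_of_mem_primitives hy, mul_zero, zero_mul]
  · exact (Finset.sum_eq_zero fun T _ => if_neg fun h => hS h.1).symm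

/-- Here the inner product is evaluated on `U = S ∪ T`, and the truncation of `*` to trees leaves
the condition that `U` is a tree. -/
theorem star_star_left (hq₁ : q₁ = fun j => if j ∈ p then 1 else 0) (hq₂ : q₂ = fun _ => 0)
    {F : ColForest (Fin n) Unit V} (hF : F.IsTree) :
    star q₁ q₂ (star q₁ q₂ z y) x (subElt k F Set.univ) =
      ∑ S : Set V, ∑ T : Set V, if IsUpperPair p F S T ∧ (F.sub (S ∪ T)).IsTree then
        z (subElt k F S) * y (subElt k F T) * x (subElt k F (S ∪ T)ᶜ) else 0 := by
  rw [star_subElt hq₁ hq₂, if_pos ((Iso.subUniv F Set.mem_univ).symm.isTree hF)]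
  have h1 : ∀ U : Set V, (if IsUpperIn p F Set.univ U then
      star q₁ q₂ z y (subElt k F U) * x (subElt k F (Set.univ \ U)) else 0) =
      ∑ S : Set V, if IsUpperIn p F Set.univ U ∧ (F.sub U).IsTree ∧ IsUpperIn p F U S then
        z (subElt k F S) * y (subElt k F (U \ S)) * x (subElt k F Uᶜ) else 0 := fun U => by
    rw [← Set.compl_eq_univ_sdiff, star_subElt hq₁ hq₂]
    split_ifs with hU hT
    · rw [Finset.sum_mul]
      refine Finset.sum_congr rfl fun S _ => ?_
      simp only [hU, hT, true_and, ite_mul, zero_mul]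
    · simp [hT]
    · simp [hU]
  simp only [h1]
  rw [Finset.sum_comm]
  refine Finset.sum_congr rfl fun S _ => ?_
  rw [← Finset.sum_filter, ← Finset.sum_filter]
  refine Finset.sum_nbij' (fun U => U \ S) (fun T => S ∪ T) (fun U hU => ?_) (fun T hT => ?_)
    (fun U hU => ?_) (fun T hT => ?_) fun U hU => ?_
  · simp only [Finset.mem_filter, Finset.mem_univ, true_and] at hU ⊢
    rw [isUpperPair_iff, Set.union_sdiff_cancel hU.2.2.1]
    exact ⟨⟨fun v hv => hv.2, hU.1, hU.2.2⟩, hU.2.1⟩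
  · simp only [Finset.mem_filter, Finset.mem_univ, true_and] at hT ⊢
    rw [isUpperPair_iff] at hT
    exact ⟨hT.1.2.1, hT.2, hT.1.2.2⟩
  · simp only [Finset.mem_filter, Finset.mem_univ, true_and] at hU
    exact Set.union_sdiff_cancel hU.2.2.1
  · simp only [Finset.mem_filter, Finset.mem_univ, true_and] at hT
    rw [Set.union_sdiff_left]
    exact sdiff_eq_left.2 (Set.disjoint_left.2 fun v hv => hT.1.2.1 hv)
  · simp only [Finset.mem_filter, Finset.mem_univ, true_and] at hU
    rw [Set.union_sdiff_cancel hU.2.2.1]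

theorem star_associator (hq₁ : q₁ = fun j => if j ∈ p then 1 else 0) (hq₂ : q₂ = fun _ => 0)
    (hy : y ∈ primitives k n) {F : ColForest (Fin n) Unit V} (hF : F.IsTree) :
    star q₁ q₂ z (star q₁ q₂ y x) (subElt k F Set.univ) -
      star q₁ q₂ (star q₁ q₂ z y) x (subElt k F Set.univ) =
      ∑ S : Set V, ∑ T : Set V, if IsUpperPair p F S T ∧ ¬ (F.sub (S ∪ T)).IsTree then
        z (subElt k F S) * y (subElt k F T) * x (subElt k F (S ∪ T)ᶜ) else 0 := by
  rw [star_star_right hq₁ hq₂ hy hF, star_star_left hq₁ hq₂ hF, ← Finset.sum_sub_distrib]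
  refine Finset.sum_congr rfl fun S _ => ?_
  rw [← Finset.sum_sub_distrib]
  refine Finset.sum_congr rfl fun T _ => ?_
  by_cases h1 : IsUpperPair p F S T <;> by_cases h2 : (F.sub (S ∪ T)).IsTree <;> simp [h1, h2]

/-- As `y` and `z` are primitive, only terms in which `S` and `T` are trees contribute; their union
is not a tree, so by `IsUpperPair.symm` the two sets may be exchanged. -/
theorem star_associator_symm (hq₁ : q₁ = fun j => if j ∈ p then 1 else 0) (hq₂ : q₂ = fun _ => 0)
    (hy : y ∈ primitives k n) (hz : z ∈ primitives k n) {F : ColForest (Fin n) Unit V}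
    (hF : F.IsTree) :
    star q₁ q₂ z (star q₁ q₂ y x) (subElt k F Set.univ) -
      star q₁ q₂ (star q₁ q₂ z y) x (subElt k F Set.univ) =
    star q₁ q₂ y (star q₁ q₂ z x) (subElt k F Set.univ) -
      star q₁ q₂ (star q₁ q₂ y z) x (subElt k F Set.univ) := by
  rw [star_associator hq₁ hq₂ hy hF, star_associator hq₁ hq₂ hz hF, Finset.sum_comm]
  refine Finset.sum_congr rfl fun S _ => Finset.sum_congr rfl fun T _ => ?_
  rw [Set.union_comm T S]
  by_cases hST : (F.sub (S ∪ T)).IsTree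
  · simp [hST]
  by_cases hS : (F.sub S).IsTree
  · by_cases hT : (F.sub T).IsTree
    · have : IsUpperPair p F T S ↔ IsUpperPair p F S T :=
        ⟨fun h => h.symm hT hS (by rwa [Set.union_comm]), fun h => h.symm hS hT hST⟩
      rw [this, mul_comm (z _)]
    · simp [apply_subElt_of_mem_primitives hz hT]
  · simp [apply_subElt_of_mem_primitives hy hS]

/-- The product on the primitive elements. -/
def primMul (hq₁ : q₁ = fun j => if j ∈ p then 1 else 0) (hq₂ : q₂ = fun _ => 0) :
    primitives k n →ₗ[k] primitives k n →ₗ[k] primitives k n :=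
  LinearMap.mk₂ k
    (fun f g => ⟨star q₁ q₂ f g, star_mem_primitives hq₁ hq₂ f.2.1 g.2.1⟩)
    (fun f f' g => Subtype.ext (by simp))
    (fun c f g => Subtype.ext (by simp))
    (fun f g g' => Subtype.ext (by simp))
    (fun c f g => Subtype.ext (by simp))

theorem primMul_apply (hq₁ : q₁ = fun j => if j ∈ p then 1 else 0) (hq₂ : q₂ = fun _ => 0)
    (f g : primitives k n) : (primMul hq₁ hq₂ f g : Module.Dual k (TreeAlg k n)) =
      star q₁ q₂ (f : Module.Dual k (TreeAlg k n)) g := rfl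

theorem primMul_flip_isRightPreLie (hq₁ : q₁ = fun j => if j ∈ p then 1 else 0)
    (hq₂ : q₂ = fun _ => 0) : IsRightPreLie (k := k) (A := primitives k n)
      (primMul hq₁ hq₂).flip := by
  intro x y z
  refine Subtype.ext (dual_ext_trees (fun m => apply_monomial_of_mem_primitives (Subtype.prop _))
    (fun m => apply_monomial_of_mem_primitives (Subtype.prop _)) fun t => ?_)
  have h := star_associator_symm (x := x.1) hq₁ hq₂ y.2 z.2 t.rep_isTree
  rwa [subElt_univ, t.rep_isTree.forestElt_eq, t.toRTree_rep] at h

end Primitives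

/-! ## Grafting -/

namespace ColForest

variable {E L U V W V' W' : Type}

/-- Grafts of isomorphic trees are isomorphic. -/
def Iso.graft {G : ColForest E L W} {G' : ColForest E L W'} {F : ColForest E L V}
    {F' : ColForest E L V'} (g : G.Iso G') (f : F.Iso F') (v : V) (e : E) :
    (G.graft F v e).Iso (G'.graft F' (f.toEquiv v) e) where
  toEquiv := Equiv.sumCongr f.toEquiv g.toEquiv
  map_R c x y := by
    cases x <;> cases y
    · exact f.map_R _ _ _
    · exact or_congr (and_congr (by simp) Iff.rfl) (f.map_R _ _ _)
    · exact Iff.rfl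
    · exact g.map_R _ _ _
  map_label x := by
    cases x
    exacts [f.map_label _, g.map_label _]

/-- Grafting onto a vertex of the upper tree of a graft. -/
def graftGraftInr (H : ColForest E L U) (G : ColForest E L W) (F : ColForest E L V) (v : V) (w : W)
    (e e' : E) :
    (H.graft (G.graft F v e) (Sum.inr w) e').Iso ((H.graft G w e').graft F v e) where
  toEquiv := Equiv.sumAssoc V W U
  map_R c x y := by
    rcases x with (x | x) | x <;> rcases y with (y | y) | y <;> simp [ColForest.graft]
  map_label x := by
    rcases x with (x | x) | x <;> rfl

/-- Two trees grafted onto the same tree. -/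
def graftGraftInl (H : ColForest E L U) (G : ColForest E L W) (F : ColForest E L V) (v u : V)
    (e e' : E) :
    (H.graft (G.graft F v e) (Sum.inl u) e').Iso
      (G.graft (H.graft F u e') (Sum.inl v) e) where
  toEquiv := (Equiv.sumAssoc V W U).trans
    ((Equiv.sumCongr (Equiv.refl V) (Equiv.sumComm W U)).trans (Equiv.sumAssoc V U W).symm)
  map_R c x y := by
    rcases x with (x | x) | x <;> rcases y with (y | y) | y <;> simp [ColForest.graft]
  map_label x := by
    rcases x with (x | x) | x <;> rfl

end ColForest

/-! ### The grafting product of vertex-colored trees is pre-Lie. -/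

section GraftProduct

variable {k : Type*} [Field k] {n : ℕ} {U V W : Type} [Fintype U] [Fintype V] [Fintype W]

/-- The basis element of a vertex-colored tree. -/
def treeElt (k : Type*) [Field k] (F : ColForest Unit (Fin n) V) (hF : F.IsTree) : FreePreLie k n :=
  Finsupp.single (F.toRTree hF) 1

theorem treeElt_eq {F : ColForest Unit (Fin n) V} {G : ColForest Unit (Fin n) W} (f : F.Iso G)
    (hF : F.IsTree) (hG : G.IsTree) : treeElt k F hF = treeElt k G hG := by
  rw [treeElt, treeElt, f.toRTree_eq hF hG]

theorem single_eq_treeElt (t : VTree n) :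
    Finsupp.single t (1 : k) = treeElt k t.rep t.rep_isTree := by
  rw [treeElt, t.toRTree_rep]

/-- Computes the product from arbitrary models of the two trees, so that grafts can be grafted again
without passing to the chosen representatives. -/
theorem graftProduct_treeElt {F : ColForest Unit (Fin n) V} {G : ColForest Unit (Fin n) W}
    (hF : F.IsTree) (hG : G.IsTree) :
    graftProduct k n (treeElt k F hF) (treeElt k G hG) =
      ∑ v : V, treeElt k (G.graft F v ()) (graft_isTree hF v ()) := by
  obtain ⟨f⟩ := nonempty_iso_rep hF
  obtain ⟨g⟩ := nonempty_iso_rep hG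
  rw [graftProduct, treeElt, treeElt, Finsupp.linearCombination_single, one_smul,
    Finsupp.linearCombination_single, one_smul]
  refine (Fintype.sum_equiv f.toEquiv _ _ fun v => ?_).symm
  exact treeElt_eq (g.graft f v ()) _ (graft_isTree (RTree.rep_isTree _) _ _)

/-- Grafting `H` onto a vertex of the copy of `G` in a graft cancels against grafting `H` onto `G`
first. What remains are the graftings of both onto vertices of `F`, visibly symmetric in `G` and
`H`. -/
theorem graftProduct_associator {F : ColForest Unit (Fin n) V} {G : ColForest Unit (Fin n) W}
    {H : ColForest Unit (Fin n) U} (hF : F.IsTree) (hG : G.IsTree) (hH : H.IsTree) :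
    graftProduct k n (graftProduct k n (treeElt k F hF) (treeElt k G hG)) (treeElt k H hH) -
      graftProduct k n (treeElt k F hF) (graftProduct k n (treeElt k G hG) (treeElt k H hH)) =
      ∑ v : V, ∑ u : V, treeElt k (H.graft (G.graft F v ()) (Sum.inl u) ())
        (graft_isTree (graft_isTree hF v ()) _ ()) := by
  rw [graftProduct_treeElt hF hG, graftProduct_treeElt hG hH, map_sum, map_sum,
    LinearMap.sum_apply]
  simp only [graftProduct_treeElt, Fintype.sum_sum_type, Finset.sum_add_distrib]
  rw [sub_eq_iff_eq_add, add_right_inj, Finset.sum_comm]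
  refine Finset.sum_congr rfl fun w _ => Finset.sum_congr rfl fun v _ => ?_
  exact treeElt_eq (graftGraftInr H G F v w () ()) _ _

theorem graftProduct_isRightPreLie : IsRightPreLie (graftProduct k n) := by
  intro x y z
  induction x using Finsupp.induction_linear with
  | zero => simp
  | add x x' h h' =>
    simp only [map_add, LinearMap.add_apply] at h h' ⊢
    rw [add_sub_add_comm, h, h', add_sub_add_comm]
  | single t a =>
  induction y using Finsupp.induction_linear with
  | zero => simp
  | add x x' h h' =>
    simp only [map_add, LinearMap.add_apply] at h h' ⊢
    rw [add_sub_add_comm, h, h', add_sub_add_comm]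
  | single s b =>
  induction z using Finsupp.induction_linear with
  | zero => simp
  | add x x' h h' =>
    simp only [map_add, LinearMap.add_apply] at h h' ⊢
    rw [add_sub_add_comm, h, h', add_sub_add_comm]
  | single r c =>
  -- The scalars are pulled out, so that only basis trees remain.
  rw [← mul_one a, ← mul_one b, ← mul_one c, ← smul_eq_mul, ← smul_eq_mul, ← smul_eq_mul,
    ← Finsupp.smul_single, ← Finsupp.smul_single, ← Finsupp.smul_single]
  simp only [map_smul, LinearMap.smul_apply, ← smul_sub, single_eq_treeElt,
    graftProduct_associator]
  rw [smul_comm b c, Finset.sum_comm]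
  congr 3
  refine Finset.sum_congr rfl fun v _ => Finset.sum_congr rfl fun u _ => ?_
  exact treeElt_eq (graftGraftInl _ _ _ _ _ _ _) _ _

end GraftProduct

/-! ## Edge colors and vertex colors -/

namespace ColForest

variable {V W A B : Type} {n : ℕ}

theorem colorVertices_lt (F : ColForest (Fin n) Unit V) (i : Fin n) (w v : V) :
    (F.colorVertices i).lt w v ↔ F.lt w v :=
  ⟨fun ⟨_, h⟩ => h, fun h => ⟨(), h⟩⟩

theorem colorVertices_le (F : ColForest (Fin n) Unit V) (i : Fin n) (w v : V) :
    (F.colorVertices i).le w v ↔ F.le w v :=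
  or_congr Iff.rfl (F.colorVertices_lt i w v)

theorem colorVertices_isEdge (F : ColForest (Fin n) Unit V) (i : Fin n) (w v : V) :
    (F.colorVertices i).IsEdge w v ↔ F.IsEdge w v := by
  simp only [IsEdge, colorVertices_lt]

theorem colorVertices_isRoot (F : ColForest (Fin n) Unit V) (i : Fin n) (r : V) :
    (F.colorVertices i).IsRoot r ↔ F.IsRoot r := by
  simp only [IsRoot, colorVertices_lt]

theorem colorVertices_isTree {F : ColForest (Fin n) Unit V} (hF : F.IsTree) (i : Fin n) :
    (F.colorVertices i).IsTree :=
  let ⟨r, hr⟩ := hF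
  ⟨r, (F.colorVertices_isRoot i r).2 hr⟩

theorem colorVertices_label {F : ColForest (Fin n) Unit V} (i : Fin n) {e : Fin n} {w v : V}
    (h : F.IsEdge w v) (hR : F.R e w v) : (F.colorVertices i).label v = e := by
  have hex : ∃ e w, F.IsEdge w v ∧ F.R e w v := ⟨e, w, h, hR⟩
  show (if h : ∃ e w, F.IsEdge w v ∧ F.R e w v then h.choose else i) = e
  rw [dif_pos hex]
  obtain ⟨w', h', hR'⟩ := hex.choose_spec
  rw [h'.eq h] at hR'
  exact F.color_unique _ _ _ _ hR' hR

theorem colorVertices_label_of_isMinimal {F : ColForest (Fin n) Unit V} (i : Fin n) {v : V}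
    (h : F.IsMinimal v) : (F.colorVertices i).label v = i :=
  dif_neg fun ⟨_, w, hw, _⟩ => h w hw.1

theorem exists_isEdge_of_not_isMinimal [Finite V] {E L : Type} {F : ColForest E L V} {v : V}
    (h : ¬ F.IsMinimal v) : ∃ e w, F.IsEdge w v ∧ F.R e w v := by
  unfold IsMinimal at h
  push Not at h
  obtain ⟨w, hw⟩ := h
  obtain ⟨u, hu, -⟩ := exists_isEdge_of_lt hw
  obtain ⟨e, he⟩ := id hu.1
  exact ⟨e, u, hu, he⟩

/-- Isomorphic edge-colored forests give isomorphic vertex-colored forests. -/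
def Iso.colorVertices [Finite V] {F : ColForest (Fin n) Unit V} {G : ColForest (Fin n) Unit W}
    (f : F.Iso G) (i : Fin n) : (F.colorVertices i).Iso (G.colorVertices i) where
  toEquiv := f.toEquiv
  map_R _ w v := f.lt_iff w v
  map_label v := by
    by_cases h : F.IsMinimal v
    · rw [colorVertices_label_of_isMinimal i h,
        colorVertices_label_of_isMinimal i ((f.isMinimal_iff v).1 h)]
    · obtain ⟨e, w, hw, hR⟩ := exists_isEdge_of_not_isMinimal h
      rw [colorVertices_label i hw hR,
        colorVertices_label i ((f.isEdge_iff _ _).1 hw) ((f.map_R _ _ _).1 hR)]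

theorem IsEdge.eq_of_le {E L : Type} {F : ColForest E L V} {w x x' v : V} (h : F.IsEdge w x)
    (h' : F.IsEdge w x') (hx : F.le x v) (hx' : F.le x' v) : x = x' := by
  rcases le_or_lt_of_le hx hx' with (h1 | h1) | h1
  · exact h1
  · exact absurd ⟨h.1, h1⟩ (h'.2 x)
  · exact absurd ⟨h'.1, h1⟩ (h.2 x')

/-- The edge-colored forest in which each edge has the color of its upper vertex. -/
def colorEdges [Finite V] (T : ColForest Unit (Fin n) V) : ColForest (Fin n) Unit V where
  -- Here `x` is the vertex that follows `w` on the path to `v`, the upper end of the first edge.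
  R e w v := ∃ x, T.IsEdge w x ∧ T.le x v ∧ T.label x = e
  irrefl e v := fun ⟨x, h, h', _⟩ => not_lt_of_le h' h.1
  color_unique e e' w v := by
    rintro ⟨x, h, hx, rfl⟩ ⟨x', h', hx', rfl⟩
    rw [h.eq_of_le h' hx hx']
  trans e e' w x v := by
    rintro ⟨y, h, hy, rfl⟩ ⟨z, h', hz, -⟩
    exact ⟨y, h, le_trans hy (Or.inr (lt_of_lt_of_le h'.1 hz)), rfl⟩
  down_linear e e' x y z hyz := by
    rintro ⟨y', h, hy, -⟩ ⟨z', h', hz, -⟩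
    have key : ∀ {y z}, T.lt y z → ∃ d, ∃ x, T.IsEdge y x ∧ T.le x z ∧ T.label x = d := by
      intro y z hyz
      obtain ⟨u, hu, huz⟩ := exists_isEdge_of_lt' hyz
      exact ⟨_, u, hu, huz, rfl⟩
    rcases le_or_lt_of_le (Or.inr (lt_of_lt_of_le h.1 hy)) (Or.inr (lt_of_lt_of_le h'.1 hz)) with
      (h1 | h1) | h1
    exacts [absurd h1 hyz, Or.inl (key h1), Or.inr (key h1)]
  label _ := ()

theorem colorEdges_lt [Finite V] (T : ColForest Unit (Fin n) V) (w v : V) :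
    T.colorEdges.lt w v ↔ T.lt w v := by
  constructor
  · rintro ⟨e, x, h, hx, -⟩
    exact lt_of_lt_of_le h.1 hx
  · intro h
    obtain ⟨u, hu, huv⟩ := exists_isEdge_of_lt' h
    exact ⟨_, u, hu, huv, rfl⟩

theorem colorEdges_isRoot [Finite V] (T : ColForest Unit (Fin n) V) (r : V) :
    T.colorEdges.IsRoot r ↔ T.IsRoot r := by
  simp only [IsRoot, colorEdges_lt]

theorem colorEdges_isEdge [Finite V] (T : ColForest Unit (Fin n) V) (w v : V) :
    T.colorEdges.IsEdge w v ↔ T.IsEdge w v := by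
  simp only [IsEdge, colorEdges_lt]

theorem colorEdges_isTree [Finite V] {T : ColForest Unit (Fin n) V} (hT : T.IsTree) :
    T.colorEdges.IsTree :=
  let ⟨r, hr⟩ := hT
  ⟨r, (T.colorEdges_isRoot r).2 hr⟩

/-- Isomorphic vertex-colored forests give isomorphic edge-colored forests. -/
def Iso.colorEdges [Finite V] [Finite W] {T : ColForest Unit (Fin n) V}
    {T' : ColForest Unit (Fin n) W} (f : T.Iso T') : T.colorEdges.Iso T'.colorEdges where
  toEquiv := f.toEquiv
  map_R e w v := by
    show (∃ x, T.IsEdge w x ∧ T.le x v ∧ T.label x = e) ↔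
      ∃ x, T'.IsEdge (f.toEquiv w) x ∧ T'.le x (f.toEquiv v) ∧ T'.label x = e
    rw [← f.toEquiv.exists_congr_right]
    simp only [f.isEdge_iff, f.le_iff, f.map_label]
  map_label _ := rfl

/-- An edge-colored forest is recovered from the colors of the vertices. -/
def colorEdgesColorVertices [Finite V] (F : ColForest (Fin n) Unit V) (i : Fin n) :
    (F.colorVertices i).colorEdges.Iso F where
  toEquiv := Equiv.refl V
  map_R e w v := by
    show (∃ x, (F.colorVertices i).IsEdge w x ∧ (F.colorVertices i).le x v ∧
      (F.colorVertices i).label x = e) ↔ F.R e w v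
    simp only [colorVertices_isEdge, colorVertices_le]
    constructor
    · rintro ⟨x, h, hx, rfl⟩
      obtain ⟨e, he⟩ := id h.1
      rw [colorVertices_label i h he]
      exact R_of_le he hx
    · intro h
      obtain ⟨u, hu, huv⟩ := exists_isEdge_of_lt' ⟨e, h⟩
      exact ⟨u, hu, huv, colorVertices_label i hu (R_of_lt_of_le hu.1 huv h)⟩
  map_label _ := rfl

/-- Recoloring the root through the colors of the edges. -/
def colorVerticesColorEdges [Finite V] {T : ColForest Unit (Fin n) V} (hT : T.IsTree) (i : Fin n) :
    (T.colorEdges.colorVertices i).Iso (T.recolorRoot i) where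
  toEquiv := Equiv.refl V
  map_R _ w v := (T.colorEdges_lt w v).trans ⟨fun ⟨_, h⟩ => h, fun h => ⟨(), h⟩⟩
  map_label v := by
    obtain ⟨r, hr⟩ := hT
    show (T.colorEdges.colorVertices i).label v = if T.IsRoot v then i else T.label v
    split_ifs with hv
    · exact colorVertices_label_of_isMinimal i ((T.colorEdges_isRoot v).2 hv).isMinimal
    · obtain ⟨u, hu, -⟩ := exists_isEdge_of_lt (hr v fun h => hv (h ▸ hr))
      exact colorVertices_label i ((T.colorEdges_isEdge u v).2 hu) ⟨v, hu, T.le_refl v, rfl⟩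

/-- Recoloring the root with its own color. -/
def recolorRootSelf {T : ColForest Unit (Fin n) V} {r : V} (hr : T.IsRoot r) :
    (T.recolorRoot (T.label r)).Iso T where
  toEquiv := Equiv.refl V
  map_R _ _ _ := Iff.rfl
  map_label v := by
    show (if T.IsRoot v then T.label r else T.label v) = T.label v
    split_ifs with h
    · rw [h.eq hr]
    · rfl

/-- The vertex colors of a graft. -/
theorem graft_colorVertices [Finite A] [Finite B] {F : ColForest (Fin n) Unit A}
    {G : ColForest (Fin n) Unit B} (v : B) (i j : Fin n) :
    Nonempty (((F.graft G v j).colorVertices i).Iso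
      ((F.colorVertices j).graft (G.colorVertices i) v ())) := by
  refine ⟨⟨Equiv.refl _, fun e x y => ?_, fun x => ?_⟩⟩
  · show (F.graft G v j).lt x y ↔ _
    cases x with
    | inl a =>
      cases y with
      | inl b => exact Iff.rfl
      | inr b =>
        show (∃ c, (a = v ∧ c = j) ∨ G.R c a v) ↔ (a = v ∧ e = ()) ∨ G.lt a v
        constructor
        · rintro ⟨c, h | h⟩
          exacts [Or.inl ⟨h.1, rfl⟩, Or.inr ⟨c, h⟩]
        · rintro (h | ⟨c, h⟩)
          exacts [⟨j, Or.inl ⟨h.1, rfl⟩⟩, ⟨c, Or.inr h⟩]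
    | inr a =>
      cases y with
      | inl b => exact ⟨fun ⟨_, h⟩ => h, fun h => h.elim⟩
      | inr b => exact Iff.rfl
  · cases x with
    | inl a =>
      show _ = (G.colorVertices i).label a
      by_cases h : G.IsMinimal a
      · rw [colorVertices_label_of_isMinimal i h, colorVertices_label_of_isMinimal]
        rintro (b | b) ⟨e, he⟩
        exacts [h b ⟨e, he⟩, he]
      · obtain ⟨e, w, hw, hR⟩ := exists_isEdge_of_not_isMinimal h
        rw [colorVertices_label i hw hR]
        refine colorVertices_label (w := Sum.inl w) i ⟨⟨e, hR⟩, ?_⟩ hR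
        rintro (b | b) ⟨⟨c, hc⟩, ⟨c', hc'⟩⟩
        exacts [hw.2 b ⟨⟨c, hc⟩, ⟨c', hc'⟩⟩, hc']
    | inr a =>
      show _ = (F.colorVertices j).label a
      by_cases h : F.IsMinimal a
      · rw [colorVertices_label_of_isMinimal j h]
        -- The root of the upper tree is now the upper end of the new edge, so its label is the
        -- color `j` of that edge.
        refine colorVertices_label (w := Sum.inl v) i ⟨⟨j, Or.inl ⟨rfl, rfl⟩⟩, ?_⟩ (Or.inl ⟨rfl, rfl⟩)
        rintro (b | b) ⟨⟨c, hc⟩, ⟨c', hc'⟩⟩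
        · rcases hc' with ⟨rfl, -⟩ | hc'
          · exact G.irrefl _ _ hc
          · exact lt_asymm ⟨c, hc⟩ ⟨c', hc'⟩
        · exact h b ⟨c', hc'⟩
      · obtain ⟨e, w, hw, hR⟩ := exists_isEdge_of_not_isMinimal h
        rw [colorVertices_label j hw hR]
        refine colorVertices_label (w := Sum.inr w) i ⟨⟨e, hR⟩, ?_⟩ hR
        rintro (b | b) ⟨⟨c, hc⟩, ⟨c', hc'⟩⟩
        exacts [hc, hw.2 b ⟨⟨c, hc⟩, ⟨c', hc'⟩⟩]

end ColForest

/-! ### A vertex-colored tree as an edge-colored tree with a root color. -/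

variable {n : ℕ}

/-- The edge-colored tree of a vertex-colored tree. -/
def VTree.colorEdges (T : VTree n) : ETree n :=
  T.rep.colorEdges.toRTree (colorEdges_isTree T.rep_isTree)

/-- The color of the root. -/
def VTree.rootColor (T : VTree n) : Fin n := T.rep.label T.rep_isTree.choose

theorem VTree.size_colorEdges (T : VTree n) : T.colorEdges.size = T.size := by
  rw [VTree.colorEdges, size_toRTree, Nat.card_fin]

theorem colorVertices_toRTree {V : Type} [Finite V] {F : ColForest (Fin n) Unit V} (hF : F.IsTree)
    (i : Fin n) : ETree.colorVertices (F.toRTree hF) i =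
      (F.colorVertices i).toRTree (colorVertices_isTree hF i) := by
  obtain ⟨f⟩ := nonempty_iso_rep hF
  exact ((f.colorVertices i).toRTree_eq _ _).symm

/-- Passing to edge colors forgets the color of the root and nothing else. -/
theorem VTree.recolorRoot_eq (T : VTree n) (i : Fin n) :
    VTree.recolorRoot i T = ETree.colorVertices T.colorEdges i := by
  rw [VTree.colorEdges, colorVertices_toRTree]
  exact ((colorVerticesColorEdges T.rep_isTree i).toRTree_eq _ _).symm

theorem VTree.recolorRoot_rootColor (T : VTree n) : VTree.recolorRoot T.rootColor T = T := by
  conv_rhs => rw [← T.toRTree_rep]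
  exact (recolorRootSelf T.rep_isTree.choose_spec).toRTree_eq _ _

/-- So each vertex-colored tree is `t_i` for exactly one pair `(t, i)`; this determines the
coefficients of the embedding. -/
theorem colorVertices_eq_iff (t : ETree n) (i : Fin n) (T : VTree n) :
    ETree.colorVertices t i = T ↔ T.colorEdges = t ∧ T.rootColor = i := by
  constructor
  · intro h
    obtain ⟨f⟩ := (toRTree_eq_rtree_iff _ _).1 h
    constructor
    · exact (toRTree_eq_rtree_iff _ _).2 ⟨f.symm.colorEdges.trans (colorEdgesColorVertices _ _)⟩
    · obtain ⟨r, hr⟩ := t.rep_isTree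
      have hr' := (f.isRoot_iff r).1 ((colorVertices_isRoot _ i r).2 hr)
      rw [VTree.rootColor, T.rep_isTree.choose_spec.eq hr', ← f.map_label,
        colorVertices_label_of_isMinimal i hr.isMinimal]
  · rintro ⟨rfl, rfl⟩
    rw [← VTree.recolorRoot_eq, VTree.recolorRoot_rootColor]

/-! ## Counting grafts -/

section Count

variable {A B V W : Type} {n : ℕ}

theorem card_iso_of_nonempty {E L : Type} {K : ColForest E L V} {H : ColForest E L W}
    (h : Nonempty (K.Iso H)) : Nat.card (K.Iso H) = Nat.card (H.Iso H) := by
  obtain ⟨f⟩ := h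
  refine Nat.card_congr ⟨fun g => f.symm.trans g, fun g => f.trans g, fun g => ?_, fun g => ?_⟩
  · refine Iso.toEquiv_injective (Equiv.ext fun v => ?_)
    simp [Iso.trans, Iso.symm]
  · refine Iso.toEquiv_injective (Equiv.ext fun v => ?_)
    simp [Iso.trans, Iso.symm]

theorem card_iso_eq_ite {E L : Type} (K : ColForest E L V) (H : ColForest E L W) :
    Nat.card (K.Iso H) = if Nonempty (K.Iso H) then Nat.card (H.Iso H) else 0 := by
  split_ifs with h
  · exact card_iso_of_nonempty h
  · exact Nat.card_eq_zero.2 (Or.inl (not_nonempty_iff.1 h))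

/-- Expresses the count through automorphisms of the source; in `card_grafts` the target is a
varying subforest. -/
theorem card_iso_symm {E L : Type} (K : ColForest E L V) (H : ColForest E L W) :
    Nat.card (K.Iso H) = if Nonempty (K.Iso H) then Nat.card (K.Iso K) else 0 := by
  have h : Nat.card (K.Iso H) = Nat.card (H.Iso K) :=
    Nat.card_congr ⟨Iso.symm, Iso.symm, fun _ => rfl, fun _ => rfl⟩
  rw [h, card_iso_eq_ite]
  exact if_congr ⟨fun ⟨f⟩ => ⟨f.symm⟩, fun ⟨f⟩ => ⟨f.symm⟩⟩ rfl rfl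

/-- The bijections from the vertices of two forests to those of a third one that are isomorphisms to
complementary subforests, of which the second one is nowhere below the first one. -/
def Shuffle (F : ColForest (Fin n) Unit A) (G : ColForest (Fin n) Unit B)
    (H : ColForest (Fin n) Unit V) : Type :=
  {φ : B ⊕ A ≃ V // (∀ e x y, F.R e x y ↔ H.R e (φ (Sum.inr x)) (φ (Sum.inr y))) ∧
    (∀ e x y, G.R e x y ↔ H.R e (φ (Sum.inl x)) (φ (Sum.inl y))) ∧
    ∀ e x y, ¬ H.R e (φ (Sum.inr x)) (φ (Sum.inl y))}

variable (F : ColForest (Fin n) Unit A) (G : ColForest (Fin n) Unit B)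
  (H : ColForest (Fin n) Unit V)

/-- An isomorphism from a graft is a shuffle. -/
def graftToShuffle (a : Σ ve : B × Fin n, (F.graft G ve.1 ve.2).Iso H) : Shuffle F G H :=
  ⟨a.2.toEquiv, fun e x y => a.2.map_R e (Sum.inr x) (Sum.inr y),
    fun e x y => a.2.map_R e (Sum.inl x) (Sum.inl y),
    fun e x y h => (a.2.map_R e (Sum.inr x) (Sum.inl y)).2 h⟩

/-- A shuffle determines the grafting: the attaching vertex is the last vertex of the lower tree on
the path to the root of the upper one, and the color is that of the first edge from there. -/
theorem graftToShuffle_bijective [Finite B] (hF : F.IsTree) (hH : H.IsTree) (hB : Nonempty B) :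
    Function.Bijective (graftToShuffle F G H) := by
  obtain ⟨r, hr⟩ := hF
  constructor
  · rintro ⟨⟨v, e⟩, f⟩ ⟨⟨v', e'⟩, f'⟩ h
    have h : f.toEquiv = f'.toEquiv := congrArg Subtype.val h
    have key : ∀ {v v' : B} {e e' : Fin n} (f : (F.graft G v e).Iso H)
        (f' : (F.graft G v' e').Iso H), f.toEquiv = f'.toEquiv →
        (v = v' ∧ e = e') ∨ G.R e v v' := by
      intro v v' e e' f f' h
      have h1 : H.R e (f.toEquiv (Sum.inl v)) (f.toEquiv (Sum.inr r)) :=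
        (f.map_R e (Sum.inl v) (Sum.inr r)).1 (Or.inl ⟨rfl, rfl⟩)
      rw [h] at h1
      exact (f'.map_R e (Sum.inl v) (Sum.inr r)).2 h1
    rcases key f f' h with ⟨rfl, rfl⟩ | h1
    · rw [Iso.toEquiv_injective h]
    · rcases key f' f h.symm with ⟨rfl, rfl⟩ | h2
      · exact absurd h1 (G.irrefl _ _)
      · exact absurd ⟨e', h2⟩ (lt_asymm ⟨e, h1⟩)
  · rintro ⟨φ, h1, h2, h3⟩
    obtain ⟨s, hs⟩ := hH
    -- The root of `H` comes from the lower tree: a root in the upper tree would lie below a vertex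
    -- of the nonempty lower one, which shuffles exclude.
    have hBs : ∃ b, φ (Sum.inl b) = s := by
      obtain ⟨b | a, hb⟩ := φ.surjective s
      · exact ⟨b, hb⟩
      · obtain ⟨b⟩ := hB
        have hne : φ (Sum.inl b) ≠ s := by
          rw [← hb]
          exact φ.injective.ne (by simp)
        obtain ⟨e, he⟩ := hs _ hne
        rw [← hb] at he
        exact absurd he (h3 e a b)
    obtain ⟨b, rfl⟩ := hBs
    -- the maximal vertex of the lower tree below the root of the upper one
    have hbr : H.lt (φ (Sum.inl b)) (φ (Sum.inr r)) := hs _ (φ.injective.ne (by simp))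
    obtain ⟨v, hv, -, hmax⟩ :=
      G.exists_maximal_ge {b | H.lt (φ (Sum.inl b)) (φ (Sum.inr r))} hbr
    obtain ⟨j, hj⟩ := id hv
    have hra : ∀ a, H.le (φ (Sum.inr r)) (φ (Sum.inr a)) := fun a => by
      by_cases har : a = r
      · exact Or.inl (by rw [har])
      · obtain ⟨c, hc⟩ := hr a har
        exact Or.inr ⟨c, (h1 c r a).1 hc⟩
    refine ⟨⟨⟨v, j⟩, ⟨φ, fun e x y => ?_, fun _ => rfl⟩⟩, rfl⟩
    cases x with
    | inr x =>
      cases y with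
      | inr y => exact h1 e x y
      | inl y => exact ⟨fun h => h.elim, fun h => h3 e x y h⟩
    | inl x =>
      cases y with
      | inl y => exact h2 e x y
      | inr y =>
        show (x = v ∧ e = j) ∨ G.R e x v ↔ _
        constructor
        · rintro (⟨rfl, rfl⟩ | h)
          · exact R_of_le hj (hra y)
          · exact R_of_le ((h2 e x v).1 h) (Or.inr (lt_of_lt_of_le hv (hra y)))
        · intro h
          have hxr : H.lt (φ (Sum.inl x)) (φ (Sum.inr r)) := by
            rcases le_or_lt_of_le (Or.inr ⟨e, h⟩) (hra y) with (h' | h') | ⟨c, h'⟩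
            · exact absurd (φ.injective h') (by simp)
            · exact h'
            · exact absurd h' (h3 c r x)
          rcases le_or_lt_of_le (Or.inr hxr) (Or.inr hv) with (h' | ⟨c, h'⟩) | ⟨c, h'⟩
          · have hxv : x = v := by simpa using φ.injective h'
            subst hxv
            exact Or.inl ⟨rfl, H.color_unique _ _ _ _ h (R_of_le hj (hra y))⟩
          · refine Or.inr ((h2 e x v).2 ?_)
            exact R_of_lt_of_le ⟨c, h'⟩ (le_trans (Or.inr hv) (hra y)) h
          · exact absurd ⟨c, (h2 c v x).2 h'⟩ (hmax x hxr)

/-- Isomorphisms to complementary subforests form a shuffle. -/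
def isosToShuffle (a : Σ S : {S : Set V // IsUpper Finset.univ H S},
    F.Iso (H.sub S) × G.Iso (H.sub (S : Set V)ᶜ)) : Shuffle F G H :=
  ⟨((Equiv.sumComm B A).trans (Equiv.sumCongr a.2.1.toEquiv a.2.2.toEquiv)).trans
      (Equiv.Set.sumCompl (a.1 : Set V)),
    fun e x y => a.2.1.map_R e x y, fun e x y => a.2.2.map_R e x y,
    fun e x y h => (a.2.2.toEquiv y).2 ((a.1.2 e _ _ h).1 (a.2.1.toEquiv x).2)⟩

theorem isosToShuffle_bijective : Function.Bijective (isosToShuffle F G H) := by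
  constructor
  · rintro ⟨⟨S, hS⟩, f, g⟩ ⟨⟨S', hS'⟩, f', g'⟩ h
    have h := congrArg Subtype.val h
    have hf : ∀ x, (f.toEquiv x).1 = (f'.toEquiv x).1 := fun x => Equiv.congr_fun h (Sum.inr x)
    have hg : ∀ x, (g.toEquiv x).1 = (g'.toEquiv x).1 := fun x => Equiv.congr_fun h (Sum.inl x)
    have hSS : S = S' := by
      ext v
      constructor
      · intro hv
        have := (f'.toEquiv (f.toEquiv.symm ⟨v, hv⟩)).2
        rwa [← hf, Equiv.apply_symm_apply] at this
      · intro hv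
        have := (f.toEquiv (f'.toEquiv.symm ⟨v, hv⟩)).2
        rwa [hf, Equiv.apply_symm_apply] at this
    subst hSS
    have h1 : f = f' := Iso.toEquiv_injective (Equiv.ext fun x => Subtype.ext (hf x))
    have h2 : g = g' := Iso.toEquiv_injective (Equiv.ext fun x => Subtype.ext (hg x))
    rw [h1, h2]
  · rintro ⟨φ, h1, h2, h3⟩
    let S : Set V := {v | ∃ x, φ (Sum.inr x) = v}
    have hS' : ∀ y, φ (Sum.inl y) ∈ Sᶜ := by
      rintro y ⟨x, hx⟩
      simpa using φ.injective hx
    have hS : IsUpper Finset.univ H S := by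
      refine fun e w v hR => ⟨?_, fun _ _ => Finset.mem_univ e⟩
      rintro ⟨x, rfl⟩
      obtain ⟨y | y, rfl⟩ := φ.surjective v
      · exact absurd hR (h3 e x y)
      · exact ⟨y, rfl⟩
    let f : A ≃ S := Equiv.ofBijective (fun x => ⟨φ (Sum.inr x), x, rfl⟩)
      ⟨fun x y h => by simpa using h, by
        rintro ⟨_, x, rfl⟩
        exact ⟨x, rfl⟩⟩
    let g : B ≃ (Sᶜ : Set V) := Equiv.ofBijective (fun y => ⟨φ (Sum.inl y), hS' y⟩)
      ⟨fun x y h => by simpa using h, by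
        rintro ⟨v, hv⟩
        obtain ⟨y | y, rfl⟩ := φ.surjective v
        · exact ⟨y, rfl⟩
        · exact absurd ⟨y, rfl⟩ hv⟩
    refine ⟨⟨⟨S, hS⟩, ⟨f, h1, fun _ => rfl⟩, ⟨g, h2, fun _ => rfl⟩⟩, Subtype.ext (Equiv.ext ?_)⟩
    rintro (x | x) <;> rfl

/-- Both sides count the shuffles. On the left they are sorted by attaching vertex and color, each
admitting `|Aut H|` isomorphisms or none; on the right by the image `S` of `F`, each admitting `|Aut
F| |Aut G|` pairs or none. All colors are allowed, hence `Finset.univ`. -/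
theorem card_grafts [Fintype A] [Fintype B] [Fintype V] (hF : F.IsTree) (hG : G.IsTree)
    (hH : H.IsTree) :
    (∑ ve : B × Fin n, if Nonempty ((F.graft G ve.1 ve.2).Iso H) then 1 else 0) *
        Nat.card (H.Iso H) =
      (∑ S : Set V, if IsUpper Finset.univ H S then
        (if Nonempty (F.Iso (H.sub S)) then 1 else 0) *
          (if Nonempty (G.Iso (H.sub Sᶜ)) then 1 else 0) else 0) *
        (Nat.card (F.Iso F) * Nat.card (G.Iso G)) := by
  have h1 : Nat.card (Shuffle F G H) = (∑ ve : B × Fin n,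
      if Nonempty ((F.graft G ve.1 ve.2).Iso H) then 1 else 0) * Nat.card (H.Iso H) := by
    rw [← Nat.card_eq_of_bijective _ (graftToShuffle_bijective F G H hF hH ⟨hG.choose⟩),
      Nat.card_sigma, Finset.sum_mul]
    refine Finset.sum_congr rfl fun ve _ => ?_
    rw [card_iso_eq_ite, ite_mul, one_mul, zero_mul]
  rw [← h1, ← Nat.card_eq_of_bijective _ (isosToShuffle_bijective F G H), Nat.card_sigma,
    ← Finset.sum_filter, Finset.sum_mul]
  rw [Finset.sum_subtype (Finset.univ.filter fun S => IsUpper Finset.univ H S)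
    (p := fun S => IsUpper Finset.univ H S) (by simp)]
  refine Finset.sum_congr rfl fun S _ => ?_
  rw [Nat.card_prod, card_iso_symm F, card_iso_symm G, mul_mul_mul_comm]
  simp only [ite_mul, one_mul, zero_mul]

end Count

/-! ## The embedding into the free pre-Lie algebra -/

section Embedding

variable {k : Type*} [Field k] {n : ℕ} {V : Type} [Fintype V]

theorem dualTree_subElt (a : ETree n) (H : ColForest (Fin n) Unit V) (S : Set V) :
    dualTree k a (subElt k H S) = if Nonempty (a.rep.Iso (H.sub S)) then 1 else 0 := by
  have ha : a.rep.components = Finsupp.single a 1 := by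
    rw [a.rep_isTree.components_eq, a.toRTree_rep]
  have h : (H.sub S).components = Finsupp.single a 1 ↔ Nonempty (a.rep.Iso (H.sub S)) := by
    rw [← ha]
    exact ⟨fun h => nonempty_iso_of_components_eq h.symm, fun ⟨f⟩ => f.components_eq.symm⟩
  simp only [dualTree, subElt, forestElt, MvPolynomial.lcoeff_apply, MvPolynomial.coeff_monomial, h]

theorem star_dualTree_mul_autCard {q₁ q₂ : Fin n → k}
    (hq₁ : q₁ = fun j => if j ∈ Finset.univ then 1 else 0) (hq₂ : q₂ = fun _ => 0)
    (a b w : ETree n) :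
    star q₁ q₂ (dualTree k a) (dualTree k b) (MvPolynomial.X w) * (a.autCard * b.autCard) =
      (∑ ve : Fin b.size × Fin n,
        if Nonempty ((a.rep.graft b.rep ve.1 ve.2).Iso w.rep) then 1 else 0) * w.autCard := by
  have h := congrArg (Nat.cast : ℕ → k) (card_grafts a.rep b.rep w.rep a.rep_isTree b.rep_isTree
    w.rep_isTree)
  push_cast at h
  rw [star_X hq₁ hq₂, dualDistrib_coprod]
  simp only [dualTree_subElt]
  exact h.symm

theorem autCard_ne_zero [CharZero k] (t : ETree n) : (t.autCard : k) ≠ 0 := by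
  have : Nonempty (t.rep.Iso t.rep) := ⟨Iso.refl _⟩
  exact Nat.cast_ne_zero.2 Nat.card_pos.ne'

/-- The embedding of the primitive elements into the free pre-Lie algebra. -/
def embedding (k : Type*) [Field k] (n : ℕ) : primitives k n →ₗ[k] FreePreLie k n where
  -- The prescribed values on the `D_t` force this coefficient, because `T` occurs only in the image
  -- of `D_t` for its own edge-colored tree `t`.
  toFun f := Finsupp.ofSupportFinite
    (fun T => (T.colorEdges.autCard : k)⁻¹ * f.1 (MvPolynomial.X T.colorEdges)) (by
      obtain ⟨N, hN⟩ := f.2.1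
      refine (finite_size_lt N).subset fun T hT => ?_
      by_contra h
      refine hT ?_
      show _ * f.1 (MvPolynomial.monomial (Finsupp.single (VTree.colorEdges T) 1) 1) = 0
      rw [hN _ ?_, mul_zero]
      rw [numVertices_single, VTree.size_colorEdges]
      exact not_lt.1 h)
  map_add' f g := by
    ext T
    exact mul_add _ _ _
  map_smul' c f := by
    ext T
    exact mul_left_comm _ _ _

theorem embedding_apply (f : primitives k n) (T : VTree n) :
    embedding k n f T = (T.colorEdges.autCard : k)⁻¹ * f.1 (MvPolynomial.X T.colorEdges) := rfl

theorem embedding_primTree (t : ETree n) : embedding k n (primTree k t) =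
    (t.autCard : k)⁻¹ • ∑ i : Fin n, Finsupp.single (ETree.colorVertices t i) (1 : k) := by
  ext T
  have h1 : (primTree k t).1 (MvPolynomial.X T.colorEdges) = if T.colorEdges = t then 1 else 0 :=
    dualTree_X t T.colorEdges
  rw [embedding_apply, h1]
  simp only [Finsupp.smul_apply, Finsupp.finsetSum_apply, Finsupp.single_apply,
    colorVertices_eq_iff, smul_eq_mul]
  by_cases h : T.colorEdges = t
  · subst h
    simp
  · simp [h]

/-- The value of `f` on `t` is recovered, up to `|Aut(t)|`, from the coefficient of any `t_i`; at
least one color is needed for such a tree to exist. -/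
theorem embedding_injective [CharZero k] (hn : 0 < n) : Function.Injective (embedding k n) := by
  rw [injective_iff_map_eq_zero]
  intro f hf
  refine Subtype.ext (dual_ext_trees (fun m => apply_monomial_of_mem_primitives f.2)
    (fun _ _ => rfl) fun t => ?_)
  have h := DFunLike.congr_fun hf (ETree.colorVertices t ⟨0, hn⟩)
  rw [embedding_apply, ((colorVertices_eq_iff t _ _).1 rfl).1] at h
  exact (mul_eq_zero.1 h).resolve_left (inv_ne_zero (autCard_ne_zero t))

/-- Up to the nonzero factor `|Aut(t)|`, the images of the `D_t` are the sums over `r_i(T)`, as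
`r_i(T) = t_i` for the edge-colored tree `t` of `T`. -/
theorem embedding_range [CharZero k] (hn : 0 < n) :
    LinearMap.range (embedding k n) = Submodule.span k (Set.range fun T : VTree n =>
      ∑ i : Fin n, Finsupp.single (VTree.recolorRoot i T) (1 : k)) := by
  rw [LinearMap.range_eq_map, ← span_primTree, Submodule.map_span]
  refine le_antisymm (Submodule.span_le.2 ?_) (Submodule.span_le.2 ?_)
  · rintro _ ⟨_, ⟨t, rfl⟩, rfl⟩
    rw [embedding_primTree]
    refine Submodule.smul_mem _ _ (Submodule.subset_span ⟨ETree.colorVertices t ⟨0, hn⟩, ?_⟩)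
    simp only [VTree.recolorRoot_eq, ((colorVertices_eq_iff t _ _).1 rfl).1]
  · rintro _ ⟨T, rfl⟩
    have h : (∑ i : Fin n, Finsupp.single (VTree.recolorRoot i T) (1 : k)) =
        (T.colorEdges.autCard : k) • embedding k n (primTree k T.colorEdges) := by
      rw [embedding_primTree, smul_smul, mul_inv_cancel₀ (autCard_ne_zero _), one_smul]
      simp only [VTree.recolorRoot_eq]
    show (∑ i : Fin n, Finsupp.single (VTree.recolorRoot i T) (1 : k)) ∈ _
    rw [h]
    exact Submodule.smul_mem _ _ (Submodule.subset_span ⟨_, ⟨_, rfl⟩, rfl⟩)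

theorem graftProduct_colorVertices (a b : ETree n) (i j : Fin n) :
    graftProduct k n (Finsupp.single (ETree.colorVertices b i) 1)
      (Finsupp.single (ETree.colorVertices a j) 1) =
      ∑ v : Fin b.size, Finsupp.single (ETree.colorVertices
        ((a.rep.graft b.rep v j).toRTree (graft_isTree b.rep_isTree v j)) i) 1 := by
  refine (graftProduct_treeElt (colorVertices_isTree b.rep_isTree i)
    (colorVertices_isTree a.rep_isTree j)).trans (Finset.sum_congr rfl fun v _ => ?_)
  obtain ⟨f⟩ := graft_colorVertices (F := a.rep) (G := b.rep) v i j
  rw [colorVertices_toRTree]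
  exact treeElt_eq f.symm _ _

/-- Comparing coefficients of `T` leaves the count of pairs of an attaching vertex and an edge color
that produce the edge-colored tree of `T`; `star_dualTree_mul_autCard` converts it into the
coefficient of `*`. -/
theorem embedding_star [CharZero k] {q₁ q₂ : Fin n → k}
    (hq₁ : q₁ = fun j => if j ∈ Finset.univ then 1 else 0) (hq₂ : q₂ = fun _ => 0) (a b : ETree n) :
    embedding k n (primMul hq₁ hq₂ (primTree k a) (primTree k b)) =
      graftProduct k n (embedding k n (primTree k b)) (embedding k n (primTree k a)) := by
  ext T
  rw [embedding_apply, embedding_primTree, embedding_primTree, primMul_apply]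
  simp only [map_smul, map_sum, LinearMap.smul_apply, LinearMap.sum_apply,
    graftProduct_colorVertices, Finsupp.smul_apply, Finsupp.finsetSum_apply, Finsupp.single_apply,
    colorVertices_eq_iff, smul_eq_mul]
  have h := star_dualTree_mul_autCard hq₁ hq₂ a b T.colorEdges
  -- The index `j` is the root color of the lower tree and must be that of `T`; the index `i` is the
  -- root color of the upper tree, hence the color of the new edge.
  have hsum : (∑ i, ∑ j, ∑ v : Fin b.size, if T.colorEdges = (a.rep.graft b.rep v i).toRTree
      (graft_isTree b.rep_isTree v i) ∧ T.rootColor = j then (1 : k) else 0) =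
      ∑ ve : Fin b.size × Fin n,
        if Nonempty ((a.rep.graft b.rep ve.1 ve.2).Iso T.colorEdges.rep) then 1 else 0 := by
    rw [Fintype.sum_prod_type_right]
    refine Finset.sum_congr rfl fun j _ => ?_
    rw [Finset.sum_comm]
    refine Finset.sum_congr rfl fun v _ => ?_
    rw [Finset.sum_eq_single_of_mem T.rootColor (Finset.mem_univ _)]
    · refine if_congr ?_ rfl rfl
      rw [← toRTree_eq_rtree_iff (graft_isTree b.rep_isTree v j), and_iff_left rfl, eq_comm]
    · exact fun i _ hi => if_neg fun h => hi h.2.symm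
  simp only [← Finset.mul_sum]
  rw [hsum]
  have ha := autCard_ne_zero (k := k) a
  have hb := autCard_ne_zero (k := k) b
  have hT := autCard_ne_zero (k := k) T.colorEdges
  show (T.colorEdges.autCard : k)⁻¹ * star q₁ q₂ (dualTree k a) (dualTree k b)
    (MvPolynomial.X T.colorEdges) = _
  rw [inv_mul_eq_iff_eq_mul₀ hT, ← mul_left_inj' (mul_ne_zero ha hb), h]
  field_simp

theorem embedding_primMul [CharZero k] {q₁ q₂ : Fin n → k}
    (hq₁ : q₁ = fun j => if j ∈ Finset.univ then 1 else 0) (hq₂ : q₂ = fun _ => 0)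
    (f g : primitives k n) : embedding k n ((primMul hq₁ hq₂).flip f g) =
      graftProduct k n (embedding k n f) (embedding k n g) := by
  have h : (primMul hq₁ hq₂).flip.compr₂ (embedding k n) =
      (graftProduct k n).compl₁₂ (embedding k n) (embedding k n) := by
    refine LinearMap.ext_on_range span_primTree fun b => ?_
    refine LinearMap.ext_on_range span_primTree fun a => ?_
    exact embedding_star hq₁ hq₂ a b
  exact LinearMap.congr_fun (LinearMap.congr_fun h f) g

end Embedding

end ColoredTrees

end

/-! ### The main theorem. -/

open ColoredTrees in
theorem mainTheorem5 {k : Type*} [Field k] (n : ℕ) (p : Finset (Fin n))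
    (q₁ q₂ : Fin n → k) (hq₁ : q₁ = fun j => if j ∈ p then 1 else 0) (hq₂ : q₂ = fun _ => 0) :
    -- the coproduct
    (∃ Δ : TreeAlg k n →ₐ[k] TreeAlg k n ⊗[k] TreeAlg k n,
      IsCoproduct q₁ q₂ Δ ∧
      (∀ Δ', IsCoproduct q₁ q₂ Δ' → Δ' = Δ) ∧
      (∀ t : ETree n,
        Δ (MvPolynomial.X t) = MvPolynomial.X t ⊗ₜ[k] 1 + cutSum k p t) ∧
      -- the operation `*` is the truncation to trees of the product dual to `Δ`
      (∀ (f g : Module.Dual k (TreeAlg k n)) (t : ETree n),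
        star q₁ q₂ f g (MvPolynomial.X t) =
          TensorProduct.dualDistrib k (TreeAlg k n) (TreeAlg k n) (f ⊗ₜ[k] g)
            (Δ (MvPolynomial.X t)))) ∧
    -- the elements `D_t` form a basis of the space of primitive elements
    LinearIndependent k (primTree k (n := n)) ∧
    Submodule.span k (Set.range (primTree k (n := n))) = ⊤ ∧
    -- the pre-Lie algebra of primitive elements and its embedding
    ∃ mul : primitives k n →ₗ[k] primitives k n →ₗ[k] primitives k n,
      (∀ f g : primitives k n,
        (mul f g : Module.Dual k (TreeAlg k n)) = star q₁ q₂ (f : Module.Dual k (TreeAlg k n)) g) ∧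
      IsRightPreLie (k := k) (A := primitives k n) mul.flip ∧
      (0 < n → CharZero k → p = Finset.univ →
        IsRightPreLie (graftProduct k n) ∧
        ∃ Φ : primitives k n →ₗ[k] FreePreLie k n,
          (∀ t : ETree n, Φ (primTree k t) =
            (t.autCard : k)⁻¹ • ∑ i : Fin n, Finsupp.single (ETree.colorVertices t i) (1 : k)) ∧
          (∀ f g : primitives k n, Φ (mul.flip f g) = graftProduct k n (Φ f) (Φ g)) ∧
          Function.Injective Φ ∧
          LinearMap.range Φ = Submodule.span k (Set.range fun T : VTree n =>
            ∑ i : Fin n, Finsupp.single (VTree.recolorRoot i T) (1 : k))) := by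
  refine ⟨⟨coprodHom k p, coprodHom_isCoproduct hq₁ hq₂,
    fun Δ' h => (coprodHom_isCoproduct hq₁ hq₂).unique h, coprodHom_X_eq_cutSum, fun f g t => ?_⟩,
    linearIndependent_primTree, span_primTree, primMul hq₁ hq₂, primMul_apply hq₁ hq₂,
    primMul_flip_isRightPreLie hq₁ hq₂, fun hn hk hp => ?_⟩
  · rw [coprodHom_X, star_X hq₁ hq₂]
  · subst hp
    exact ⟨graftProduct_isRightPreLie, embedding k n, embedding_primTree, embedding_primMul hq₁ hq₂,
      embedding_injective hn, embedding_range hn⟩
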